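/- Let $(\Omega,\mathcal F,(\mathcal F_t)_{t\ge 0},\mathbb P)$ be a filtered probability space satisfying the usual conditions, with $\mathcal F_0$ $\mathbb P$-trivial. All processes are identified up to indistinguishability, and inequalities between processes are understood almost surely for all $t\ge 0$. Let $\theta\in(0,1)$ and $\rho=\frac{\theta-1}{\theta}<0$. **Notation.** For $u,w\in[0,\infty]$ let $h_{EZ}(u,w)=u\,w^{\rho}$ if $u,w\in(0,\infty)$; $h_{EZ}(u,w)=w^\rho$ if $u\in(0,\infty)$ and $w\in\{0,\infty\}$ (with $0^\rho=\infty$, $\infty^\rho=0$); and $h_{EZ}(u,w)=u$ if $u\in\{0,\infty\}$. For a nonnegative progressively measurable process $U$, let $\mathbb I(h_{EZ},U)$ be the set of progressively measurable $[0,\infty]$-valued processes $W$ with $\mathbb E\int_0^\infty h_{EZ}(U_s,W_s)\,ds<\infty$, and for such $W$ let $F_U(W)$ be the càdlàg version of $$F_U(W)_t=\mathbb E\Big[\int_t^\infty h_{EZ}(U_s,W_s)\,ds\,\Big|\,\mathcal F_t\Big],\qquad t\ge 0.$$ Let $\hat L^\theta_{++}$ be the set of strictly positive progressively measurable processes $\Lambda$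 with $\mathbb E\int_0^\infty\Lambda_s^\theta\,ds<\infty$ for which there are constants $k,K\in(0,\infty)$ with $k I^\Lambda\le\Lambda^\theta\le K I^\Lambda$, where $I^\Lambda$ is the càdlàg version of $I^\Lambda_t=\mathbb E[\int_t^\infty\Lambda_s^\theta\,ds\mid\mathcal F_t]$. **(i)** Let $\Lambda\in\hat L^\theta_{++}$, and let $U$ be a nonnegative progressively measurable process such that $0\le U\le K\Lambda$ for some constant $K\in[0,\infty)$. Then $F_U$ has a unique fixed point $W\in\mathbb I(h_{EZ},U)$. **(ii)** Let $b>0$, $\delta\in\mathbb R$ and $R,S\in(0,\infty)\setminus\{1\}$ with $\frac{1-R}{1-S}=\theta$ (so that $\rho=\frac{S-R}{1-R}$), and let $$g_{EZ}(t,c,v)=b\,e^{-\delta t}\,\frac{c^{1-S}}{1-S}\,\big((1-R)v\big)^{\rho},\qquad c\ge 0,\ v\in\mathbb V:=(1-R)[0,\infty),$$ where $c^{1-S}$, $((1-R)v)^\rho$ and their product are formed in $[0,\infty]$ with $0^{a}=\infty$ for $a<0$ and $0\cdot\infty=0$. Let $B$ be an $(\mathcal F_t)$-Brownian motion, $r,\mu\in\mathbb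 R$, $\sigma>0$, $x>0$, $\lambda=\frac{\mu-r}{\sigma}$, and suppose that $\eta=\frac1S\big(\delta+(S-1)r+(S-1)\frac{\lambda^2}{2R}\big)>0$. Let $\hat C=\eta\hat X$ be the candidate optimal consumption in the Black--Scholes--Merton market with these parameters, where, with $\hat\pi=\frac{\lambda}{\sigma R}$, $$\hat X_t=x\exp\Big(\hat\pi\sigma B_t+\big(r+\hat\pi(\mu-r)-\eta-\tfrac12\hat\pi^2\sigma^2\big)t\Big).$$ Let $C$ be a nonnegative progressively measurable process such that $C^{1-S}\le K\hat C^{1-S}$ for some constant $K\in[0,\infty)$. Then $C$ is uniquely evaluable for $g_{EZ}$: there is, up to indistinguishability, exactly one $\mathbb V$-valued progressively measurable process $V$ with càdlàg paths such that $\mathbb E\int_0^\infty|g_{EZ}(s,C_s,V_s)|\,ds<\infty$ and $$V_t=\mathbb E\Big[\int_t^\infty g_{EZ}(s,C_s,V_s)\,ds\,\Big|\,\mathcal F_t\Big]\qquad\text{for all }t\ge 0.$$ -/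

import Mathlib

open Set Filter Topology MeasureTheory ProbabilityTheory
open scoped NNReal ENNReal

namespace EpsteinZin

noncomputable section

/-! ### Processes on a filtered probability space, with time set `[0, ∞)` -/

/-- The standing assumptions on the filtered probability space: the usual conditions
(right-continuity, and `𝓕 0` contains all null sets), and `𝓕 0` is trivial. -/
structure IsStochasticBasis {Ω : Type*} {m : MeasurableSpace Ω} (𝓕 : Filtration ℝ≥0 m)
    (P : Measure Ω) : Prop where
  rightContinuous : 𝓕.IsRightContinuous
  complete : ∀ s : Set Ω, P s = 0 → MeasurableSet[𝓕 0] s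
  trivial_zero : ∀ s : Set Ω, MeasurableSet[𝓕 0] s → P s = 0 ∨ P s = 1

/-- Two processes are indistinguishable. -/
def Indistinguishable {Ω E : Type*} {m : MeasurableSpace Ω} (P : Measure Ω)
    (X Y : ℝ≥0 → Ω → E) : Prop :=
  ∀ᵐ ω ∂P, ∀ t, X t ω = Y t ω

/-- Lebesgue measure on the time set `[0, ∞)`. -/
def leb : Measure ℝ≥0 := Measure.comap ((↑) : ℝ≥0 → ℝ) volume

/-- A càdlàg path: right-continuous with left limits in `E`.  (At `t = 0` the filter `𝓝[<] t` is
`⊥`, so that nothing is required from the left.) -/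
def IsCadlag {E : Type*} [TopologicalSpace E] (f : ℝ≥0 → E) : Prop :=
  ∀ t, ContinuousWithinAt f (Ioi t) t ∧ ∃ l, Tendsto f (𝓝[<] t) (𝓝 l)

/-- `X` is a (finite-valued) càdlàg adapted version of the process
`t ↦ E[∫_t^∞ Y_s ds | 𝓕_t]`, where `Y` takes values in `[0, ∞]`. -/
structure IsCadlagTailExp {Ω : Type*} {m : MeasurableSpace Ω} (𝓕 : Filtration ℝ≥0 m)
    (P : Measure Ω) (Y : ℝ≥0 → Ω → ℝ≥0∞) (X : ℝ≥0 → Ω → ℝ≥0) : Prop where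
  adapted : Adapted 𝓕 X
  cadlag : ∀ ω, IsCadlag fun t => X t ω
  version : ∀ t, (fun ω => (X t ω : ℝ≥0∞)) =ᵐ[P]
    condLExp (𝓕 t) P (fun ω => ∫⁻ s in Ici t, Y s ω ∂leb)

/-- The nonnegative process `X` has the same order as the nonnegative process `Y`:
`k Y ≤ X ≤ K Y` for some constants `k, K ∈ (0, ∞)`. -/
def SameOrder {Ω : Type*} {m : MeasurableSpace Ω} (P : Measure Ω)
    (X Y : ℝ≥0 → Ω → ℝ≥0) : Prop :=
  ∃ k K : ℝ≥0, 0 < k ∧ 0 < K ∧ ∀ᵐ ω ∂P, ∀ t, k * Y t ω ≤ X t ω ∧ X t ω ≤ K * Y t ω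

/-- The class `L^θ_{++}`: positive progressively measurable `Λ` with `E ∫_0^∞ Λ_s^θ ds < ∞`. -/
structure MemL {Ω : Type*} {m : MeasurableSpace Ω} (𝓕 : Filtration ℝ≥0 m) (P : Measure Ω)
    (θ : ℝ) (Λ : ℝ≥0 → Ω → ℝ≥0) : Prop where
  progressive : IsProgressive 𝓕 Λ
  pos : ∀ᵐ ω ∂P, ∀ t, 0 < Λ t ω
  integrable : ∫⁻ ω, ∫⁻ s, ((Λ s ω ^ θ : ℝ≥0) : ℝ≥0∞) ∂leb ∂P < ∞

/-- The class `L̂^θ_{++}`: those `Λ ∈ L^θ_{++}` for which `Λ^θ` has the same order as the càdlàg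
process `I^Λ_t = E[∫_t^∞ Λ_s^θ ds | 𝓕_t]`. -/
structure MemLHat {Ω : Type*} {m : MeasurableSpace Ω} (𝓕 : Filtration ℝ≥0 m) (P : Measure Ω)
    (θ : ℝ) (Λ : ℝ≥0 → Ω → ℝ≥0) : Prop extends MemL 𝓕 P θ Λ where
  sameOrder : ∃ I : ℝ≥0 → Ω → ℝ≥0,
    IsCadlagTailExp 𝓕 P (fun s ω => ((Λ s ω ^ θ : ℝ≥0) : ℝ≥0∞)) I ∧
    SameOrder P (fun t ω => Λ t ω ^ θ) I

/-! ### The transformed aggregator and the operator `F_U` -/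

/-- The transformed Epstein--Zin aggregator on `[0, ∞]²`; here `0 ^ ρ = ∞` and `∞ ^ ρ = 0` for
`ρ < 0`, as in `ENNReal.rpow`. -/
def hEZ (ρ : ℝ) (u w : ℝ≥0∞) : ℝ≥0∞ :=
  if u = 0 ∨ u = ∞ then u
  else if w = 0 ∨ w = ∞ then w ^ ρ
  else u * w ^ ρ

/-- `W ∈ 𝕀(h_EZ, U)`. -/
structure MemIh {Ω : Type*} {m : MeasurableSpace Ω} (𝓕 : Filtration ℝ≥0 m) (P : Measure Ω)
    (ρ : ℝ) (U W : ℝ≥0 → Ω → ℝ≥0∞) : Prop where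
  progressive : IsProgressive 𝓕 W
  integrable : ∫⁻ ω, ∫⁻ s, hEZ ρ (U s ω) (W s ω) ∂leb ∂P < ∞

/-- `X = F_U(W)`, i.e. `X` is a càdlàg version of `t ↦ E[∫_t^∞ h_EZ(U_s, W_s) ds | 𝓕_t]`. -/
def IsFU {Ω : Type*} {m : MeasurableSpace Ω} (𝓕 : Filtration ℝ≥0 m) (P : Measure Ω)
    (ρ : ℝ) (U W : ℝ≥0 → Ω → ℝ≥0∞) (X : ℝ≥0 → Ω → ℝ≥0) : Prop :=
  IsCadlagTailExp 𝓕 P (fun s ω => hEZ ρ (U s ω) (W s ω)) X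

/-- `W ∈ 𝕀(h_EZ, U)` and `W = F_U(W)` (up to indistinguishability). -/
def IsFixedPointFU {Ω : Type*} {m : MeasurableSpace Ω} (𝓕 : Filtration ℝ≥0 m) (P : Measure Ω)
    (ρ : ℝ) (U W : ℝ≥0 → Ω → ℝ≥0∞) : Prop :=
  MemIh 𝓕 P ρ U W ∧
    ∃ X : ℝ≥0 → Ω → ℝ≥0, IsFU 𝓕 P ρ U W X ∧ Indistinguishable P W (fun t ω => (X t ω : ℝ≥0∞))

/-! ### Utility processes and evaluable consumption streams -/

/-- `V` is a utility process associated to the pair `(g, C)`, for an aggregator `g` whose third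
argument ranges over `𝕍 ⊆ ℝ`: `V` is a progressive `𝕍`-valued process with càdlàg paths,
`E ∫_0^∞ |g(s, C_s, V_s)| ds < ∞`, and `V_t = E[∫_t^∞ g(s, C_s, V_s) ds | 𝓕_t]` for all `t`.
(By the integrability condition, `g(s, C_s, V_s)` is finite for almost all `(s, ω)`.) -/
structure IsUtilityProcess {Ω : Type*} {m : MeasurableSpace Ω} (𝓕 : Filtration ℝ≥0 m)
    (P : Measure Ω) (𝕍 : Set ℝ) (g : ℝ≥0 → ℝ≥0 → ℝ → EReal)
    (C : ℝ≥0 → Ω → ℝ≥0) (V : ℝ≥0 → Ω → ℝ) : Prop where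
  progressive : IsProgressive 𝓕 V
  mem : ∀ᵐ ω ∂P, ∀ t, V t ω ∈ 𝕍
  integrable : ∫⁻ ω, ∫⁻ s, (g s (C s ω) (V s ω)).abs ∂leb ∂P < ∞
  cadlag : ∀ᵐ ω ∂P, IsCadlag fun t => V t ω
  eq : ∀ t, V t =ᵐ[P] P[fun ω => ∫ s in Ici t, (g s (C s ω) (V s ω)).toReal ∂leb | 𝓕 t]

/-- The consumption stream `C` is `g`-uniquely evaluable: there is a utility process associated
to `(g, C)`, and it is unique up to indistinguishability. -/
def UniquelyEvaluable {Ω : Type*} {m : MeasurableSpace Ω} (𝓕 : Filtration ℝ≥0 m)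
    (P : Measure Ω) (𝕍 : Set ℝ) (g : ℝ≥0 → ℝ≥0 → ℝ → EReal) (C : ℝ≥0 → Ω → ℝ≥0) : Prop :=
  (∃ V, IsUtilityProcess 𝓕 P 𝕍 g C V) ∧
    ∀ V V', IsUtilityProcess 𝓕 P 𝕍 g C V → IsUtilityProcess 𝓕 P 𝕍 g C V' →
      Indistinguishable P V V'

/-- The domain `𝕍 = (1 - R) [0, ∞)` of Epstein--Zin utility processes. -/
def domEZ (R : ℝ) : Set ℝ := {v | 0 ≤ (1 - R) * v}

/-- The (discounted form of the) Epstein--Zin aggregator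
`g_EZ(t, c, v) = b e^{-δ t} c^{1-S} / (1-S) * ((1-R) v)^ρ` with `ρ = (S-R)/(1-R)`.
Both powers and their product are formed in `[0, ∞]`, so `0` to a negative power is `∞`, and
`0 * ∞ = 0`. -/
def gEZ (b δ R S : ℝ) (t c : ℝ≥0) (v : ℝ) : EReal :=
  ((b * Real.exp (-δ * t) / (1 - S) : ℝ) : EReal) *
    (((c : ℝ≥0∞) ^ (1 - S) * ENNReal.ofReal ((1 - R) * v) ^ ((S - R) / (1 - R)) : ℝ≥0∞) : EReal)

/-! ### The Black--Scholes--Merton market and the candidate optimal consumption -/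

/-- `B` is a standard Brownian motion with respect to the filtration `𝓕`. -/
structure IsFBrownian {Ω : Type*} {m : MeasurableSpace Ω} (𝓕 : Filtration ℝ≥0 m)
    (P : Measure Ω) (B : ℝ≥0 → Ω → ℝ) : Prop extends IsBrownianReal B P where
  adapted : Adapted 𝓕 B
  indep : ∀ s t, s ≤ t →
    Indep (𝓕 s) (MeasurableSpace.comap (fun ω => B t ω - B s ω) inferInstance) P

/-- The wealth process for initial wealth `x` when a constant proportion `p` of wealth is invested
in the risky asset and wealth is consumed at the constant proportional rate `ξ`, i.e. the
geometric Brownian motion solving `dX = X p σ dB + X (r + p (μ - r) - ξ) dt`, `X_0 = x`. -/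
def wealthConst {Ω : Type*} (r μ σ x p ξ : ℝ) (B : ℝ≥0 → Ω → ℝ) (t : ℝ≥0) (ω : Ω) : ℝ :=
  x * Real.exp (p * σ * B t ω + (r + p * (μ - r) - ξ - p ^ 2 * σ ^ 2 / 2) * t)

/-- `η = (δ + (S-1) r + (S-1) λ² / (2R)) / S` with the Sharpe ratio `λ = (μ - r) / σ`. -/
def etaEZ (δ R S r μ σ : ℝ) : ℝ :=
  1 / S * (δ + (S - 1) * r + (S - 1) * ((μ - r) / σ) ^ 2 / (2 * R))

/-- The candidate optimal consumption stream `Ĉ = η X̂`, where `X̂` is the wealth process for the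
constant proportions `π̂ = λ / (σ R)` and `ξ̂ = η`. -/
def candidateC {Ω : Type*} (δ R S r μ σ x : ℝ) (B : ℝ≥0 → Ω → ℝ) (t : ℝ≥0) (ω : Ω) : ℝ :=
  etaEZ δ R S r μ σ *
    wealthConst r μ σ x ((μ - r) / σ / (σ * R)) (etaEZ δ R S r μ σ) B t ω

end

end EpsteinZin

open EpsteinZin

namespace EpsteinZin

noncomputable section

/-! ### Lebesgue measure on the time set -/

/-! Both parts come down to the backward equation `X_t = E[∫_t^∞ U_s X_s^ρ ds | 𝓕_t]` with `ρ < 0`,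
whose driver is decreasing in `X`.

Uniqueness is a comparison principle (`IsCadlagTailExp.le_of_imp`): if `X`, `X'` are the tail
expectations of `Y`, `Y'`, and `Y ≤ Y'` wherever `X' ≤ X`, then `X ≤ X'`. It replaces Tanaka's
formula by a grid argument. Over a short interval `[t, u)`, the quantity `E (X_t - X'_t)⁺` exceeds
`E (X_u - X'_u)⁺` by at most the integral of `(Y - Y')⁺` over the event `X'_t < X_t`. Summing over a
grid and refining the mesh, the total error vanishes, because a càdlàg path has only countably many
downward jumps.

Existence cannot be iterated directly, since the driver is singular at `0`. Perturb it to `Φ(w) = U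
w^ρ + ε Λ^θ`. With `I` the tail expectation of `Λ^θ`, the bounds `U ≤ KΛ` and `Λ^θ ≍ I`, together
with `1 + θρ = θ`, make `εI` a subsolution and `CI` a supersolution. Moreover `1 + θ(ρ-1) = 0`, so
above `εI` the slope of `Φ` is bounded below by a constant `-L`. The equation is equivalent to the
one for `e^{-Lt} X_t` with driver `e^{-Ls} (Φ(X_s) + L X_s)` (`IsTail.discount`,
`IsTail.of_discount`); this driver is increasing between the two barriers, so monotone iteration
from `εI` converges (`exists_isTail_of_sub_super`). By comparison the solutions decrease as `ε`
decreases, and their limit solves the original equation.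

For the utility processes, put `X = (1-R)V` and `U = θ b e^{-δt} C^{1-S}`. The dominating process `θ
b e^{-δt} Ĉ^{1-S}` is a geometric Brownian motion whose `θ`-th power decays in conditional mean at
the rate `θη > 0`; hence its tail expectation is an explicit multiple of that power.

The càdlàg versions come from Doob's regularization: the maximal and upcrossing inequalities along
dyadic times give one-sided limits (`exists_cadlag_condExp`). -/

lemma isClosedEmbedding_coe_nnreal : IsClosedEmbedding ((↑) : ℝ≥0 → ℝ) :=
  (isClosed_Ici (a := (0 : ℝ))).isClosedEmbedding_subtypeVal

instance : IsFiniteMeasureOnCompacts leb :=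
  IsFiniteMeasureOnCompacts.comap' volume NNReal.continuous_coe
    isClosedEmbedding_coe_nnreal.measurableEmbedding

instance : SigmaFinite leb := inferInstance

instance : NullSingletonClass leb where
  measure_singleton x := by
    rw [leb, isClosedEmbedding_coe_nnreal.measurableEmbedding.comap_apply]
    simp

lemma lintegral_leb (f : ℝ → ℝ≥0∞) :
    ∫⁻ s, f (s : ℝ≥0) ∂leb = ∫⁻ x in Ici (0 : ℝ), f x :=
  lintegral_subtype_comap (s := Ici (0 : ℝ)) measurableSet_Ici f

lemma setLIntegral_leb {A : Set ℝ} (hA : MeasurableSet A) (f : ℝ → ℝ≥0∞) :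
    ∫⁻ s in ((↑) : ℝ≥0 → ℝ) ⁻¹' A, f (s : ℝ≥0) ∂leb = ∫⁻ x in Ici (0 : ℝ) ∩ A, f x := by
  rw [← lintegral_indicator (by measurability)]
  have := lintegral_leb (A.indicator f)
  rw [setLIntegral_indicator hA, inter_comm] at this
  exact this

/-! ### Dyadic times -/

/-- The dyadic time `k / 2 ^ n`. -/
def dyadic (n k : ℕ) : ℝ≥0 := k / 2 ^ n

/-- The set of dyadic times of level `n`. -/
def dyadicGrid (n : ℕ) : Set ℝ≥0 := range (dyadic n)

/-- The smallest dyadic time of level `n` after `t`. -/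
def dyadicUp (n : ℕ) (t : ℝ≥0) : ℝ≥0 := dyadic n (⌊t * 2 ^ n⌋₊ + 1)

lemma dyadic_mono (n : ℕ) : Monotone (dyadic n) := fun i j h => by
  unfold dyadic; gcongr

lemma dyadicGrid_mono : Monotone dyadicGrid := by
  refine monotone_nat_of_le_succ fun n => ?_
  rintro _ ⟨k, rfl⟩
  refine ⟨2 * k, ?_⟩
  simp only [dyadic, pow_succ]
  push_cast
  field_simp

lemma lt_dyadicUp (n : ℕ) (t : ℝ≥0) : t < dyadicUp n t := by
  unfold dyadicUp dyadic
  rw [lt_div_iff₀ (by positivity)]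
  exact_mod_cast Nat.lt_floor_add_one (t * 2 ^ n)

lemma dyadicUp_le (n : ℕ) (t : ℝ≥0) : dyadicUp n t ≤ t + (1 / 2) ^ n := by
  unfold dyadicUp dyadic
  rw [div_le_iff₀ (by positivity), add_mul, ← mul_pow]
  have : (⌊t * 2 ^ n⌋₊ : ℝ≥0) ≤ t * 2 ^ n := Nat.floor_le (by positivity)
  simpa using this

lemma tendsto_dyadicUp (t : ℝ≥0) : Tendsto (fun n => dyadicUp n t) atTop (𝓝[>] t) := by
  refine tendsto_nhdsWithin_iff.2 ⟨?_, Eventually.of_forall fun n => lt_dyadicUp n t⟩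
  refine tendsto_of_tendsto_of_tendsto_of_le_of_le tendsto_const_nhds ?_
    (fun n => (lt_dyadicUp n t).le) (fun n => dyadicUp_le n t)
  have : Tendsto (fun n : ℕ => ((1 : ℝ≥0) / 2) ^ n) atTop (𝓝 0) :=
    tendsto_pow_atTop_nhds_zero_of_lt_one (by positivity)
      (by rw [div_lt_one (by positivity)]; norm_num)
  simpa using this.const_add t

lemma dyadicUp_mem (n : ℕ) (t : ℝ≥0) : dyadicUp n t ∈ dyadicGrid n := ⟨_, rfl⟩

/-! ### Progressive processes -/

section Progressive

variable {Ω E : Type*} {m : MeasurableSpace Ω} {𝓕 : Filtration ℝ≥0 m}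

/-- On `{p.1 ≤ n}` the map agrees with the process stopped at time `n`, which factors through `[0,
n] × Ω`; these sets exhaust the product. -/
lemma measurable_uncurry_of_isProgressive [MeasurableSpace E] {u : ℝ≥0 → Ω → E}
    (hu : IsProgressive 𝓕 u) : Measurable fun p : ℝ≥0 × Ω => u p.1 p.2 := by
  intro S hS
  have key : (fun p : ℝ≥0 × Ω => u p.1 p.2) ⁻¹' S =
      ⋃ n : ℕ, {p : ℝ≥0 × Ω | p.1 ≤ (n : ℝ≥0)} ∩
        (fun p : ℝ≥0 × Ω => u (min p.1 (n : ℝ≥0)) p.2) ⁻¹' S := by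
    ext p
    simp only [mem_preimage, mem_iUnion, mem_inter_iff, mem_ofPred_eq]
    constructor
    · intro hp
      obtain ⟨n, hn⟩ := exists_nat_ge p.1
      exact ⟨n, hn, by rwa [min_eq_left hn]⟩
    · rintro ⟨n, hn, hp⟩
      rwa [min_eq_left hn] at hp
  rw [key]
  refine MeasurableSet.iUnion fun n => (measurableSet_le measurable_fst measurable_const).inter ?_
  have h1 := (hu n).mono (sup_le_sup le_rfl (MeasurableSpace.comap_mono (𝓕.le n))) le_rfl
  have h2 : Measurable fun p : ℝ≥0 × Ω =>
      ((⟨min p.1 n, mem_Iic.2 (min_le_right _ _)⟩ : Iic (n : ℝ≥0)), p.2) :=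
    ((measurable_fst.min measurable_const).subtype_mk).prodMk measurable_snd
  exact (h1.comp h2) hS

lemma _root_.MeasureTheory.IsProgressive.map {F : Type*} [MeasurableSpace E] [MeasurableSpace F]
    {u : ℝ≥0 → Ω → E}
    (hu : IsProgressive 𝓕 u) {f : ℝ≥0 × E → F} (hf : Measurable f) :
    IsProgressive 𝓕 fun t ω => f (t, u t ω) := fun i =>
  hf.comp ((measurable_subtype_coe.comp
    (@measurable_fst _ _ Subtype.instMeasurableSpace (𝓕 i))).prodMk (hu i))

lemma _root_.MeasureTheory.IsProgressive.measurable_path [MeasurableSpace E] {u : ℝ≥0 → Ω → E}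
    (hu : IsProgressive 𝓕 u) (ω : Ω) : Measurable fun s => u s ω :=
  (measurable_uncurry_of_isProgressive hu).comp measurable_prodMk_right

/-- A right-continuous process is the limit of its values at dyadic times approached from the right.
Each approximation takes countably many times and is therefore jointly measurable. -/
lemma measurable_uncurry_Iic_of_rightCont {Ω E : Type*} [MeasurableSpace Ω] [MeasurableSpace E]
    [TopologicalSpace E] [TopologicalSpace.PseudoMetrizableSpace E] [BorelSpace E]
    {u : ℝ≥0 → Ω → E} (i : ℝ≥0) (hu : ∀ t ≤ i, Measurable (u t))
    (hc : ∀ ω t, ContinuousWithinAt (fun t => u t ω) (Ioi t) t) :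
    Measurable fun p : Iic i × Ω => u p.1 p.2 := by
  -- The approximating times are capped at `i`, so that only variables known by time `i` occur; at
  -- `s = i` the cap makes the sequence constant.
  let c : ℕ → ℕ → ℝ≥0 := fun n k => min i (dyadic n (k + 1))
  have key : ∀ (c : ℕ → ℝ≥0) (f : Iic i → ℕ), (∀ k, c k ≤ i) → Measurable f →
      Measurable fun p : Iic i × Ω => u (c (f p.1)) p.2 := by
    intro c f hci hf
    have h1 : Measurable fun q : ℕ × Ω => u (c q.1) q.2 :=
      measurable_from_prod_countable_right fun k => hu (c k) (hci k)
    exact h1.comp ((hf.comp measurable_fst).prodMk measurable_snd)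
  have hmeas : ∀ n, Measurable
      fun p : Iic i × Ω => u (c n ⌊(p.1 : ℝ≥0) * 2 ^ n⌋₊) p.2 := fun n =>
    key (c n) (fun s => ⌊(s : ℝ≥0) * 2 ^ n⌋₊) (fun k => min_le_left _ _)
      (Nat.measurable_floor.comp (measurable_subtype_coe.mul_const _))
  refine measurable_of_tendsto_metrizable hmeas ?_
  rw [tendsto_pi_nhds]
  rintro ⟨⟨s, hs⟩, ω⟩
  rcases (mem_Iic.1 hs).lt_or_eq with h | h
  · have h1 : Tendsto (fun n => c n ⌊s * 2 ^ n⌋₊) atTop (𝓝[>] s) := by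
      refine (tendsto_dyadicUp s).congr' ?_
      filter_upwards [(tendsto_dyadicUp s).eventually
        (mem_nhdsWithin_of_mem_nhds (Iio_mem_nhds h))] with n hn
      exact (min_eq_right (le_of_lt hn)).symm
    exact (hc ω s).tendsto.comp h1
  · subst h
    have : ∀ n, c n ⌊s * 2 ^ n⌋₊ = s := fun n => min_eq_left (lt_dyadicUp n s).le
    simp only [this]
    exact tendsto_const_nhds

lemma isProgressive_of_rightCont [MeasurableSpace E] [TopologicalSpace E]
    [TopologicalSpace.PseudoMetrizableSpace E] [BorelSpace E] {u : ℝ≥0 → Ω → E}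
    (hu : Adapted 𝓕 u) (hc : ∀ ω t, ContinuousWithinAt (fun t => u t ω) (Ioi t) t) :
    IsProgressive 𝓕 u := fun i =>
  @measurable_uncurry_Iic_of_rightCont Ω E (𝓕 i) _ _ _ _ _ i
    (fun _ ht => (hu _).mono (𝓕.mono ht) le_rfl) hc

end Progressive

/-! ### Null sets and completeness -/

lemma IsStochasticBasis.measurableSet_of_null {Ω : Type*} {m : MeasurableSpace Ω}
    {𝓕 : Filtration ℝ≥0 m} {P : Measure Ω} (h : IsStochasticBasis 𝓕 P) {s : Set Ω} (hs : P s = 0)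
    (t : ℝ≥0) : MeasurableSet[𝓕 t] s :=
  𝓕.mono zero_le s (h.complete s hs)

lemma IsStochasticBasis.measurableSet_of_ae {Ω : Type*} {m : MeasurableSpace Ω}
    {𝓕 : Filtration ℝ≥0 m} {P : Measure Ω} (h : IsStochasticBasis 𝓕 P) {s : Set Ω}
    (hs : ∀ᵐ ω ∂P, ω ∈ s) (t : ℝ≥0) : MeasurableSet[𝓕 t] s := by
  have := (h.measurableSet_of_null (s := sᶜ) hs t).compl
  rwa [compl_compl] at this

/-! ### Regularization of paths -/

/-- The set of dyadic times. -/
def dyadics : Set ℝ≥0 := ⋃ n, dyadicGrid n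

lemma countable_dyadics : dyadics.Countable := countable_iUnion fun _ => countable_range _

lemma dyadicUp_mem_dyadics (n : ℕ) (t : ℝ≥0) : dyadicUp n t ∈ dyadics :=
  mem_iUnion.2 ⟨n, dyadicUp_mem n t⟩

lemma tendsto_dyadicUp' (t : ℝ≥0) :
    Tendsto (fun n => dyadicUp n t) atTop (𝓝[dyadics ∩ Ioi t] t) :=
  tendsto_nhdsWithin_iff.2 ⟨(tendsto_nhdsWithin_iff.1 (tendsto_dyadicUp t)).1,
    Eventually.of_forall fun n => ⟨dyadicUp_mem_dyadics n t, lt_dyadicUp n t⟩⟩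

instance (t : ℝ≥0) : (𝓝[dyadics ∩ Ioi t] t).NeBot := (tendsto_dyadicUp' t).neBot

/-- The path `g` has at least `K` successive upcrossings of `[a, b]` at times in `S ∩ (u, ∞)`. -/
def HasUpcrossings (S : Set ℝ≥0) (g : ℝ≥0 → ℝ) (a b : ℝ) : ℕ → ℝ≥0 → Prop
  | 0, _ => True
  | K + 1, u => ∃ s ∈ S, ∃ t ∈ S, u < s ∧ s < t ∧ g s < a ∧ b < g t ∧ HasUpcrossings S g a b K t

lemma HasUpcrossings.mono {S T : Set ℝ≥0} (hST : S ⊆ T) {g : ℝ≥0 → ℝ} {a b : ℝ} {K : ℕ} :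
    ∀ {u v : ℝ≥0}, v ≤ u → HasUpcrossings S g a b K u → HasUpcrossings T g a b K v := by
  induction K with
  | zero => intros; trivial
  | succ K ih =>
    rintro u v huv ⟨s, hs, t, ht, hus, hst, h1, h2, h3⟩
    exact ⟨s, hST hs, t, hST ht, huv.trans_lt hus, hst, h1, h2, ih le_rfl h3⟩

/-- Only finitely many dyadic times are involved, and the grids are nested. -/
lemma HasUpcrossings.exists_level {g : ℝ≥0 → ℝ} {a b : ℝ} {K : ℕ} :
    ∀ {u : ℝ≥0}, HasUpcrossings dyadics g a b K u →
      ∃ n, HasUpcrossings (dyadicGrid n) g a b K u := by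
  induction K with
  | zero => exact fun _ => ⟨0, trivial⟩
  | succ K ih =>
    rintro u ⟨s, hs, t, ht, hus, hst, h1, h2, h3⟩
    obtain ⟨n₁, hs⟩ := mem_iUnion.1 hs
    obtain ⟨n₂, ht⟩ := mem_iUnion.1 ht
    obtain ⟨n₃, h3⟩ := ih h3
    have e₁ : n₁ ≤ max n₁ (max n₂ n₃) := le_max_left _ _
    have e₂ : n₂ ≤ max n₁ (max n₂ n₃) := (le_max_left _ _).trans (le_max_right _ _)
    have e₃ : n₃ ≤ max n₁ (max n₂ n₃) := (le_max_right _ _).trans (le_max_right _ _)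
    exact ⟨_, s, dyadicGrid_mono e₁ hs, t, dyadicGrid_mono e₂ ht, hus, hst, h1, h2,
      h3.mono (dyadicGrid_mono e₃) le_rfl⟩

/-- Links the recursive notion to the discrete upcrossing count, to which Doob's inequality applies.
The count made before index `N` is carried along so that the induction can resume after each
completed upcrossing. -/
lemma HasUpcrossings.le_upcrossingsBefore {Ω : Type*} {M : ℝ≥0 → Ω → ℝ} {ω : Ω} {n : ℕ} {a b : ℝ}
    (hab : a < b) {K : ℕ} : ∀ {u : ℝ≥0} {N : ℕ}, (∀ k, u < dyadic n k → N ≤ k) →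
      HasUpcrossings (dyadicGrid n) (fun t => M t ω) a b K u →
      ∃ N', K + upcrossingsBefore a b (fun k => M (dyadic n k)) N ω ≤
        upcrossingsBefore a b (fun k => M (dyadic n k)) N' ω := by
  induction K with
  | zero => exact fun {u N} _ _ => ⟨N, by simp⟩
  | succ K ih =>
    rintro u N hN ⟨_, ⟨k, rfl⟩, _, ⟨l, rfl⟩, hus, hst, h1, h2, h3⟩
    have hkl : k ≤ l := ((dyadic_mono n).reflect_lt hst).le
    have := upcrossingsBefore_lt_of_exists_upcrossing (f := fun k => M (dyadic n k)) hab (hN k hus)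
      h1 hkl h2
    -- The upcrossing ends at index `l`, so it is counted before `l + 1`, and every later time has
    -- index at least `l + 1`.
    obtain ⟨N', hN'⟩ := ih (N := l + 1) (fun j hj => (dyadic_mono n).reflect_lt hj) h3
    exact ⟨N', by omega⟩

/-- Oscillation just to the right of `t` produces any number of upcrossings. They are built
backwards in time: each new one is placed between `t` and those already found. -/
lemma not_frequently_of_not_hasUpcrossings_right {g : ℝ≥0 → ℝ} {a b : ℝ} {t : ℝ≥0}
    (h : ∃ K, ∀ u, ¬ HasUpcrossings dyadics g a b K u) :
    ¬ ((∃ᶠ d in 𝓝[dyadics ∩ Ioi t] t, g d < a) ∧ ∃ᶠ d in 𝓝[dyadics ∩ Ioi t] t, b < g d) := by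
  rintro ⟨ha, hb⟩
  have fr : ∀ {p : ℝ≥0 → Prop}, (∃ᶠ d in 𝓝[dyadics ∩ Ioi t] t, p d) → ∀ u > t,
      ∃ d ∈ dyadics, t < d ∧ d < u ∧ p d := by
    intro p hp u hu
    obtain ⟨d, hd, h1, h2⟩ := (hp.and_eventually (inter_mem
      (mem_nhdsWithin_of_mem_nhds (Iio_mem_nhds hu)) self_mem_nhdsWithin)).exists
    exact ⟨d, h2.1, h2.2, h1, hd⟩
  obtain ⟨K, hK⟩ := h
  have : ∀ K, ∃ u > t, HasUpcrossings dyadics g a b K u := by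
    intro K
    induction K with
    | zero => exact ⟨t + 1, by simp, trivial⟩
    | succ K ih =>
      obtain ⟨u, hu, hup⟩ := ih
      obtain ⟨d₂, h₂, ht₂, hd₂, hb₂⟩ := fr hb u hu
      obtain ⟨d₁, h₁, ht₁, hd₁, ha₁⟩ := fr ha d₂ ht₂
      obtain ⟨v, hv, hv'⟩ := exists_between ht₁
      exact ⟨v, hv, d₁, h₁, d₂, h₂, hv', hd₁, ha₁, hb₂, hup.mono le_rfl hd₂.le⟩
  obtain ⟨u, -, hu⟩ := this K
  exact hK u hu

/-- To the left of `t` the upcrossings are built forwards in time, each one closer to `t`. -/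
lemma not_frequently_of_not_hasUpcrossings_left {g : ℝ≥0 → ℝ} {a b : ℝ} {t : ℝ≥0}
    (h : ∃ K, ∀ u, ¬ HasUpcrossings dyadics g a b K u) :
    ¬ ((∃ᶠ d in 𝓝[dyadics ∩ Iio t] t, g d < a) ∧ ∃ᶠ d in 𝓝[dyadics ∩ Iio t] t, b < g d) := by
  rintro ⟨ha, hb⟩
  have fr : ∀ {p : ℝ≥0 → Prop}, (∃ᶠ d in 𝓝[dyadics ∩ Iio t] t, p d) → ∀ u < t,
      ∃ d ∈ dyadics, u < d ∧ d < t ∧ p d := by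
    intro p hp u hu
    obtain ⟨d, hd, h1, h2⟩ := (hp.and_eventually (inter_mem
      (mem_nhdsWithin_of_mem_nhds (Ioi_mem_nhds hu)) self_mem_nhdsWithin)).exists
    exact ⟨d, h2.1, h1, h2.2, hd⟩
  obtain ⟨K, hK⟩ := h
  have : ∀ K, ∀ u < t, HasUpcrossings dyadics g a b K u := by
    intro K
    induction K with
    | zero => exact fun _ _ => trivial
    | succ K ih =>
      intro u hu
      obtain ⟨d₁, h₁, hu₁, hd₁, ha₁⟩ := fr ha u hu
      obtain ⟨d₂, h₂, hu₂, hd₂, hb₂⟩ := fr hb d₁ hd₁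
      exact ⟨d₁, h₁, d₂, h₂, hu₁, hu₂, ha₁, hb₂, ih d₂ hd₂⟩
  obtain ⟨d, -, hd⟩ := (ha.and_eventually self_mem_nhdsWithin).exists
  exact hK d (this K d hd.2)

/-- The regularity of a path along the dyadic times that yields one-sided limits everywhere. -/
structure IsRegular (g : ℝ≥0 → ℝ) : Prop where
  bounded : ∃ C, ∀ d ∈ dyadics, |g d| ≤ C
  upcrossings : ∀ a b : ℚ, a < b → ∃ K, ∀ u, ¬ HasUpcrossings dyadics g a b K u

/-- A bounded function fails to converge only by oscillating across some pair of rational levels,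
which `h` and the upcrossing bound exclude. -/
lemma IsRegular.exists_tendsto {g : ℝ≥0 → ℝ} (hg : IsRegular g) {F : Filter ℝ≥0}
    (hF : dyadics ∈ F) (h : ∀ a b : ℝ, (∃ K, ∀ u, ¬ HasUpcrossings dyadics g a b K u) →
      ¬ ((∃ᶠ d in F, g d < a) ∧ ∃ᶠ d in F, b < g d)) :
    ∃ l, Tendsto g F (𝓝 l) := by
  obtain ⟨C, hC⟩ := hg.bounded
  refine tendsto_of_no_upcrossings (s := range ((↑) : ℚ → ℝ)) Rat.denseRange_cast ?_ ?_ ?_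
  · rintro _ ⟨a, rfl⟩ _ ⟨b, rfl⟩ hab
    exact h a b (hg.upcrossings a b (by exact_mod_cast hab))
  · exact ⟨C, eventually_map.2 (mem_of_superset hF fun d hd => (abs_le.1 (hC d hd)).2)⟩
  · exact ⟨-C, eventually_map.2 (mem_of_superset hF fun d hd => (abs_le.1 (hC d hd)).1)⟩

lemma IsRegular.exists_tendsto_right {g : ℝ≥0 → ℝ} (hg : IsRegular g) (t : ℝ≥0) :
    ∃ l, Tendsto g (𝓝[dyadics ∩ Ioi t] t) (𝓝 l) :=
  hg.exists_tendsto (mem_of_superset self_mem_nhdsWithin inter_subset_left) fun _ _ =>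
    not_frequently_of_not_hasUpcrossings_right

lemma IsRegular.exists_tendsto_left {g : ℝ≥0 → ℝ} (hg : IsRegular g) (t : ℝ≥0) :
    ∃ l, Tendsto g (𝓝[dyadics ∩ Iio t] t) (𝓝 l) :=
  hg.exists_tendsto (mem_of_superset self_mem_nhdsWithin inter_subset_left) fun _ _ =>
    not_frequently_of_not_hasUpcrossings_left

/-- The limit of `g` from the right along the dyadic times. -/
def dyadicRightLim (g : ℝ≥0 → ℝ) (t : ℝ≥0) : ℝ := limUnder (𝓝[dyadics ∩ Ioi t] t) g

lemma IsRegular.tendsto_dyadicRightLim {g : ℝ≥0 → ℝ} (hg : IsRegular g) (t : ℝ≥0) :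
    Tendsto g (𝓝[dyadics ∩ Ioi t] t) (𝓝 (dyadicRightLim g t)) :=
  tendsto_nhds_limUnder (hg.exists_tendsto_right t)

/-- The values of `X` are limits of values of `g`, so they stay in any closed neighbourhood of `l`
that contains the nearby values of `g`. Taking `J` to be a right or left half-line gives
right-continuity and left limits. -/
lemma tendsto_of_tendsto_dyadics {g X : ℝ≥0 → ℝ}
    (hX : ∀ t, Tendsto g (𝓝[dyadics ∩ Ioi t] t) (𝓝 (X t))) {t : ℝ≥0} {J : Set ℝ≥0}
    (hJ : IsOpen J) {l : ℝ} (hl : Tendsto g (𝓝[dyadics ∩ J] t) (𝓝 l)) :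
    Tendsto X (𝓝[J] t) (𝓝 l) := by
  refine (closed_nhds_basis l).tendsto_right_iff.2 fun N ⟨hN, hNc⟩ => ?_
  obtain ⟨O, hO, htO, hsub⟩ := mem_nhdsWithin.1 (hl hN)
  refine mem_nhdsWithin.2 ⟨O, hO, htO, fun s hs => ?_⟩
  refine hNc.mem_of_tendsto (hX s) ?_
  filter_upwards [self_mem_nhdsWithin,
    mem_nhdsWithin_of_mem_nhds ((hO.inter hJ).mem_nhds hs)] with d hd hdO
  exact hsub ⟨hdO.1, hd.1, hdO.2⟩

lemma IsRegular.isCadlag_dyadicRightLim {g : ℝ≥0 → ℝ} (hg : IsRegular g) :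
    IsCadlag (dyadicRightLim g) := fun t =>
  ⟨tendsto_of_tendsto_dyadics hg.tendsto_dyadicRightLim isOpen_Ioi (hg.tendsto_dyadicRightLim t),
    (hg.exists_tendsto_left t).imp fun _ hl =>
      tendsto_of_tendsto_dyadics hg.tendsto_dyadicRightLim isOpen_Iio hl⟩

/-! ### Càdlàg versions of closed martingales -/

/-- Turns weak-type bounds of order `1 / n` into almost sure finiteness. -/
lemma measure_iInter_eq_zero_of_mul_le {Ω : Type*} {m : MeasurableSpace Ω} {P : Measure Ω}
    {B : ℕ → Set Ω} {c : ℝ≥0∞} (hc : c ≠ ∞)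
    (h : ∀ n, n * P (B n) ≤ c) : P (⋂ n, B n) = 0 := by
  by_contra h0
  have h1 : ∀ n : ℕ, n * P (⋂ n, B n) ≤ c := fun n =>
    (mul_le_mul_right (measure_mono (iInter_subset _ n)) _).trans (h n)
  obtain ⟨n, hn⟩ := ENNReal.exists_nat_mul_gt h0 hc
  exact absurd (h1 n) (not_le.2 hn)

section Martingale

variable {Ω : Type*} {m : MeasurableSpace Ω} {𝓕 : Filtration ℝ≥0 m} {P : Measure Ω}
  [IsProbabilityMeasure P]

/-- The discrete-time filtration of the dyadic times of level `n`. -/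
def dyadicFiltration (𝓕 : Filtration ℝ≥0 m) (n : ℕ) : Filtration ℕ m where
  seq k := 𝓕 (dyadic n k)
  mono' _ _ h := 𝓕.mono (dyadic_mono n h)
  le' _ := 𝓕.le _

/-- Doob's maximal inequality for the positive part of the martingale, on one grid up to a finite
index. The bound depends on neither, so it survives the increasing unions over horizons and levels.
-/
lemma mul_measure_exists_dyadic_le (ξ : Ω → ℝ) (c : ℝ≥0) :
    c * P {ω | ∃ d ∈ dyadics, (c : ℝ) ≤ (P[ξ | 𝓕 d]) ω} ≤ ENNReal.ofReal (∫ ω, |ξ ω| ∂P) := by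
  let A : ℕ → ℕ → Set Ω := fun n N => {ω | ∃ k ≤ N, (c : ℝ) ≤ (P[ξ | 𝓕 (dyadic n k)]) ω}
  have hA : ∀ n N, c * P (A n N) ≤ ENNReal.ofReal (∫ ω, |ξ ω| ∂P) := by
    intro n N
    have hsub := (martingale_condExp ξ (dyadicFiltration 𝓕 n) P).submartingale.pos
    have h := maximal_ineq hsub (fun k ω => posPart_nonneg _) (ε := c) N
    have h1 : A n N ⊆ {ω | (c : ℝ) ≤ (Finset.range (N + 1)).sup' Finset.nonempty_range_add_one
        fun k => ((P[ξ | dyadicFiltration 𝓕 n k]) ω)⁺} := by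
      rintro ω ⟨k, hk, hc⟩
      exact (hc.trans (le_posPart _)).trans (Finset.le_sup'
        (fun k => ((P[ξ | dyadicFiltration 𝓕 n k]) ω)⁺) (Finset.mem_range.2 (Nat.lt_succ_of_le hk)))
    refine (mul_le_mul_right (measure_mono h1) _).trans (h.trans (ENNReal.ofReal_le_ofReal ?_))
    refine (setIntegral_le_integral (hsub.integrable N)
      (Eventually.of_forall fun ω => posPart_nonneg _)).trans ?_
    exact (integral_mono (hsub.integrable N)
      (integrable_condExp (m := dyadicFiltration 𝓕 n N) (f := ξ)).abs
      fun ω => sup_le (le_abs_self _) (abs_nonneg _)).trans (integral_abs_condExp_le ξ)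
  have hunion : {ω | ∃ d ∈ dyadics, (c : ℝ) ≤ (P[ξ | 𝓕 d]) ω} = ⋃ n, ⋃ N, A n N := by
    ext ω
    simp only [dyadics, dyadicGrid, mem_iUnion, mem_range, A, mem_ofPred_eq]
    constructor
    · rintro ⟨_, ⟨n, k, rfl⟩, h⟩
      exact ⟨n, k, k, le_rfl, h⟩
    · rintro ⟨n, N, k, -, h⟩
      exact ⟨_, ⟨n, k, rfl⟩, h⟩
  have hmonoN : ∀ n, Monotone (A n) := fun n N N' h ω ⟨k, hk, hc⟩ => ⟨k, hk.trans h, hc⟩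
  have hmono : Monotone fun n => ⋃ N, A n N := by
    intro n n' h ω hω
    obtain ⟨N, k, -, hc⟩ := mem_iUnion.1 hω
    obtain ⟨k', hk'⟩ := dyadicGrid_mono h ⟨k, rfl⟩
    refine mem_iUnion.2 ⟨k', k', le_rfl, ?_⟩
    rw [hk']; exact hc
  rw [hunion, hmono.measure_iUnion, ENNReal.mul_iSup]
  refine iSup_le fun n => ?_
  rw [(hmonoN n).measure_iUnion, ENNReal.mul_iSup]
  exact iSup_le fun N => hA n N

lemma ae_bounded_dyadics {ξ : Ω → ℝ} (hξ0 : 0 ≤ᵐ[P] ξ) :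
    ∀ᵐ ω ∂P, ∃ C, ∀ d ∈ dyadics, |(P[ξ | 𝓕 d]) ω| ≤ C := by
  have h1 : ∀ᵐ ω ∂P, ∀ d ∈ dyadics, 0 ≤ (P[ξ | 𝓕 d]) ω :=
    (ae_ball_iff countable_dyadics).2 fun d _ => condExp_nonneg hξ0
  have h2 : P (⋂ n : ℕ, {ω | ∃ d ∈ dyadics, ((n : ℝ≥0) : ℝ) ≤ (P[ξ | 𝓕 d]) ω}) = 0 :=
    measure_iInter_eq_zero_of_mul_le ENNReal.ofReal_ne_top fun n =>
      mul_measure_exists_dyadic_le (𝓕 := 𝓕) ξ (n : ℝ≥0)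
  filter_upwards [h1, measure_eq_zero_iff_ae_notMem.1 h2] with ω h1 h2
  simp only [mem_iInter, mem_ofPred_eq, not_forall, not_exists, not_and, not_le] at h2
  obtain ⟨n, hn⟩ := h2
  exact ⟨_, fun d hd => by rw [abs_of_nonneg (h1 d hd)]; exact (hn d hd).le⟩

/-- Doob's upcrossing inequality bounds the expected number of upcrossings along each grid by `c`,
independently of the level. Markov's inequality then bounds the probability of `K` upcrossings by `c
/ K`. -/
lemma ae_not_hasUpcrossings (ξ : Ω → ℝ) {a b : ℝ} (hab : a < b) :
    ∀ᵐ ω ∂P, ∃ K, ∀ u, ¬ HasUpcrossings dyadics (fun t => (P[ξ | 𝓕 t]) ω) a b K u := by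
  let c : ℝ≥0∞ := ENNReal.ofReal (∫ ω, |ξ ω| ∂P + |a|) / ENNReal.ofReal (b - a)
  have hba : ENNReal.ofReal (b - a) ≠ 0 := by simpa using hab
  have hc : c ≠ ∞ := ENNReal.div_ne_top ENNReal.ofReal_ne_top hba
  let A : ℕ → ℕ → Set Ω := fun K n =>
    {ω | ∃ u, HasUpcrossings (dyadicGrid n) (fun t => (P[ξ | 𝓕 t]) ω) a b K u}
  have hA : ∀ K n : ℕ, K * P (A K n) ≤ c := by
    intro K n
    let f : ℕ → Ω → ℝ := fun k => P[ξ | dyadicFiltration 𝓕 n k]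
    have hf : Martingale f (dyadicFiltration 𝓕 n) P := martingale_condExp ξ _ P
    have h1 : A K n ⊆ {ω | (K : ℝ≥0∞) ≤ upcrossings a b f ω} := by
      rintro ω ⟨u, hu⟩
      obtain ⟨N', hN'⟩ := hu.le_upcrossingsBefore (M := fun t => P[ξ | 𝓕 t]) hab (N := 0)
        (fun _ _ => zero_le)
      have h2 : K ≤ upcrossingsBefore a b f N' ω := le_trans (Nat.le_add_right _ _) hN'
      refine le_trans ?_ (le_iSup (fun N => (upcrossingsBefore a b f N ω : ℝ≥0∞)) N')
      exact_mod_cast h2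
    have h3 : ∫⁻ ω, upcrossings a b f ω ∂P ≤ c := by
      rw [ENNReal.le_div_iff_mul_le (Or.inl hba) (Or.inl ENNReal.ofReal_ne_top), mul_comm]
      refine (hf.submartingale.mul_lintegral_upcrossings_le_lintegral_pos_part a b).trans ?_
      refine iSup_le fun N => ?_
      have hint : Integrable (fun ω => |f N ω| + |a|) P :=
        (hf.integrable N).abs.add (integrable_const _)
      calc ∫⁻ ω, ENNReal.ofReal ((f N ω - a)⁺) ∂P
          ≤ ∫⁻ ω, ENNReal.ofReal (|f N ω| + |a|) ∂P :=
            lintegral_mono fun ω => ENNReal.ofReal_le_ofReal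
              ((sup_le (le_abs_self _) (abs_nonneg _)).trans (abs_sub _ _))
        _ = ENNReal.ofReal (∫ ω, (|f N ω| + |a|) ∂P) :=
            (ofReal_integral_eq_lintegral_ofReal hint
              (Eventually.of_forall fun ω => by positivity)).symm
        _ ≤ _ := by
            refine ENNReal.ofReal_le_ofReal ?_
            rw [integral_add (hf.integrable N).abs (integrable_const _)]
            simpa using integral_abs_condExp_le (μ := P) ξ
    refine (mul_le_mul_right (measure_mono h1) _).trans ((mul_meas_ge_le_lintegral₀ ?_ _).trans h3)
    exact (hf.stronglyAdapted.measurable_upcrossings hab).aemeasurable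
  have h2 : P (⋂ K : ℕ,
      {ω | ∃ u, HasUpcrossings dyadics (fun t => (P[ξ | 𝓕 t]) ω) a b K u}) = 0 := by
    refine measure_iInter_eq_zero_of_mul_le hc fun K => ?_
    have hmono : Monotone (A K) := fun n n' h ω ⟨u, hu⟩ => ⟨u, hu.mono (dyadicGrid_mono h) le_rfl⟩
    have hsub : {ω | ∃ u, HasUpcrossings dyadics (fun t => (P[ξ | 𝓕 t]) ω) a b K u} ⊆
        ⋃ n, A K n := by
      rintro ω ⟨u, hu⟩
      obtain ⟨n, hn⟩ := hu.exists_level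
      exact mem_iUnion.2 ⟨n, u, hn⟩
    refine (mul_le_mul_right (measure_mono hsub) _).trans ?_
    rw [hmono.measure_iUnion, ENNReal.mul_iSup]
    exact iSup_le fun n => hA K n
  filter_upwards [measure_eq_zero_iff_ae_notMem.1 h2] with ω h2
  simpa only [mem_iInter, mem_ofPred_eq, not_forall, not_exists] using h2

lemma ae_isRegular_condExp {ξ : Ω → ℝ} (hξ0 : 0 ≤ᵐ[P] ξ) :
    ∀ᵐ ω ∂P, IsRegular fun t => (P[ξ | 𝓕 t]) ω := by
  have h2 : ∀ᵐ ω ∂P, ∀ a b : ℚ, a < b →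
      ∃ K, ∀ u, ¬ HasUpcrossings dyadics (fun t => (P[ξ | 𝓕 t]) ω) a b K u := by
    refine ae_all_iff.2 fun a => ae_all_iff.2 fun b => ?_
    by_cases hab : a < b
    · filter_upwards [ae_not_hasUpcrossings (𝓕 := 𝓕) (P := P) ξ
        (a := a) (b := b) (by exact_mod_cast hab)] with ω hω _ using hω
    · exact Eventually.of_forall fun ω h => absurd h hab
  filter_upwards [ae_bounded_dyadics (𝓕 := 𝓕) hξ0, h2] with ω h1 h2 using ⟨h1, h2⟩

lemma isCadlag_const {E : Type*} [TopologicalSpace E] (c : E) : IsCadlag fun _ : ℝ≥0 => c :=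
  fun _ => ⟨continuousWithinAt_const, c, tendsto_const_nhds⟩

/-- Under the usual conditions, a closed nonnegative martingale has a càdlàg version. -/
theorem exists_cadlag_condExp (h𝓕 : IsStochasticBasis 𝓕 P) {ξ : Ω → ℝ} (hξ : Integrable ξ P)
    (hξ0 : 0 ≤ᵐ[P] ξ) :
    ∃ X : ℝ≥0 → Ω → ℝ, Adapted 𝓕 X ∧ (∀ ω, IsCadlag fun t => X t ω) ∧
      ∀ t, X t =ᵐ[P] P[ξ | 𝓕 t] := by
  classical
  let G : Set Ω := {ω | IsRegular fun t => (P[ξ | 𝓕 t]) ω}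
  have hG : ∀ᵐ ω ∂P, ω ∈ G := ae_isRegular_condExp hξ0
  have hGm : ∀ t, MeasurableSet[𝓕 t] G := h𝓕.measurableSet_of_ae hG
  let X : ℝ≥0 → Ω → ℝ := fun t => G.indicator fun ω => dyadicRightLim (fun t => (P[ξ | 𝓕 t]) ω) t
  have hlim : ∀ t, Tendsto (fun n => G.indicator (P[ξ | 𝓕 (dyadicUp n t)])) atTop (𝓝 (X t)) := by
    intro t
    rw [tendsto_pi_nhds]
    intro ω
    by_cases hω : ω ∈ G
    · simp only [X, indicator_of_mem hω]
      exact (IsRegular.tendsto_dyadicRightLim hω t).comp (tendsto_dyadicUp' t)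
    · simp only [X, indicator_of_notMem hω]
      exact tendsto_const_nhds
  have hadapted : Adapted 𝓕 X := by
    intro t
    -- The limit uses times strictly after `t`, so it is only known to be measurable for each `𝓕 j`
    -- with `j > t`; right-continuity of the filtration closes the gap.
    have hj : ∀ j > t, Measurable[𝓕 j] (X t) := by
      intro j hj
      obtain ⟨N, hN⟩ := eventually_atTop.1 ((tendsto_dyadicUp t).eventually
        (mem_nhdsWithin_of_mem_nhds (Iio_mem_nhds hj)))
      refine @measurable_of_tendsto_metrizable _ _ (𝓕 j) _ _ _ _ _ _ (fun n => ?_)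
        ((hlim t).comp (tendsto_add_atTop_nat N))
      refine Measurable.indicator ?_ (hGm j)
      exact stronglyMeasurable_condExp.measurable.mono
        (𝓕.mono (hN _ (Nat.le_add_left _ _)).le) le_rfl
    intro s hs
    have := h𝓕.rightContinuous
    refine Filtration.IsRightContinuous.measurableSet (𝓕 := 𝓕) ?_
    rw [Filtration.rightCont_eq]
    simp only [MeasurableSpace.measurableSet_iInf]
    exact fun j hjt => hj j hjt hs
  refine ⟨X, hadapted, fun ω => ?_, fun t => ?_⟩
  · by_cases hω : ω ∈ G
    · simp only [X, indicator_of_mem hω]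
      exact IsRegular.isCadlag_dyadicRightLim hω
    · simp only [X, indicator_of_notMem hω]
      exact isCadlag_const 0
  · let f : ℕ → Ω → ℝ := fun n => P[ξ | 𝓕 (dyadicUp n t)]
    -- Uniform integrability upgrades almost sure convergence to convergence in `L¹`. The integrals
    -- over `A ∈ 𝓕 t` then pass to the limit, and they are constant because the approximating times
    -- exceed `t`.
    have hui : UniformIntegrable f 1 P := hξ.uniformIntegrable_condExp fun n => 𝓕.le _
    have hae : ∀ᵐ ω ∂P, Tendsto (fun n => f n ω) atTop (𝓝 (X t ω)) := by
      filter_upwards [hG] with ω hω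
      have := tendsto_pi_nhds.1 (hlim t) ω
      simpa only [indicator_of_mem hω] using this
    have hXm : AEStronglyMeasurable (X t) P :=
      ((hadapted t).mono (𝓕.le t) le_rfl).aestronglyMeasurable
    have hXp : MemLp (X t) 1 P := hui.memLp_of_ae_tendsto hae
    have hL1 := tendsto_Lp_finite_of_tendsto_ae le_rfl ENNReal.one_ne_top
      (fun n => (hui.1 n)) hXp hui.2.1 hae
    have hXi : Integrable (X t) P := memLp_one_iff_integrable.1 hXp
    refine ae_eq_condExp_of_forall_setIntegral_eq (𝓕.le t) hξ (fun s _ _ => hXi.integrableOn)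
      (fun s hs _ => ?_) (hadapted t).stronglyMeasurable.aestronglyMeasurable
    have h1 : Tendsto (fun n => ∫ ω in s, f n ω ∂P) atTop (𝓝 (∫ ω in s, X t ω ∂P)) :=
      tendsto_setIntegral_of_L1' _ hXi.aestronglyMeasurable
        (Eventually.of_forall fun n => integrable_condExp) hL1 s
    refine tendsto_nhds_unique h1 ?_
    have h2 : ∀ n, ∫ ω in s, f n ω ∂P = ∫ ω in s, ξ ω ∂P := fun n =>
      setIntegral_condExp (𝓕.le _) hξ (𝓕.mono (lt_dyadicUp n t).le _ hs)
    simp only [h2]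
    exact tendsto_const_nhds

end Martingale

/-! ### Tail expectations -/

section Tail

variable {Ω : Type*} {m : MeasurableSpace Ω}

/-- `X` satisfies `E[X_t ; A] = E[∫_t^∞ Y_s ds ; A]` for all `t` and all `A ∈ 𝓕 t`. -/
def IsTail (𝓕 : Filtration ℝ≥0 m) (P : Measure Ω) (Y X : ℝ≥0 → Ω → ℝ≥0∞) : Prop :=
  ∀ t, ∀ A, MeasurableSet[𝓕 t] A →
    ∫⁻ ω in A, X t ω ∂P = ∫⁻ ω in A, ∫⁻ s in Ici t, Y s ω ∂leb ∂P

variable {𝓕 : Filtration ℝ≥0 m} {P : Measure Ω}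

lemma IsCadlagTailExp.isProgressive {Y : ℝ≥0 → Ω → ℝ≥0∞} {X : ℝ≥0 → Ω → ℝ≥0}
    (h : IsCadlagTailExp 𝓕 P Y X) : IsProgressive 𝓕 X :=
  isProgressive_of_rightCont h.adapted fun ω t => (h.cadlag ω t).1

/-- Dominated convergence: for each `s ≠ t` the indicator of `Iic u` at `s` is locally constant in
`u` near `t`, and `leb` has no atoms. -/
lemma continuous_toReal_setLIntegral_Iic {f : ℝ≥0 → ℝ≥0∞} (hf : Measurable f)
    (hfi : ∫⁻ s, f s ∂leb ≠ ∞) : Continuous fun t => (∫⁻ s in Iic t, f s ∂leb).toReal := by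
  have hlt : ∀ᵐ s ∂leb, f s < ∞ := ae_lt_top hf hfi
  have key : ∀ t, (∫⁻ s in Iic t, f s ∂leb).toReal =
      ∫ s, (Iic t).indicator (fun s => (f s).toReal) s ∂leb := fun t => by
    rw [integral_indicator measurableSet_Iic, integral_toReal hf.aemeasurable
      (ae_restrict_of_ae hlt)]
  simp only [key]
  refine continuous_iff_continuousAt.2 fun t => ?_
  refine continuousAt_of_dominated (bound := fun s => (f s).toReal)
    (Eventually.of_forall fun u =>
      (hf.ennreal_toReal.indicator measurableSet_Iic).aestronglyMeasurable)
    (Eventually.of_forall fun u => Eventually.of_forall fun s => ?_)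
    (integrable_toReal_of_lintegral_ne_top hf.aemeasurable hfi) ?_
  · rw [Real.norm_of_nonneg (indicator_nonneg (fun _ _ => ENNReal.toReal_nonneg) _)]
    exact indicator_le_self' (fun _ _ => ENNReal.toReal_nonneg) _
  · have : ∀ᵐ s ∂leb, s ≠ t := by
      rw [ae_iff]; simp
    filter_upwards [this] with s hs
    rcases hs.lt_or_gt with h | h
    · refine (continuousAt_const (y := (f s).toReal)).congr ?_
      filter_upwards [Ioi_mem_nhds h] with u hu
      rw [indicator_of_mem (mem_Iic.2 (le_of_lt hu))]
    · refine (continuousAt_const (y := (0 : ℝ))).congr ?_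
      filter_upwards [Iio_mem_nhds h] with u hu
      rw [indicator_of_notMem (by simpa using hu)]

lemma lintegral_eq_Iic_add_Ici {f : ℝ≥0 → ℝ≥0∞} (t : ℝ≥0) :
    ∫⁻ s, f s ∂leb = ∫⁻ s in Iic t, f s ∂leb + ∫⁻ s in Ici t, f s ∂leb := by
  rw [← lintegral_add_compl f (measurableSet_Iic (a := t)), compl_Iic,
    setLIntegral_congr Ioi_ae_eq_Ici]

/-- Seen as an integral over the subtype `Iic t`, the expression involves only the restriction to
`[0, t] × Ω`, which is measurable for `𝓕 t` by progressivity. -/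
lemma measurable_setLIntegral_Iic {Y : ℝ≥0 → Ω → ℝ≥0∞} (hY : IsProgressive 𝓕 Y) (t : ℝ≥0) :
    Measurable[𝓕 t] fun ω => ∫⁻ s in Iic t, Y s ω ∂leb := by
  have : (fun ω => ∫⁻ s in Iic t, Y s ω ∂leb) =
      fun ω => ∫⁻ s : Iic t, Y s ω ∂(leb.comap Subtype.val) := by
    ext ω
    exact (lintegral_subtype_comap measurableSet_Iic fun s => Y s ω).symm
  rw [this]
  have : IsFiniteMeasure (leb.comap (Subtype.val : Iic t → ℝ≥0)) := ⟨by
    rw [(MeasurableEmbedding.subtype_coe measurableSet_Iic).comap_apply, image_univ,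
      Subtype.range_coe, ← Icc_bot]
    exact isCompact_Icc.measure_lt_top⟩
  exact @Measurable.lintegral_prod_left' _ _ _ (𝓕 t) _ inferInstance _ (hY t)

variable [IsProbabilityMeasure P]

lemma IsCadlagTailExp.isTail {Y : ℝ≥0 → Ω → ℝ≥0∞} {X : ℝ≥0 → Ω → ℝ≥0}
    (h : IsCadlagTailExp 𝓕 P Y X) : IsTail 𝓕 P Y fun t ω => X t ω := fun t A hA => by
  rw [lintegral_congr_ae (ae_restrict_of_ae (h.version t)), setLIntegral_condLExp (𝓕.le t) _ _ hA]

lemma IsTail.isCadlagTailExp {Y : ℝ≥0 → Ω → ℝ≥0∞} {X : ℝ≥0 → Ω → ℝ≥0}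
    (h : IsTail 𝓕 P Y fun t ω => X t ω) (hX : Adapted 𝓕 X) (hc : ∀ ω, IsCadlag fun t => X t ω) :
    IsCadlagTailExp 𝓕 P Y X :=
  ⟨hX, hc, fun t => ae_eq_condLExp (𝓕.le t) _ _ (measurable_coe_nnreal_ennreal.comp (hX t))
    fun A hA => h t A hA⟩

lemma IsTail.ae_eq {Y X X' : ℝ≥0 → Ω → ℝ≥0∞} (h : IsTail 𝓕 P Y X)
    (h' : IsTail 𝓕 P Y X') (hX : Adapted 𝓕 X) (hX' : Adapted 𝓕 X') (t : ℝ≥0) :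
    X t =ᵐ[P] X' t :=
  (ae_eq_condLExp (𝓕.le t) _ _ (hX t) fun A hA => h t A hA).trans
    (ae_eq_condLExp (𝓕.le t) _ _ (hX' t) fun A hA => h' t A hA).symm

lemma integral_comm_of_isProgressive {Y : ℝ≥0 → Ω → ℝ≥0∞} (hY : IsProgressive 𝓕 Y) (A : Set Ω)
    (J : Set ℝ≥0) : ∫⁻ ω in A, ∫⁻ s in J, Y s ω ∂leb ∂P = ∫⁻ s in J, ∫⁻ ω in A, Y s ω ∂P ∂leb :=
  lintegral_lintegral_swap
    ((measurable_uncurry_of_isProgressive hY).comp measurable_swap).aemeasurable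

lemma measurable_setLIntegral_of_isProgressive {Y : ℝ≥0 → Ω → ℝ≥0∞} (hY : IsProgressive 𝓕 Y)
    (J : Set ℝ≥0) : Measurable fun ω => ∫⁻ s in J, Y s ω ∂leb :=
  Measurable.lintegral_prod_left' (measurable_uncurry_of_isProgressive hY)

/-- Tail expectations of integrable progressive processes have càdlàg versions. -/
theorem exists_isCadlagTailExp (h𝓕 : IsStochasticBasis 𝓕 P) {Y : ℝ≥0 → Ω → ℝ≥0∞}
    (hY : IsProgressive 𝓕 Y) (hint : ∫⁻ ω, ∫⁻ s, Y s ω ∂leb ∂P < ∞) :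
    ∃ X, IsCadlagTailExp 𝓕 P Y X := by
  have hm := measurable_uncurry_of_isProgressive hY
  have hI : Measurable fun ω => ∫⁻ s, Y s ω ∂leb := Measurable.lintegral_prod_left' hm
  obtain ⟨M, hMa, hMc, hM⟩ := exists_cadlag_condExp h𝓕
    (ξ := fun ω => (∫⁻ s, Y s ω ∂leb).toReal)
    (integrable_toReal_of_lintegral_ne_top hI.aemeasurable hint.ne)
    (Eventually.of_forall fun _ => ENNReal.toReal_nonneg)
  let G : Set Ω := {ω | ∫⁻ s, Y s ω ∂leb < ∞}
  have hG : ∀ᵐ ω ∂P, ω ∈ G := ae_lt_top hI hint.ne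
  -- The tail expectation is the closed martingale of the total integral minus the integral
  -- accumulated so far. Paths with infinite total are set to `0`; passing to `toNNReal` below is
  -- harmless, as `Z t` is almost surely nonnegative.
  let Z : ℝ≥0 → Ω → ℝ := fun t =>
    G.indicator fun ω => M t ω - (∫⁻ s in Iic t, Y s ω ∂leb).toReal
  refine ⟨fun t ω => (Z t ω).toNNReal, fun t => ?_, fun ω => ?_, fun t => ?_⟩
  · refine measurable_real_toNNReal.comp (Measurable.indicator ?_ (h𝓕.measurableSet_of_ae hG t))
    exact (hMa t).sub (measurable_setLIntegral_Iic hY t).ennreal_toReal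
  · by_cases hω : ω ∈ G
    · simp only [Z, indicator_of_mem hω]
      have hc := continuous_toReal_setLIntegral_Iic (f := fun s => Y s ω)
        (hm.comp measurable_prodMk_right) (ne_of_lt hω)
      intro t
      obtain ⟨h1, l, h2⟩ := hMc ω t
      exact ⟨continuous_real_toNNReal.continuousAt.comp_continuousWithinAt
          (h1.sub hc.continuousWithinAt), _,
        (continuous_real_toNNReal.tendsto _).comp (h2.sub (hc.tendsto t |>.mono_left inf_le_left))⟩
    · simp only [Z, indicator_of_notMem hω]
      exact isCadlag_const _
  · have hI1 := measurable_setLIntegral_of_isProgressive hY (Iic t)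
    have hI2 := measurable_setLIntegral_of_isProgressive hY (Ici t)
    have hle : ∀ J : Set ℝ≥0, ∫⁻ ω, ∫⁻ s in J, Y s ω ∂leb ∂P ≠ ∞ := fun J =>
      ((lintegral_mono fun ω => setLIntegral_le_lintegral J _).trans_lt hint).ne
    have i1 := integrable_toReal_of_lintegral_ne_top hI1.aemeasurable (hle (Iic t))
    have i2 := integrable_toReal_of_lintegral_ne_top hI2.aemeasurable (hle (Ici t))
    have hsplit : (fun ω => (∫⁻ s, Y s ω ∂leb).toReal) =ᵐ[P]
        (fun ω => (∫⁻ s in Iic t, Y s ω ∂leb).toReal) +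
          fun ω => (∫⁻ s in Ici t, Y s ω ∂leb).toReal := by
      filter_upwards [hG] with ω hω
      have h1 := lintegral_eq_Iic_add_Ici (f := fun s => Y s ω) t
      have h2 : ∫⁻ s, Y s ω ∂leb ≠ ∞ := ne_of_lt hω
      rw [h1] at h2
      rw [Pi.add_apply, h1, ENNReal.toReal_add (ENNReal.add_ne_top.1 h2).1
        (ENNReal.add_ne_top.1 h2).2]
    have hself : P[fun ω => (∫⁻ s in Iic t, Y s ω ∂leb).toReal | 𝓕 t] = _ :=
      condExp_of_stronglyMeasurable (𝓕.le t)
        (measurable_setLIntegral_Iic hY t).ennreal_toReal.stronglyMeasurable i1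
    filter_upwards [hG, hM t, condExp_congr_ae (m := 𝓕 t) hsplit, condExp_add i1 i2 (𝓕 t),
      toReal_condLExp (𝓕 t) hI2.aemeasurable (hle (Ici t)), condLExp_ne_top (hle (Ici t))]
      with ω h1 h2 h3 h4 h5 h6
    have : Z t ω = (condLExp (𝓕 t) P (fun ω => ∫⁻ s in Ici t, Y s ω ∂leb) ω).toReal := by
      simp only [Z, indicator_of_mem h1]
      rw [h2, h3, h4, h5, Pi.add_apply, hself]
      ring
    rw [this]
    exact ENNReal.ofReal_toReal h6

end Tail

/-! ### Comparison of tail expectations -/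

/-- The times at which `D` jumps downwards. -/
def downJumps (D : ℝ≥0 → ℝ) : Set ℝ≥0 :=
  {s | ∃ z : ℝ, D s < z ∧ ∃ q < s, ∀ r ∈ Ioo q s, z < D r}

/-- Label a downward jump at `s` by a dyadic `q < s` and a rational `z` with `D s < z < D` on `(q,
s)`. A label determines its jump, for of two jumps with the same label the earlier one would
contradict the lower bound required before the later. -/
lemma countable_downJumps (D : ℝ≥0 → ℝ) : (downJumps D).Countable := by
  let T : ℝ≥0 → ℚ → Set ℝ≥0 := fun q z => {s | q < s ∧ D s < z ∧ ∀ r ∈ Ioo q s, (z : ℝ) < D r}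
  have hT : ∀ q z, (T q z).Subsingleton := by
    have aux : ∀ q z, ∀ s ∈ T q z, ∀ s' ∈ T q z, ¬ s < s' := fun q z s hs s' hs' h =>
      absurd (hs'.2.2 s ⟨hs.1, h⟩) hs.2.1.not_gt
    exact fun q z s hs s' hs' =>
      le_antisymm (not_lt.1 (aux q z s' hs' s hs)) (not_lt.1 (aux q z s hs s' hs'))
  refine ((countable_dyadics.biUnion fun q _ =>
    countable_iUnion fun z => (hT q z).countable)).mono ?_
  rintro s ⟨z, hz, q, hq, h⟩
  obtain ⟨y, hy1, hy2⟩ := exists_rat_btwn hz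
  obtain ⟨n, hn⟩ := ((tendsto_dyadicUp q).eventually
    (mem_nhdsWithin_of_mem_nhds (Iio_mem_nhds hq))).exists
  exact mem_biUnion (dyadicUp_mem_dyadics n q) (mem_iUnion.2 ⟨y, hn, hy1, fun r hr =>
    hy2.trans (h r ⟨(lt_dyadicUp n q).trans hr.1, hr.2⟩)⟩)

/-- If the left limit were nonnegative, the level `D s / 2` would exhibit a downward jump at `s`. At
`s = 0` the left filter is trivial. -/
lemma eventually_neg_of_notMem_downJumps {D : ℝ≥0 → ℝ} (hD : IsCadlag D) {s : ℝ≥0}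
    (hs : s ∉ downJumps D) (h : D s < 0) : ∀ᶠ r in 𝓝[≤] s, D r < 0 := by
  rw [← Iio_insert, nhdsWithin_insert, eventually_sup]
  refine ⟨h, ?_⟩
  obtain ⟨l, hl⟩ := (hD s).2
  rcases lt_or_ge l 0 with h0 | h0
  · exact hl.eventually_lt_const h0
  rcases eq_zero_or_pos s with rfl | hpos
  · simp
  have h1 : ∀ᶠ r in 𝓝[<] s, D s / 2 < D r := hl.eventually_const_lt (by linarith)
  obtain ⟨q, hq, hsub⟩ := (mem_nhdsLT_iff_exists_Ioo_subset' hpos).1 h1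
  exact absurd ⟨D s / 2, by linarith, q, hq, fun r hr => hsub hr⟩ hs

/-- The last time before `s` in the grid `t + ℕ / 2 ^ n`. -/
def gridDown (t : ℝ≥0) (n : ℕ) (s : ℝ≥0) : ℝ≥0 := t + dyadic n ⌊(s - t) * 2 ^ n⌋₊

lemma measurable_gridDown (t : ℝ≥0) (n : ℕ) : Measurable (gridDown t n) := by
  have h1 : Measurable fun s : ℝ≥0 => ⌊(s - t) * 2 ^ n⌋₊ :=
    Nat.measurable_floor.comp ((measurable_id.sub_const t).mul_const _)
  have h2 : Measurable fun k : ℕ => t + dyadic n k := measurable_from_nat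
  exact h2.comp h1

lemma gridDown_eq {t : ℝ≥0} {n k : ℕ} {s : ℝ≥0}
    (hs : s ∈ Ico (t + dyadic n k) (t + dyadic n (k + 1))) : gridDown t n s = t + dyadic n k := by
  have h : ⌊(s - t) * 2 ^ n⌋₊ = k := by
    have h1 : dyadic n k ≤ s - t := le_tsub_of_add_le_left hs.1
    have h2 : s - t < dyadic n (k + 1) := by
      rw [tsub_lt_iff_left (le_self_add.trans hs.1)]; exact hs.2
    rw [Nat.floor_eq_iff (by positivity)]
    unfold dyadic at h1 h2
    rw [div_le_iff₀ (by positivity)] at h1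
    rw [lt_div_iff₀ (by positivity)] at h2
    exact ⟨h1, by exact_mod_cast h2⟩
  rw [gridDown, h]

lemma tendsto_gridDown {t s : ℝ≥0} (hts : t ≤ s) :
    Tendsto (fun n => gridDown t n s) atTop (𝓝[≤] s) := by
  have hle : ∀ n, gridDown t n s ≤ s := fun n => by
    have : dyadic n ⌊(s - t) * 2 ^ n⌋₊ ≤ s - t := by
      unfold dyadic
      rw [div_le_iff₀ (by positivity)]
      exact Nat.floor_le (by positivity)
    calc gridDown t n s ≤ t + (s - t) := by unfold gridDown; gcongr
      _ = s := add_tsub_cancel_of_le hts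
  refine tendsto_nhdsWithin_iff.2 ⟨?_, Eventually.of_forall hle⟩
  have hge : ∀ n, s - (1 / 2) ^ n ≤ gridDown t n s := fun n => by
    have h1 := dyadicUp_le n (s - t)
    have h2 := (lt_dyadicUp n (s - t)).le
    have h3 : dyadicUp n (s - t) = dyadic n ⌊(s - t) * 2 ^ n⌋₊ + (1 / 2) ^ n := by
      unfold dyadicUp dyadic
      push_cast
      rw [add_div, div_pow, one_pow]
    rw [tsub_le_iff_right, gridDown, add_assoc, ← h3]
    calc s = t + (s - t) := (add_tsub_cancel_of_le hts).symm
      _ ≤ _ := by gcongr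
  refine tendsto_of_tendsto_of_tendsto_of_le_of_le ?_ tendsto_const_nhds hge hle
  have : Tendsto (fun n : ℕ => ((1 : ℝ≥0) / 2) ^ n) atTop (𝓝 0) :=
    tendsto_pow_atTop_nhds_zero_of_lt_one (by positivity)
      (by rw [div_lt_one (by positivity)]; norm_num)
  simpa using (tendsto_const_nhds (x := s)).sub this

section Comparison

variable {Ω : Type*} {m : MeasurableSpace Ω} {𝓕 : Filtration ℝ≥0 m} {P : Measure Ω}

lemma setLIntegral_lintegral_Ici_split {Y : ℝ≥0 → Ω → ℝ≥0∞} (hY : IsProgressive 𝓕 Y) {t u : ℝ≥0}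
    (htu : t ≤ u) (A : Set Ω) :
    ∫⁻ ω in A, ∫⁻ s in Ici t, Y s ω ∂leb ∂P =
      ∫⁻ ω in A, ∫⁻ s in Ico t u, Y s ω ∂leb ∂P + ∫⁻ ω in A, ∫⁻ s in Ici u, Y s ω ∂leb ∂P := by
  rw [← lintegral_add_left (measurable_setLIntegral_of_isProgressive hY _)]
  refine lintegral_congr fun ω => ?_
  rw [← Ico_union_Ici_eq_Ici htu, lintegral_union measurableSet_Ici]
  exact disjoint_left.2 fun x hx hx' => absurd hx.2 (not_lt.2 hx')

variable [IsProbabilityMeasure P]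

/-- A single step of the comparison argument. -/
lemma lintegral_tsub_le_step {Y Y' : ℝ≥0 → Ω → ℝ≥0∞} {X X' : ℝ≥0 → Ω → ℝ≥0}
    (hY : IsProgressive 𝓕 Y) (hY' : IsProgressive 𝓕 Y') (hX : IsCadlagTailExp 𝓕 P Y X)
    (hX' : IsCadlagTailExp 𝓕 P Y' X') (hint' : ∫⁻ ω, ∫⁻ s, Y' s ω ∂leb ∂P < ∞)
    {t u : ℝ≥0} (htu : t ≤ u) :
    ∫⁻ ω, ((X t ω : ℝ≥0∞) - X' t ω) ∂P ≤ ∫⁻ ω, ((X u ω : ℝ≥0∞) - X' u ω) ∂P +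
      ∫⁻ ω, ∫⁻ s in Ico t u, {p : ℝ≥0 × Ω | X' t p.2 < X t p.2}.indicator
        (fun p => Y p.1 p.2 - Y' p.1 p.2) (s, ω) ∂leb ∂P := by
  let A : Set Ω := {ω | X' t ω < X t ω}
  have hA : MeasurableSet[𝓕 t] A := measurableSet_lt (hX'.adapted t) (hX.adapted t)
  have hA0 : MeasurableSet A := 𝓕.le t _ hA
  have hAu : MeasurableSet[𝓕 u] A := 𝓕.mono htu _ hA
  have mX : ∀ t, Measurable fun ω => (X t ω : ℝ≥0∞) := fun t =>
    (hX.adapted.measurable (i := t)).coe_nnreal_ennreal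
  have mX' : ∀ t, Measurable fun ω => (X' t ω : ℝ≥0∞) := fun t =>
    (hX'.adapted.measurable (i := t)).coe_nnreal_ennreal
  have h1 : ∫⁻ ω, ((X t ω : ℝ≥0∞) - X' t ω) ∂P = ∫⁻ ω in A, ((X t ω : ℝ≥0∞) - X' t ω) ∂P := by
    rw [← lintegral_indicator hA0]
    refine lintegral_congr fun ω => ?_
    by_cases hω : ω ∈ A
    · rw [indicator_of_mem hω]
    · rw [indicator_of_notMem hω, tsub_eq_zero_iff_le]
      exact_mod_cast not_lt.1 hω
  -- Truncated subtraction commutes with the integral only when the subtracted integral is finite.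
  have hfin : ∫⁻ ω in A, (X' t ω : ℝ≥0∞) ∂P ≠ ∞ := by
    rw [hX'.isTail t A hA]
    exact (((setLIntegral_le_lintegral _ _).trans
      (lintegral_mono fun ω => setLIntegral_le_lintegral _ _)).trans_lt hint').ne
  have h2 : ∫⁻ ω in A, ((X t ω : ℝ≥0∞) - X' t ω) ∂P =
      ∫⁻ ω in A, (X t ω : ℝ≥0∞) ∂P - ∫⁻ ω in A, (X' t ω : ℝ≥0∞) ∂P := by
    refine lintegral_sub (mX' t) hfin ?_
    refine (ae_restrict_iff' hA0).2 (Eventually.of_forall fun ω hω => ?_)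
    exact ENNReal.coe_le_coe.2 (le_of_lt hω)
  -- As `A` lies in `𝓕 t` and hence in `𝓕 u`, the tail identities hold on the same event at both
  -- times, leaving only the integrals over `[t, u)` and the values at `u`.
  rw [h1, h2, tsub_le_iff_right, hX.isTail t A hA, hX'.isTail t A hA,
    setLIntegral_lintegral_Ici_split hY htu, setLIntegral_lintegral_Ici_split hY' htu,
    ← hX.isTail u A hAu, ← hX'.isTail u A hAu]
  have e1 : ∫⁻ ω in A, ∫⁻ s in Ico t u, Y s ω ∂leb ∂P ≤
      ∫⁻ ω in A, ∫⁻ s in Ico t u, Y' s ω ∂leb ∂P +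
      ∫⁻ ω, ∫⁻ s in Ico t u, {p : ℝ≥0 × Ω | X' t p.2 < X t p.2}.indicator
        (fun p => Y p.1 p.2 - Y' p.1 p.2) (s, ω) ∂leb ∂P := by
    refine le_trans ?_ (add_le_add_right (setLIntegral_le_lintegral A _) _)
    rw [← lintegral_add_left (measurable_setLIntegral_of_isProgressive hY' _)]
    refine setLIntegral_mono' hA0 fun ω hω => ?_
    have hm : Measurable fun s => Y' s ω :=
      (measurable_uncurry_of_isProgressive hY').comp measurable_prodMk_right
    rw [← lintegral_add_left hm]
    refine lintegral_mono fun s => ?_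
    have : (s, ω) ∈ {p : ℝ≥0 × Ω | X' t p.2 < X t p.2} := hω
    rw [indicator_of_mem this]
    exact le_add_tsub
  have e2 : ∫⁻ ω in A, (X u ω : ℝ≥0∞) ∂P ≤
      ∫⁻ ω in A, (X' u ω : ℝ≥0∞) ∂P + ∫⁻ ω, ((X u ω : ℝ≥0∞) - X' u ω) ∂P := by
    refine le_trans ?_ (add_le_add_right (setLIntegral_le_lintegral A _) _)
    rw [← lintegral_add_left (mX' u)]
    exact lintegral_mono fun ω => le_add_tsub
  refine (add_le_add e1 e2).trans (le_of_eq ?_)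
  ring

lemma tendsto_lintegral_Ici_atTop {Y : ℝ≥0 → Ω → ℝ≥0∞} (hY : IsProgressive 𝓕 Y)
    (hint : ∫⁻ ω, ∫⁻ s, Y s ω ∂leb ∂P < ∞) {c : ℕ → ℝ≥0} (hc : Tendsto c atTop atTop) :
    Tendsto (fun k => ∫⁻ ω, ∫⁻ s in Ici (c k), Y s ω ∂leb ∂P) atTop (𝓝 0) := by
  have hm := measurable_uncurry_of_isProgressive hY
  have hI : Measurable fun ω => ∫⁻ s, Y s ω ∂leb := Measurable.lintegral_prod_left' hm
  have : (0 : ℝ≥0∞) = ∫⁻ ω, 0 ∂P := by simp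
  rw [this]
  refine tendsto_lintegral_of_dominated_convergence (fun ω => ∫⁻ s, Y s ω ∂leb)
    (fun k => measurable_setLIntegral_of_isProgressive hY _)
    (fun k => Eventually.of_forall fun ω => setLIntegral_le_lintegral _ _) hint.ne ?_
  filter_upwards [ae_lt_top hI hint.ne] with ω hω
  have hmω : Measurable fun s => Y s ω := hm.comp measurable_prodMk_right
  have : (0 : ℝ≥0∞) = ∫⁻ s, 0 ∂leb := by simp
  rw [this]
  simp only [← lintegral_indicator (measurableSet_Ici)]
  refine tendsto_lintegral_of_dominated_convergence (fun s => Y s ω)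
    (fun k => hmω.indicator measurableSet_Ici)
    (fun k => Eventually.of_forall fun s => indicator_le_self _ _ _) hω.ne
    (Eventually.of_forall fun s => ?_)
  refine tendsto_const_nhds.congr' ?_
  filter_upwards [hc.eventually_gt_atTop s] with k hk
  rw [indicator_of_notMem (by simpa using hk)]

/-- Comparison: if `Y ≤ Y'` wherever `X' ≤ X`, then the tail expectation `X` of `Y` is dominated by
the tail expectation `X'` of `Y'`. -/
theorem IsCadlagTailExp.le_of_imp {Y Y' : ℝ≥0 → Ω → ℝ≥0∞} {X X' : ℝ≥0 → Ω → ℝ≥0}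
    (hX : IsCadlagTailExp 𝓕 P Y X) (hX' : IsCadlagTailExp 𝓕 P Y' X')
    (hY : IsProgressive 𝓕 Y) (hY' : IsProgressive 𝓕 Y')
    (hint : ∫⁻ ω, ∫⁻ s, Y s ω ∂leb ∂P < ∞) (hint' : ∫⁻ ω, ∫⁻ s, Y' s ω ∂leb ∂P < ∞)
    (h : ∀ᵐ ω ∂P, ∀ᵐ s ∂leb, X' s ω ≤ X s ω → Y s ω ≤ Y' s ω) :
    ∀ᵐ ω ∂P, ∀ t, X t ω ≤ X' t ω := by
  have hm := measurable_uncurry_of_isProgressive hY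
  have hm' := measurable_uncurry_of_isProgressive hY'
  have hmX := measurable_uncurry_of_isProgressive hX.isProgressive
  have hmX' := measurable_uncurry_of_isProgressive hX'.isProgressive
  have hI : Measurable fun ω => ∫⁻ s, Y s ω ∂leb := Measurable.lintegral_prod_left' hm
  have key : ∀ t, ∀ᵐ ω ∂P, X t ω ≤ X' t ω := by
    intro t
    -- The sign condition is read at the last grid point before `s`, as the one-step estimate
    -- provides.
    let S : ℕ → Set (ℝ≥0 × Ω) := fun n =>
      {p | X' (gridDown t n p.1) p.2 < X (gridDown t n p.1) p.2}
    have hS : ∀ n, MeasurableSet (S n) := fun n => by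
      have hg : Measurable fun p : ℝ≥0 × Ω => (gridDown t n p.1, p.2) :=
        ((measurable_gridDown t n).comp measurable_fst).prodMk measurable_snd
      exact measurableSet_lt (hmX'.comp hg) (hmX.comp hg)
    let F : ℕ → ℝ≥0 × Ω → ℝ≥0∞ := fun n => (S n).indicator fun p => Y p.1 p.2 - Y' p.1 p.2
    have hF : ∀ n, Measurable (F n) := fun n => (hm.sub hm').indicator (hS n)
    have hFle : ∀ n p, F n p ≤ Y p.1 p.2 := fun n p =>
      (indicator_le_self _ _ _).trans tsub_le_self
    have hsum : ∀ n k, ∫⁻ ω, ((X t ω : ℝ≥0∞) - X' t ω) ∂P ≤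
        ∫⁻ ω, ((X (t + dyadic n k) ω : ℝ≥0∞) - X' (t + dyadic n k) ω) ∂P +
          ∫⁻ ω, ∫⁻ s in Ico t (t + dyadic n k), F n (s, ω) ∂leb ∂P := by
      intro n k
      induction k with
      | zero => simp [dyadic]
      | succ k ih =>
        have hle : t + dyadic n k ≤ t + dyadic n (k + 1) := by
          gcongr; exact dyadic_mono n (Nat.le_succ k)
        refine ih.trans ?_
        refine (add_le_add_left (lintegral_tsub_le_step hY hY' hX hX' hint' hle) _).trans ?_
        rw [add_assoc]
        refine add_le_add_right (le_of_eq ?_) _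
        rw [← lintegral_add_right _
          (Measurable.lintegral_prod_left' (hF n))]
        refine lintegral_congr fun ω => ?_
        rw [← Ico_union_Ico_eq_Ico le_self_add hle, lintegral_union measurableSet_Ico, add_comm]
        · congr 1
          refine setLIntegral_congr_fun measurableSet_Ico fun s hs => ?_
          simp only [F, S, indicator, mem_ofPred_eq, gridDown_eq hs]
        · exact disjoint_left.2 fun x hx hx' => absurd hx.2 (not_lt.2 hx'.1)
    -- The remaining term is at most `E X` at the far grid point, which tends to `0` by
    -- integrability of `Y`.
    have hbound : ∀ n, ∫⁻ ω, ((X t ω : ℝ≥0∞) - X' t ω) ∂P ≤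
        ∫⁻ ω, ∫⁻ s in Ici t, F n (s, ω) ∂leb ∂P := by
      intro n
      have hc : Tendsto (fun k => t + dyadic n k) atTop atTop := by
        refine tendsto_atTop_mono (fun k => le_add_self) ?_
        exact tendsto_natCast_atTop_atTop.atTop_div_const (by positivity)
      have hlim := (tendsto_lintegral_Ici_atTop hY hint hc).add_const
        (∫⁻ ω, ∫⁻ s in Ici t, F n (s, ω) ∂leb ∂P)
      rw [zero_add] at hlim
      refine ge_of_tendsto' hlim fun k => (hsum n k).trans (add_le_add ?_ ?_)
      · refine (lintegral_mono fun ω => tsub_le_self).trans (le_of_eq ?_)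
        simpa using hX.isTail (t + dyadic n k) univ MeasurableSet.univ
      · exact lintegral_mono fun ω => lintegral_mono_set Ico_subset_Ici_self
    have hzero : Tendsto (fun n => ∫⁻ ω, ∫⁻ s in Ici t, F n (s, ω) ∂leb ∂P) atTop (𝓝 0) := by
      have : (0 : ℝ≥0∞) = ∫⁻ ω, 0 ∂P := by simp
      rw [this]
      refine tendsto_lintegral_of_dominated_convergence (fun ω => ∫⁻ s, Y s ω ∂leb)
        (fun n => Measurable.lintegral_prod_left' (hF n))
        (fun n => Eventually.of_forall fun ω => (setLIntegral_le_lintegral _ _).trans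
          (lintegral_mono fun s => hFle n (s, ω))) hint.ne ?_
      filter_upwards [ae_lt_top hI hint.ne, h] with ω hω hωY
      have : (0 : ℝ≥0∞) = ∫⁻ s in Ici t, 0 ∂leb := by simp
      rw [this]
      refine tendsto_lintegral_of_dominated_convergence (fun s => Y s ω)
        (fun n => (hF n).comp measurable_prodMk_right)
        (fun n => Eventually.of_forall fun s => hFle n (s, ω))
        ((setLIntegral_le_lintegral _ _).trans_lt hω).ne ?_
      let D : ℝ≥0 → ℝ := fun s => (X s ω : ℝ) - X' s ω
      have hD : IsCadlag D := fun s => by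
        obtain ⟨h1, l, h2⟩ := hX.cadlag ω s
        obtain ⟨h1', l', h2'⟩ := hX'.cadlag ω s
        exact ⟨(NNReal.continuous_coe.continuousAt.comp_continuousWithinAt h1).sub
          (NNReal.continuous_coe.continuousAt.comp_continuousWithinAt h1'), _,
          ((NNReal.continuous_coe.tendsto _).comp h2).sub
            ((NNReal.continuous_coe.tendsto _).comp h2')⟩
      -- Off the downward jumps of `X - X'`, a strict inequality `X < X'` at `s` already holds at
      -- the nearby earlier grid points, so the indicator vanishes. If instead `X' ≤ X` at `s`, the
      -- factor `Y - Y'` vanishes.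
      have hJ : ∀ᵐ s ∂leb, s ∉ downJumps D :=
        measure_eq_zero_iff_ae_notMem.1 ((countable_downJumps D).measure_zero leb)
      refine (ae_restrict_iff' measurableSet_Ici).2 ?_
      filter_upwards [hJ, hωY] with s hs hsY hst
      refine tendsto_const_nhds.congr' ?_
      by_cases hD0 : D s < 0
      · filter_upwards [(tendsto_gridDown (mem_Ici.1 hst)).eventually
          (eventually_neg_of_notMem_downJumps hD hs hD0)] with n hn
        refine (indicator_of_notMem (s := S n) ?_ _).symm
        have : (X (gridDown t n s) ω : ℝ) < X' (gridDown t n s) ω := sub_neg.1 hn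
        exact not_lt.2 (by exact_mod_cast this.le)
      · refine Eventually.of_forall fun n => ?_
        have h1 : (X' s ω : ℝ) ≤ X s ω := sub_nonneg.1 (not_lt.1 hD0)
        have h2 := hsY (by exact_mod_cast h1)
        simp only [F, indicator, tsub_eq_zero_of_le h2, ite_self]
    have hle := ge_of_tendsto' hzero hbound
    have h0 : ∫⁻ ω, ((X t ω : ℝ≥0∞) - X' t ω) ∂P = 0 := le_antisymm hle zero_le
    have hms : Measurable fun ω => (X t ω : ℝ≥0∞) - X' t ω :=
      (hX.adapted.measurable (i := t)).coe_nnreal_ennreal.sub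
        (hX'.adapted.measurable (i := t)).coe_nnreal_ennreal
    filter_upwards [(lintegral_eq_zero_iff hms).1 h0] with ω hω
    exact_mod_cast tsub_eq_zero_iff_le.1 hω
  -- Right-continuity extends the inequality from the countably many dyadic times to all times
  -- outside one null set.
  filter_upwards [(ae_ball_iff countable_dyadics).2 fun d _ => key d] with ω hω t
  refine le_of_tendsto_of_tendsto
    ((hX.cadlag ω t).1.tendsto.comp (tendsto_dyadicUp t))
    ((hX'.cadlag ω t).1.tendsto.comp (tendsto_dyadicUp t))
    (Eventually.of_forall fun n => hω _ (dyadicUp_mem_dyadics n t))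

end Comparison

/-! ### Discounting of tail expectations -/

lemma setLIntegral_Icc_leb_of_hasDerivAt {F f : ℝ → ℝ} (hF : ∀ x, HasDerivAt F (f x) x)
    (hf : Continuous f) (hf0 : ∀ x, 0 ≤ f x) {t r : ℝ≥0} (htr : t ≤ r) :
    ∫⁻ s in Icc t r, ENNReal.ofReal (f s) ∂leb = ENNReal.ofReal (F r - F t) := by
  have h1 : Icc t r = ((↑) : ℝ≥0 → ℝ) ⁻¹' Icc (t : ℝ) r := by ext; simp
  rw [h1, setLIntegral_leb measurableSet_Icc fun x => ENNReal.ofReal (f x),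
    inter_eq_self_of_subset_right (fun x hx => mem_Ici.2 (t.2.trans hx.1)),
    ← ofReal_integral_eq_lintegral_ofReal (hf.integrableOn_Icc) (Eventually.of_forall hf0),
    integral_Icc_eq_integral_Ioc, ← intervalIntegral.integral_of_le (by exact_mod_cast htr),
    intervalIntegral.integral_eq_sub_of_hasDerivAt (fun x _ => hF x) (hf.intervalIntegrable _ _)]

lemma measurable_lintegral_Ici {α : Type*} [MeasurableSpace α] {Y : ℝ≥0 → α → ℝ≥0∞}
    (hY : Measurable fun p : ℝ≥0 × α => Y p.1 p.2) :
    Measurable fun p : ℝ≥0 × α => ∫⁻ r in Ici p.1, Y r p.2 ∂leb := by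
  have h : Measurable fun q : (ℝ≥0 × α) × ℝ≥0 =>
      {q : (ℝ≥0 × α) × ℝ≥0 | q.1.1 ≤ q.2}.indicator (fun q => Y q.2 q.1.2) q :=
    (hY.comp (measurable_snd.prodMk (measurable_snd.comp measurable_fst))).indicator
      (measurableSet_le (measurable_fst.comp measurable_fst) measurable_snd)
  have h2 : (fun p : ℝ≥0 × α => ∫⁻ r in Ici p.1, Y r p.2 ∂leb) = fun p => ∫⁻ r,
      {q : (ℝ≥0 × α) × ℝ≥0 | q.1.1 ≤ q.2}.indicator (fun q => Y q.2 q.1.2) (p, r) ∂leb := by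
    ext p
    rw [← lintegral_indicator measurableSet_Ici]
    rfl
  rw [h2]
  exact h.lintegral_prod_right'

/-- Tonelli's theorem on the region `t ≤ s ≤ r`. -/
lemma lintegral_Ici_mul_lintegral_Ici {φ f : ℝ≥0 → ℝ≥0∞} (hφ : Measurable φ) (hf : Measurable f)
    (t : ℝ≥0) : ∫⁻ s in Ici t, φ s * ∫⁻ r in Ici s, f r ∂leb ∂leb =
      ∫⁻ r in Ici t, (∫⁻ s in Icc t r, φ s ∂leb) * f r ∂leb := by
  let S : Set (ℝ≥0 × ℝ≥0) := {p : ℝ≥0 × ℝ≥0 | t ≤ p.1} ∩ {p | p.1 ≤ p.2}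
  have hS : MeasurableSet S :=
    MeasurableSet.inter (measurableSet_le (measurable_const (a := t)) measurable_fst)
      (measurableSet_le measurable_fst measurable_snd)
  let g : ℝ≥0 → ℝ≥0 → ℝ≥0∞ := fun s r => S.indicator (fun p => φ p.1 * f p.2) (s, r)
  have hg : Measurable (Function.uncurry g) :=
    ((hφ.comp measurable_fst).mul (hf.comp measurable_snd)).indicator hS
  have h1 : ∫⁻ s in Ici t, φ s * ∫⁻ r in Ici s, f r ∂leb ∂leb = ∫⁻ s, ∫⁻ r, g s r ∂leb ∂leb := by
    rw [← lintegral_indicator measurableSet_Ici]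
    refine lintegral_congr fun s => ?_
    by_cases hs : t ≤ s
    · rw [indicator_of_mem (mem_Ici.2 hs), ← lintegral_const_mul _ hf,
        ← lintegral_indicator measurableSet_Ici]
      refine lintegral_congr fun r => ?_
      simp [g, S, indicator, hs]
    · rw [indicator_of_notMem (by simpa using hs)]
      simp [g, S, hs]
  have h2 : ∫⁻ r in Ici t, (∫⁻ s in Icc t r, φ s ∂leb) * f r ∂leb =
      ∫⁻ r, ∫⁻ s, g s r ∂leb ∂leb := by
    rw [← lintegral_indicator measurableSet_Ici]
    refine lintegral_congr fun r => ?_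
    by_cases hr : t ≤ r
    · rw [indicator_of_mem (mem_Ici.2 hr), ← lintegral_mul_const _ hφ,
        ← lintegral_indicator measurableSet_Icc]
      refine lintegral_congr fun s => ?_
      simp [g, S, indicator]
    · rw [indicator_of_notMem (by simpa using hr)]
      have : ∀ s, g s r = 0 := fun s => indicator_of_notMem (s := S)
        (fun h => hr (le_trans h.1 h.2)) _
      simp [this]
  rw [h1, h2, lintegral_lintegral_swap hg.aemeasurable]

section Discount

variable {Ω : Type*} {m : MeasurableSpace Ω} {𝓕 : Filtration ℝ≥0 m} {P : Measure Ω}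
  [IsProbabilityMeasure P]

/-- For `s ≥ t` the event `A` also lies in `𝓕 s`, so `X s` may be replaced on it by the tail
integral of `Y`; exchanging the order of integration collects the weight in front of `Y`. -/
lemma IsTail.weighted {Y X : ℝ≥0 → Ω → ℝ≥0∞} (h : IsTail 𝓕 P Y X) (hX : IsProgressive 𝓕 X)
    (hY : IsProgressive 𝓕 Y) {φ : ℝ≥0 → ℝ≥0∞} (hφ : Measurable φ) (t : ℝ≥0) {A : Set Ω}
    (hA : MeasurableSet[𝓕 t] A) :
    ∫⁻ ω in A, ∫⁻ s in Ici t, φ s * X s ω ∂leb ∂P =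
      ∫⁻ ω in A, ∫⁻ r in Ici t, (∫⁻ s in Icc t r, φ s ∂leb) * Y r ω ∂leb ∂P := by
  have hm := measurable_uncurry_of_isProgressive hY
  have hmX := measurable_uncurry_of_isProgressive hX
  have h1 : ∫⁻ ω in A, ∫⁻ s in Ici t, φ s * X s ω ∂leb ∂P =
      ∫⁻ s in Ici t, ∫⁻ ω in A, φ s * X s ω ∂P ∂leb :=
    lintegral_lintegral_swap
      (((hφ.comp measurable_fst).mul hmX).comp measurable_swap).aemeasurable
  have h2 : ∫⁻ s in Ici t, ∫⁻ ω in A, φ s * X s ω ∂P ∂leb =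
      ∫⁻ s in Ici t, ∫⁻ ω in A, φ s * ∫⁻ r in Ici s, Y r ω ∂leb ∂P ∂leb := by
    refine setLIntegral_congr_fun measurableSet_Ici fun s hs => ?_
    rw [lintegral_const_mul _ (hX.adapted.measurable (i := s)),
      lintegral_const_mul _ (measurable_setLIntegral_of_isProgressive hY _),
      h s A (𝓕.mono hs _ hA)]
  have h3 : ∫⁻ s in Ici t, ∫⁻ ω in A, φ s * ∫⁻ r in Ici s, Y r ω ∂leb ∂P ∂leb =
      ∫⁻ ω in A, ∫⁻ s in Ici t, φ s * ∫⁻ r in Ici s, Y r ω ∂leb ∂leb ∂P :=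
    lintegral_lintegral_swap ((hφ.comp measurable_fst).mul
      (measurable_lintegral_Ici hm)).aemeasurable
  rw [h1, h2, h3]
  exact lintegral_congr fun ω =>
    lintegral_Ici_mul_lintegral_Ici hφ (hY.measurable_path ω) t

/-- The exponential weight `e ^ (a s)`. -/
def expWeight (a : ℝ) (s : ℝ≥0) : ℝ≥0∞ := ENNReal.ofReal (Real.exp (a * s))

lemma measurable_expWeight (a : ℝ) : Measurable (expWeight a) := by
  unfold expWeight; fun_prop

lemma expWeight_mul_neg (a : ℝ) (s : ℝ≥0) : expWeight a s * expWeight (-a) s = 1 := by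
  rw [expWeight, expWeight, ← ENNReal.ofReal_mul (Real.exp_nonneg _), ← Real.exp_add]
  simp

lemma expWeight_ne_top (a : ℝ) (s : ℝ≥0) : expWeight a s ≠ ∞ := ENNReal.ofReal_ne_top

lemma expWeight_neg_le_one {a : ℝ} (ha : 0 ≤ a) (s : ℝ≥0) : expWeight (-a) s ≤ 1 := by
  rw [expWeight, ENNReal.ofReal_le_one, Real.exp_le_one_iff]
  nlinarith [mul_nonneg ha s.2]

/-- Stated as a sum, here and for the negative exponent, to avoid truncated subtraction in `ℝ≥0∞`.
-/
lemma lintegral_Icc_expWeight_add {L : ℝ} (hL : 0 ≤ L) {t r : ℝ≥0} (htr : t ≤ r) :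
    ∫⁻ s in Icc t r, ENNReal.ofReal L * expWeight L s ∂leb + expWeight L t = expWeight L r := by
  have h := setLIntegral_Icc_leb_of_hasDerivAt (F := fun x => Real.exp (L * x))
    (f := fun x => L * Real.exp (L * x))
    (fun x => by simpa [mul_comm] using ((hasDerivAt_id x).const_mul L).exp) (by fun_prop)
    (fun x => by positivity) htr
  simp only [expWeight, ← ENNReal.ofReal_mul hL]
  rw [h, ← ENNReal.ofReal_add (sub_nonneg.2 (by gcongr)) (Real.exp_nonneg _)]
  simp

lemma lintegral_Icc_expWeight_neg_add {L : ℝ} (hL : 0 ≤ L) {t r : ℝ≥0} (htr : t ≤ r) :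
    ∫⁻ s in Icc t r, ENNReal.ofReal L * expWeight (-L) s ∂leb + expWeight (-L) r =
      expWeight (-L) t := by
  have h := setLIntegral_Icc_leb_of_hasDerivAt (F := fun x => -Real.exp (-L * x))
    (f := fun x => L * Real.exp (-L * x))
    (fun x => by simpa [mul_comm] using (((hasDerivAt_id x).const_mul (-L)).exp).fun_neg)
    (by fun_prop)
    (fun x => by positivity) htr
  have hle : Real.exp (-L * r) ≤ Real.exp (-L * t) := by
    have : (t : ℝ) ≤ r := htr
    exact Real.exp_le_exp.2 (by nlinarith)
  simp only [expWeight, ← ENNReal.ofReal_mul hL]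
  rw [h, ← ENNReal.ofReal_add (by linarith) (Real.exp_nonneg _)]
  simp

lemma _root_.MeasureTheory.IsProgressive.weight {Y : ℝ≥0 → Ω → ℝ≥0∞}
    (hY : IsProgressive 𝓕 Y) (a : ℝ) :
    IsProgressive 𝓕 fun s ω => expWeight a s * Y s ω :=
  hY.map (f := fun p : ℝ≥0 × ℝ≥0∞ => expWeight a p.1 * p.2)
    (((measurable_expWeight a).comp measurable_fst).mul measurable_snd)

/-- If `X` is the tail expectation of `Y`, then `e^{-Lt} X_t` is the tail expectation of
`e^{-Ls} (Y_s + L X_s)`. -/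
theorem IsTail.discount {Y X : ℝ≥0 → Ω → ℝ≥0∞} (h : IsTail 𝓕 P Y X) (hX : IsProgressive 𝓕 X)
    (hY : IsProgressive 𝓕 Y) {L : ℝ} (hL : 0 ≤ L) :
    IsTail 𝓕 P (fun s ω => expWeight (-L) s * (Y s ω + ENNReal.ofReal L * X s ω))
      fun t ω => expWeight (-L) t * X t ω := by
  intro t A hA
  have hmX := measurable_uncurry_of_isProgressive hX
  have hm := measurable_uncurry_of_isProgressive hY
  have hYw := hY.weight (-L)
  -- The `L X` part of the driver contributes `e^{-Lt} - e^{-Lr}` in front of `Y r`; with the factor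
  -- `e^{-Lr}` already there this gives `e^{-Lt}`.
  have hw := h.weighted hX hY (φ := fun s => ENNReal.ofReal L * expWeight (-L) s)
    ((measurable_expWeight _).const_mul _) t hA
  have e1 : ∫⁻ ω in A, ∫⁻ s in Ici t,
      expWeight (-L) s * (Y s ω + ENNReal.ofReal L * X s ω) ∂leb ∂P =
      ∫⁻ ω in A, ∫⁻ s in Ici t, expWeight (-L) s * Y s ω ∂leb ∂P +
        ∫⁻ ω in A, ∫⁻ s in Ici t, ENNReal.ofReal L * expWeight (-L) s * X s ω ∂leb ∂P := by
    rw [← lintegral_add_left (measurable_setLIntegral_of_isProgressive hYw _)]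
    refine lintegral_congr fun ω => ?_
    rw [← lintegral_add_left
      (hYw.measurable_path ω)]
    refine lintegral_congr fun s => ?_
    ring
  rw [e1, hw, ← lintegral_add_left (measurable_setLIntegral_of_isProgressive hYw _),
    lintegral_const_mul _ (hX.adapted.measurable (i := t)), h t A hA,
    ← lintegral_const_mul _ (measurable_setLIntegral_of_isProgressive hY _)]
  refine lintegral_congr fun ω => ?_
  rw [← lintegral_add_left
    (hYw.measurable_path ω),
    ← lintegral_const_mul _ (hY.measurable_path ω)]
  refine setLIntegral_congr_fun measurableSet_Ici fun s hs => ?_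
  rw [← lintegral_Icc_expWeight_neg_add hL hs]
  ring

/-- The converse of `IsTail.discount`, for integrable `X`. -/
theorem IsTail.of_discount {Y X : ℝ≥0 → Ω → ℝ≥0∞} {L : ℝ} (hL : 0 ≤ L)
    (h : IsTail 𝓕 P (fun s ω => expWeight (-L) s * (Y s ω + ENNReal.ofReal L * X s ω))
      fun t ω => expWeight (-L) t * X t ω) (hX : IsProgressive 𝓕 X)
    (hY : IsProgressive 𝓕 Y) (hint : ∫⁻ ω, ∫⁻ s, X s ω ∂leb ∂P < ∞) :
    IsTail 𝓕 P Y X := by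
  intro t A hA
  have hmX := measurable_uncurry_of_isProgressive hX
  have hm := measurable_uncurry_of_isProgressive hY
  let G : ℝ≥0 → Ω → ℝ≥0∞ := fun s ω => Y s ω + ENNReal.ofReal L * X s ω
  have hXL : IsProgressive 𝓕 fun s ω => ENNReal.ofReal L * X s ω :=
    hX.map (f := fun p : ℝ≥0 × ℝ≥0∞ => ENNReal.ofReal L * p.2) (measurable_snd.const_mul _)
  have hG : IsProgressive 𝓕 G := hY.add hXL
  -- The growing weight `L e^{Ls}` undoes the discount: it turns the discounted process into `L X`
  -- and leaves `e^{Lr} - e^{Lt}` in front of the discounted driver.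
  have hw := h.weighted (hX.weight (-L)) (hG.weight (-L))
    (φ := fun s => ENNReal.ofReal L * expWeight L s) ((measurable_expWeight _).const_mul _) t hA
  have e0 : ∀ s (x : ℝ≥0∞), expWeight L s * (expWeight (-L) s * x) = x := fun s x => by
    rw [← mul_assoc, expWeight_mul_neg, one_mul]
  have e1 : ∫⁻ ω in A, ∫⁻ s in Ici t, ENNReal.ofReal L * X s ω ∂leb ∂P =
      ∫⁻ ω in A, ∫⁻ r in Ici t, (∫⁻ s in Icc t r, ENNReal.ofReal L * expWeight L s ∂leb) *
        (expWeight (-L) r * G r ω) ∂leb ∂P := by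
    rw [← hw]
    simp only [mul_assoc, e0]
  have e2 : ∫⁻ ω in A, X t ω ∂P =
      ∫⁻ ω in A, ∫⁻ s in Ici t, expWeight L t * (expWeight (-L) s * G s ω) ∂leb ∂P := by
    have h1 : ∫⁻ ω in A, X t ω ∂P = expWeight L t * ∫⁻ ω in A, expWeight (-L) t * X t ω ∂P := by
      rw [← lintegral_const_mul _ ((hX.adapted.measurable (i := t)).const_mul _)]
      simp only [e0]
    rw [h1, h t A hA, ← lintegral_const_mul _
      (measurable_setLIntegral_of_isProgressive (hG.weight (-L)) _)]
    refine lintegral_congr fun ω => ?_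
    rw [← lintegral_const_mul _
      ((hG.weight (-L)).measurable_path ω)]
  have e3 : ∫⁻ ω in A, ∫⁻ s in Ici t, ENNReal.ofReal L * X s ω ∂leb ∂P + ∫⁻ ω in A, X t ω ∂P =
      ∫⁻ ω in A, ∫⁻ s in Ici t, G s ω ∂leb ∂P := by
    have hme : IsProgressive 𝓕 fun s ω => expWeight L t * (expWeight (-L) s * G s ω) :=
      (hG.weight (-L)).map (f := fun p : ℝ≥0 × ℝ≥0∞ => expWeight L t * p.2)
        (measurable_snd.const_mul _)
    rw [e1, e2, ← lintegral_add_right _ (measurable_setLIntegral_of_isProgressive hme _)]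
    refine lintegral_congr fun ω => ?_
    rw [← lintegral_add_right _
      (hme.measurable_path ω)]
    refine setLIntegral_congr_fun measurableSet_Ici fun s hs => ?_
    rw [← add_mul, lintegral_Icc_expWeight_add hL hs, e0]
  have e4 : ∫⁻ ω in A, ∫⁻ s in Ici t, G s ω ∂leb ∂P =
      ∫⁻ ω in A, ∫⁻ s in Ici t, ENNReal.ofReal L * X s ω ∂leb ∂P +
        ∫⁻ ω in A, ∫⁻ s in Ici t, Y s ω ∂leb ∂P := by
    rw [← lintegral_add_left (measurable_setLIntegral_of_isProgressive hXL _)]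
    refine lintegral_congr fun ω => ?_
    rw [← lintegral_add_left
      (hXL.measurable_path ω)]
    exact lintegral_congr fun s => add_comm _ _
  have hfin : ∫⁻ ω in A, ∫⁻ s in Ici t, ENNReal.ofReal L * X s ω ∂leb ∂P ≠ ∞ := by
    have : ∫⁻ ω, ∫⁻ s, ENNReal.ofReal L * X s ω ∂leb ∂P < ∞ := by
      have h1 : ∀ ω, ∫⁻ s, ENNReal.ofReal L * X s ω ∂leb = ENNReal.ofReal L * ∫⁻ s, X s ω ∂leb :=
        fun ω => lintegral_const_mul _ (hX.measurable_path ω)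
      simp only [h1]
      rw [lintegral_const_mul _ (Measurable.lintegral_prod_left' hmX)]
      exact ENNReal.mul_lt_top ENNReal.ofReal_lt_top hint
    exact (((setLIntegral_le_lintegral _ _).trans
      (lintegral_mono fun ω => setLIntegral_le_lintegral _ _)).trans_lt this).ne
  -- Both identities contain the integral of `L X`; cancelling it is where integrability of `X`
  -- enters.
  exact (ENNReal.add_right_inj hfin).1 (e3.trans e4)

end Discount

/-! ### Monotone iteration -/

section Iteration

variable {Ω : Type*} {m : MeasurableSpace Ω} {𝓕 : Filtration ℝ≥0 m} {P : Measure Ω}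

lemma IsTail.congr {Y Y' X : ℝ≥0 → Ω → ℝ≥0∞} (h : IsTail 𝓕 P Y X)
    (hYY' : ∀ᵐ ω ∂P, ∀ᵐ s ∂leb, Y s ω = Y' s ω) : IsTail 𝓕 P Y' X := fun t A hA => by
  rw [h t A hA]
  refine lintegral_congr_ae (ae_restrict_of_ae ?_)
  filter_upwards [hYY'] with ω hω using lintegral_congr_ae (ae_restrict_of_ae hω)

lemma IsTail.congr_left {Y X X' : ℝ≥0 → Ω → ℝ≥0∞} (h : IsTail 𝓕 P Y X)
    (hXX' : ∀ t, ∀ᵐ ω ∂P, X t ω = X' t ω) : IsTail 𝓕 P Y X' := fun t A hA => by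
  rw [← h t A hA]
  exact lintegral_congr_ae (ae_restrict_of_ae ((hXX' t).mono fun _ hω => hω.symm))

lemma IsTail.const_mul {Y X : ℝ≥0 → Ω → ℝ≥0∞} (h : IsTail 𝓕 P Y X) (hX : Adapted 𝓕 X)
    (hY : IsProgressive 𝓕 Y) (c : ℝ≥0∞) :
    IsTail 𝓕 P (fun s ω => c * Y s ω) fun t ω => c * X t ω := fun t A hA => by
  rw [lintegral_const_mul _ (hX.measurable (i := t)), h t A hA,
    ← lintegral_const_mul _ (measurable_setLIntegral_of_isProgressive hY _)]
  exact lintegral_congr fun ω => (lintegral_const_mul _ (hY.measurable_path ω)).symm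

lemma tendsto_setLIntegral_of_monotone {Y : ℕ → ℝ≥0 → Ω → ℝ≥0∞} {Z : ℝ≥0 → Ω → ℝ≥0∞}
    (hY : ∀ n, IsProgressive 𝓕 (Y n))
    (hmono : ∀ᵐ ω ∂P, ∀ᵐ s ∂leb, Monotone fun n => Y n s ω)
    (hlim : ∀ᵐ ω ∂P, ∀ᵐ s ∂leb, Tendsto (fun n => Y n s ω) atTop (𝓝 (Z s ω)))
    (A : Set Ω) (J : Set ℝ≥0) :
    Tendsto (fun n => ∫⁻ ω in A, ∫⁻ s in J, Y n s ω ∂leb ∂P) atTop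
      (𝓝 (∫⁻ ω in A, ∫⁻ s in J, Z s ω ∂leb ∂P)) := by
  refine lintegral_tendsto_of_tendsto_of_monotone
    (fun n => (measurable_setLIntegral_of_isProgressive (hY n) J).aemeasurable) ?_ ?_
  · filter_upwards [ae_restrict_of_ae hmono] with ω hω n n' hnn'
    refine lintegral_mono_ae (ae_restrict_of_ae ?_)
    filter_upwards [hω] with s hs using hs hnn'
  · filter_upwards [ae_restrict_of_ae hmono, ae_restrict_of_ae hlim] with ω hω hω'
    exact lintegral_tendsto_of_tendsto_of_monotone
      (fun n => ((hY n).measurable_path ω).aemeasurable) (ae_restrict_of_ae hω)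
      (ae_restrict_of_ae hω')

variable [IsProbabilityMeasure P]

/-- Fubini's theorem for null sets. It converts statements at each fixed time into statements that
may be used inside the time integral. -/
lemma ae_ae_of_forall_ae {p : ℝ≥0 → Ω → Prop} (hp : MeasurableSet {x : ℝ≥0 × Ω | p x.1 x.2})
    (h : ∀ t, ∀ᵐ ω ∂P, p t ω) : ∀ᵐ ω ∂P, ∀ᵐ s ∂leb, p s ω :=
  (Measure.ae_ae_comm hp).1 (ae_of_all _ h)

lemma IsTail.ae_le {Y Y' X X' : ℝ≥0 → Ω → ℝ≥0∞} (h : IsTail 𝓕 P Y X) (h' : IsTail 𝓕 P Y' X')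
    (hX : Adapted 𝓕 X) (hX' : Adapted 𝓕 X') (hYY' : ∀ᵐ ω ∂P, ∀ᵐ s ∂leb, Y s ω ≤ Y' s ω)
    (t : ℝ≥0) : ∀ᵐ ω ∂P, X t ω ≤ X' t ω := by
  have h1 := ae_eq_condLExp (𝓕.le t) P _ (hX t) fun A hA => h t A hA
  have h2 := ae_eq_condLExp (𝓕.le t) P _ (hX' t) fun A hA => h' t A hA
  have h3 : (fun ω => ∫⁻ s in Ici t, Y s ω ∂leb) ≤ᵐ[P] fun ω => ∫⁻ s in Ici t, Y' s ω ∂leb := by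
    filter_upwards [hYY'] with ω hω using lintegral_mono_ae (ae_restrict_of_ae hω)
  filter_upwards [h1, h2, condLExp_mono (mΩ := 𝓕 t) h3] with ω h1 h2 h3
  rw [h1, h2]
  exact h3

/-- A solution of a tail equation has a càdlàg version, which solves the equation too. -/
lemma IsTail.exists_cadlag (h𝓕 : IsStochasticBasis 𝓕 P) {Φ : ℝ≥0 → Ω → ℝ≥0∞ → ℝ≥0∞}
    {W : ℝ≥0 → Ω → ℝ≥0∞} (h : IsTail 𝓕 P (fun s ω => Φ s ω (W s ω)) W) (hW : IsProgressive 𝓕 W)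
    (hΦ : IsProgressive 𝓕 fun s ω => Φ s ω (W s ω))
    (hint : ∫⁻ ω, ∫⁻ s, Φ s ω (W s ω) ∂leb ∂P < ∞) :
    ∃ X : ℝ≥0 → Ω → ℝ≥0, IsCadlagTailExp 𝓕 P (fun s ω => Φ s ω (X s ω)) X ∧
      (∀ t, ∀ᵐ ω ∂P, (X t ω : ℝ≥0∞) = W t ω) ∧
      ∀ᵐ ω ∂P, ∀ᵐ s ∂leb, (X s ω : ℝ≥0∞) = W s ω := by
  obtain ⟨X, hX⟩ := exists_isCadlagTailExp h𝓕 hΦ hint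
  have h1 : ∀ t, ∀ᵐ ω ∂P, (X t ω : ℝ≥0∞) = W t ω := fun t =>
    hX.isTail.ae_eq h (fun t => (hX.adapted t).coe_nnreal_ennreal) hW.adapted t
  have h2 : ∀ᵐ ω ∂P, ∀ᵐ s ∂leb, (X s ω : ℝ≥0∞) = W s ω :=
    ae_ae_of_forall_ae (measurableSet_eq_fun
      (measurable_uncurry_of_isProgressive hX.isProgressive).coe_nnreal_ennreal
      (measurable_uncurry_of_isProgressive hW)) h1
  refine ⟨X, (hX.isTail.congr ?_).isCadlagTailExp hX.adapted hX.cadlag, h1, h2⟩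
  filter_upwards [h2] with ω hω
  filter_upwards [hω] with s hs
  rw [hs]

lemma expWeight_mul_le_iff (a : ℝ) (s : ℝ≥0) {x y : ℝ≥0∞} :
    expWeight a s * x ≤ expWeight a s * y ↔ x ≤ y :=
  ENNReal.mul_le_mul_iff_right (by simp [expWeight, Real.exp_pos]) (expWeight_ne_top a s)

/-- Between a subsolution `l` and a supersolution `u`, the tail equation `X = E[∫ Φ(X)]` has a
solution, provided that `w ↦ Φ(w) + L w` is monotone there for some constant `L`. -/
theorem exists_isTail_of_sub_super (h𝓕 : IsStochasticBasis 𝓕 P)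
    {Φ : ℝ≥0 → Ω → ℝ≥0∞ → ℝ≥0∞} {l u yl yu : ℝ≥0 → Ω → ℝ≥0∞} {L : ℝ} (hL : 0 ≤ L)
    (hΦ : ∀ W, IsProgressive 𝓕 W → IsProgressive 𝓕 fun s ω => Φ s ω (W s ω))
    (hΦc : ∀ s ω, Continuous (Φ s ω))
    (hl : IsProgressive 𝓕 l) (hu : IsProgressive 𝓕 u) (hyl : IsProgressive 𝓕 yl)
    (hyu : IsProgressive 𝓕 yu) (hlu : ∀ s ω, l s ω ≤ u s ω)
    (htl : IsTail 𝓕 P yl l) (htu : IsTail 𝓕 P yu u)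
    (hmono : ∀ᵐ ω ∂P, ∀ s, ∀ w w', l s ω ≤ w → w ≤ w' → w' ≤ u s ω →
      Φ s ω w + ENNReal.ofReal L * w ≤ Φ s ω w' + ENNReal.ofReal L * w')
    (hsub : ∀ᵐ ω ∂P, ∀ s, yl s ω ≤ Φ s ω (l s ω)) (hsup : ∀ᵐ ω ∂P, ∀ s, Φ s ω (u s ω) ≤ yu s ω)
    (hinty : ∫⁻ ω, ∫⁻ s, yu s ω ∂leb ∂P < ∞) (hintu : ∫⁻ ω, ∫⁻ s, u s ω ∂leb ∂P < ∞) :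
    ∃ W, IsProgressive 𝓕 W ∧ IsTail 𝓕 P (fun s ω => Φ s ω (W s ω)) W ∧
      (∫⁻ ω, ∫⁻ s, Φ s ω (W s ω) ∂leb ∂P < ∞) ∧ ∀ t ω, l t ω ≤ W t ω ∧ W t ω ≤ u t ω := by
  let G : (ℝ≥0 → Ω → ℝ≥0∞) → ℝ≥0 → Ω → ℝ≥0∞ := fun W s ω =>
    expWeight (-L) s * (Φ s ω (W s ω) + ENNReal.ofReal L * W s ω)
  have hLp : ∀ {W : ℝ≥0 → Ω → ℝ≥0∞}, IsProgressive 𝓕 W →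
      IsProgressive 𝓕 fun s ω => ENNReal.ofReal L * W s ω := fun hW =>
    hW.map (f := fun p : ℝ≥0 × ℝ≥0∞ => ENNReal.ofReal L * p.2) (measurable_snd.const_mul _)
  have hG : ∀ {W}, IsProgressive 𝓕 W → IsProgressive 𝓕 (G W) := fun {W} hW =>
    ((hΦ W hW).add (hLp hW)).weight (-L)
  let S := {W : ℝ≥0 → Ω → ℝ≥0∞ // IsProgressive 𝓕 W ∧ ∀ t ω, l t ω ≤ W t ω ∧ W t ω ≤ u t ω}
  have hGle : ∀ W : S, ∀ᵐ ω ∂P, ∀ s,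
      G W.1 s ω ≤ expWeight (-L) s * (yu s ω + ENNReal.ofReal L * u s ω) := by
    intro W
    filter_upwards [hmono, hsup] with ω h1 h2 s
    rw [expWeight_mul_le_iff]
    exact (h1 s _ _ (W.2.2 s ω).1 (W.2.2 s ω).2 le_rfl).trans (add_le_add_left (h2 s) _)
  have hleG : ∀ W : S, ∀ᵐ ω ∂P, ∀ s,
      expWeight (-L) s * (yl s ω + ENNReal.ofReal L * l s ω) ≤ G W.1 s ω := by
    intro W
    filter_upwards [hmono, hsub] with ω h1 h2 s
    rw [expWeight_mul_le_iff]
    exact (add_le_add_left (h2 s) _).trans (h1 s _ _ le_rfl (W.2.2 s ω).1 (W.2.2 s ω).2)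
  have hstep : ∀ W : S, ∃ W' : S, IsTail 𝓕 P (G W.1) fun t ω => expWeight (-L) t * W'.1 t ω := by
    intro W
    have hGp := hG W.2.1
    have hint : ∫⁻ ω, ∫⁻ s, G W.1 s ω ∂leb ∂P < ∞ := by
      have h1 : ∫⁻ ω, ∫⁻ s, G W.1 s ω ∂leb ∂P ≤
          ∫⁻ ω, ∫⁻ s, yu s ω + ENNReal.ofReal L * u s ω ∂leb ∂P := by
        refine lintegral_mono_ae ?_
        filter_upwards [hGle W] with ω hω
        exact lintegral_mono fun s => (hω s).trans
          (mul_le_of_le_one_left zero_le (expWeight_neg_le_one hL s))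
      refine h1.trans_lt ?_
      have h2 : ∀ ω, ∫⁻ s, yu s ω + ENNReal.ofReal L * u s ω ∂leb =
          ∫⁻ s, yu s ω ∂leb + ENNReal.ofReal L * ∫⁻ s, u s ω ∂leb := fun ω => by
        rw [lintegral_add_left (hyu.measurable_path ω),
          lintegral_const_mul _ (hu.measurable_path ω)]
      simp only [h2]
      rw [lintegral_add_left (Measurable.lintegral_prod_left'
        (measurable_uncurry_of_isProgressive hyu)), lintegral_const_mul _
        (Measurable.lintegral_prod_left' (measurable_uncurry_of_isProgressive hu))]
      exact ENNReal.add_lt_top.2 ⟨hinty, ENNReal.mul_lt_top ENNReal.ofReal_lt_top hintu⟩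
    obtain ⟨X, hX⟩ := exists_isCadlagTailExp h𝓕 hGp hint
    have hXp : IsProgressive 𝓕 fun t ω => (X t ω : ℝ≥0∞) := fun i =>
      (hX.isProgressive i).coe_nnreal_ennreal
    have h1 : ∀ t, ∀ᵐ ω ∂P, expWeight (-L) t * l t ω ≤ X t ω := fun t =>
      (htl.discount hl hyl hL).ae_le hX.isTail (hl.weight (-L)).adapted hXp.adapted
        ((hleG W).mono fun ω hω => Eventually.of_forall hω) t
    have h2 : ∀ t, ∀ᵐ ω ∂P, (X t ω : ℝ≥0∞) ≤ expWeight (-L) t * u t ω := fun t =>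
      hX.isTail.ae_le (htu.discount hu hyu hL) hXp.adapted (hu.weight (-L)).adapted
        ((hGle W).mono fun ω hω => Eventually.of_forall hω) t
    -- The undiscounted version lies between `l` and `u` only almost surely at each time; clamping
    -- makes the bounds hold everywhere, so that the iteration stays in `S`.
    let W' : ℝ≥0 → Ω → ℝ≥0∞ := fun t ω => max (l t ω) (min (expWeight L t * X t ω) (u t ω))
    have hW' : IsProgressive 𝓕 W' := fun i =>
      (hl i).max (((hXp.weight L) i).min (hu i))
    refine ⟨⟨W', hW', fun t ω => ⟨le_max_left _ _, max_le (hlu t ω) (min_le_right _ _)⟩⟩, ?_⟩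
    refine hX.isTail.congr_left fun t => ?_
    have e : ∀ x, expWeight (-L) t * (expWeight L t * x) = x := fun x => by
      rw [← mul_assoc, mul_comm (expWeight (-L) t), expWeight_mul_neg, one_mul]
    filter_upwards [h1 t, h2 t] with ω h1 h2
    have h3 : l t ω ≤ expWeight L t * X t ω := by
      rwa [← expWeight_mul_le_iff (-L) t, e]
    have h4 : expWeight L t * X t ω ≤ u t ω := by
      rwa [← expWeight_mul_le_iff (-L) t, e]
    simp only [W', min_eq_left h4, max_eq_right h3, e]
  choose T hT using hstep
  let V : ℕ → S := fun n => T^[n] ⟨l, hl, fun t ω => ⟨le_rfl, hlu t ω⟩⟩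
  have hV : ∀ n, IsTail 𝓕 P (G (V n).1) fun t ω => expWeight (-L) t * (V (n + 1)).1 t ω := by
    intro n
    have : V (n + 1) = T (V n) := Function.iterate_succ_apply' T n _
    rw [this]
    exact hT (V n)
  have hVle : ∀ n t, ∀ᵐ ω ∂P, (V n).1 t ω ≤ (V (n + 1)).1 t ω := by
    intro n
    induction n with
    | zero => exact fun t => Eventually.of_forall fun ω => ((V 1).2.2 t ω).1
    | succ n ih =>
      intro t
      have h1 : ∀ᵐ ω ∂P, ∀ᵐ s ∂leb, (V n).1 s ω ≤ (V (n + 1)).1 s ω :=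
        ae_ae_of_forall_ae (measurableSet_le (measurable_uncurry_of_isProgressive (V n).2.1)
          (measurable_uncurry_of_isProgressive (V (n + 1)).2.1)) ih
      have h2 : ∀ᵐ ω ∂P, ∀ᵐ s ∂leb, G (V n).1 s ω ≤ G (V (n + 1)).1 s ω := by
        filter_upwards [h1, hmono] with ω h1 h2
        filter_upwards [h1] with s h1
        rw [expWeight_mul_le_iff]
        exact h2 s _ _ ((V n).2.2 s ω).1 h1 ((V (n + 1)).2.2 s ω).2
      filter_upwards [(hV n).ae_le (hV (n + 1)) ((V (n + 1)).2.1.weight (-L)).adapted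
        ((V (n + 1 + 1)).2.1.weight (-L)).adapted h2 t] with ω hω
      exact (expWeight_mul_le_iff _ _).1 hω
  have hVm : ∀ t, ∀ᵐ ω ∂P, Monotone fun n => (V n).1 t ω := fun t => by
    filter_upwards [ae_all_iff.2 fun n => hVle n t] with ω hω using monotone_nat_of_le_succ hω
  have hVm' : ∀ᵐ ω ∂P, ∀ᵐ s ∂leb, Monotone fun n => (V n).1 s ω := by
    have h1 : ∀ n, ∀ᵐ ω ∂P, ∀ᵐ s ∂leb, (V n).1 s ω ≤ (V (n + 1)).1 s ω := fun n =>
      ae_ae_of_forall_ae (measurableSet_le (measurable_uncurry_of_isProgressive (V n).2.1)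
        (measurable_uncurry_of_isProgressive (V (n + 1)).2.1)) (hVle n)
    filter_upwards [ae_all_iff.2 h1] with ω hω
    filter_upwards [ae_all_iff.2 hω] with s hs using monotone_nat_of_le_succ hs
  let W : ℝ≥0 → Ω → ℝ≥0∞ := fun t ω => ⨆ n, (V n).1 t ω
  have hW : IsProgressive 𝓕 W := fun i => Measurable.iSup fun n => (V n).2.1 i
  have hWu : ∀ t ω, W t ω ≤ u t ω := fun t ω => iSup_le fun n => ((V n).2.2 t ω).2
  have hWl : ∀ t ω, l t ω ≤ W t ω := fun t ω => le_iSup (fun n => (V n).1 t ω) 0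
  -- Monotone convergence on both sides of the recursion: `hmono` makes the drivers `G (V n)`
  -- increase, and continuity of `Φ` identifies their limit.
  have htail : IsTail 𝓕 P (G W) fun t ω => expWeight (-L) t * W t ω := by
    intro t A hA
    have h1 : Tendsto (fun n => ∫⁻ ω in A, expWeight (-L) t * (V (n + 1)).1 t ω ∂P) atTop
        (𝓝 (∫⁻ ω in A, expWeight (-L) t * W t ω ∂P)) := by
      refine lintegral_tendsto_of_tendsto_of_monotone
        (fun n => ((V (n + 1)).2.1.adapted.measurable (i := t)).const_mul _ |>.aemeasurable) ?_ ?_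
      · filter_upwards [ae_restrict_of_ae (hVm t)] with ω hω n n' h
        exact mul_le_mul_right (hω (Nat.succ_le_succ h)) _
      · filter_upwards [ae_restrict_of_ae (hVm t)] with ω hω
        exact ENNReal.Tendsto.const_mul
          ((tendsto_atTop_iSup hω).comp (tendsto_add_atTop_nat 1)) (Or.inr (expWeight_ne_top _ _))
    have h2 : Tendsto (fun n => ∫⁻ ω in A, ∫⁻ s in Ici t, G (V n).1 s ω ∂leb ∂P) atTop
        (𝓝 (∫⁻ ω in A, ∫⁻ s in Ici t, G W s ω ∂leb ∂P)) := by
      refine tendsto_setLIntegral_of_monotone (fun n => hG (V n).2.1) ?_ ?_ A _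
      · filter_upwards [hVm', hmono] with ω h1 h2
        filter_upwards [h1] with s h1 n n' hnn'
        simp only [G]
        rw [expWeight_mul_le_iff]
        exact h2 s _ _ ((V n).2.2 s ω).1 (h1 hnn') ((V n').2.2 s ω).2
      · filter_upwards [hVm'] with ω h1
        filter_upwards [h1] with s h1
        have h3 := tendsto_atTop_iSup h1
        exact ENNReal.Tendsto.const_mul ((((hΦc s ω).tendsto _).comp h3).add
          (ENNReal.Tendsto.const_mul h3 (Or.inr ENNReal.ofReal_ne_top)))
          (Or.inr (expWeight_ne_top _ _))
    have h3 : ∀ n, ∫⁻ ω in A, expWeight (-L) t * (V (n + 1)).1 t ω ∂P =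
        ∫⁻ ω in A, ∫⁻ s in Ici t, G (V n).1 s ω ∂leb ∂P := fun n => hV n t A hA
    simp only [h3] at h1
    exact tendsto_nhds_unique h1 h2
  have hWt : IsTail 𝓕 P (fun s ω => Φ s ω (W s ω)) W :=
    IsTail.of_discount hL htail hW (hΦ W hW)
      ((lintegral_mono fun ω => lintegral_mono fun s => hWu s ω).trans_lt hintu)
  refine ⟨W, hW, hWt, ?_, fun t ω => ⟨hWl t ω, hWu t ω⟩⟩
  -- Read at time `0`, the tail identity expresses the total integral of the driver as `E W_0 ≤ E
  -- u_0`.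
  have h1 := hWt 0 univ MeasurableSet.univ
  have h2 := htu 0 univ MeasurableSet.univ
  have e : Ici (0 : ℝ≥0) = univ := by ext; simp
  simp only [Measure.restrict_univ, e] at h1 h2
  rw [← h1]
  exact (lintegral_mono fun ω => hWu 0 ω).trans_lt (h2 ▸ hinty)

end Iteration

/-! ### Fixed points of `F_U` -/

/-- For finite `u` the separate cases merely reproduce multiplication in `ℝ≥0∞`, where `u * ∞ = ∞`
for `u ≠ 0`. -/
lemma hEZ_coe {ρ : ℝ} (hρ : ρ < 0) (u : ℝ≥0) (w : ℝ≥0∞) : hEZ ρ u w = u * w ^ ρ := by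
  unfold hEZ
  by_cases hu : u = 0
  · simp [hu]
  · have hu' : (u : ℝ≥0∞) ≠ 0 := by simpa using hu
    simp only [hu', ENNReal.coe_ne_top, or_self, if_false]
    split_ifs with hw
    · rcases hw with rfl | rfl
      · rw [ENNReal.zero_rpow_of_neg hρ, ENNReal.mul_top hu']
      · rw [ENNReal.top_rpow_of_neg hρ, mul_zero]
    · rfl

/-- A convex function lies above its tangents. By scaling this is `1 + ρ (τ - 1) ≤ τ ^ ρ`, which
follows from `1 + z ≤ e^z` at `z = ρ log τ` and from `log τ ≤ τ - 1`, using `ρ < 0`. -/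
lemma rpow_tangent_le {ρ x y : ℝ} (hρ : ρ < 0) (hx : 0 < x) (hy : 0 < y) :
    x ^ ρ + ρ * x ^ (ρ - 1) * (y - x) ≤ y ^ ρ := by
  have hτ : 0 < y / x := div_pos hy hx
  have h1 : 1 + ρ * (y / x - 1) ≤ (y / x) ^ ρ := by
    rw [Real.rpow_def_of_pos hτ]
    nlinarith [Real.add_one_le_exp (Real.log (y / x) * ρ), Real.log_le_sub_one_of_pos hτ]
  have h2 : y ^ ρ = x ^ ρ * (y / x) ^ ρ := by
    rw [← Real.mul_rpow hx.le hτ.le, mul_div_cancel₀ _ hx.ne']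
  have h3 : x ^ ρ = x ^ (ρ - 1) * x := by
    rw [← Real.rpow_add_one hx.ne']; congr 1; ring
  calc x ^ ρ + ρ * x ^ (ρ - 1) * (y - x) = x ^ ρ * (1 + ρ * (y / x - 1)) := by
        rw [h3]; field_simp
    _ ≤ x ^ ρ * (y / x) ^ ρ := by gcongr
    _ = y ^ ρ := h2.symm

/-- The slope of `u w^ρ` is negative and increasing in `w`, so on `[ℓ, ∞)` it is at least its value
at `ℓ`, which `L` compensates. -/
lemma mul_rpow_add_mul_le {ρ L : ℝ} (hρ : ρ < 0) {u ℓ : ℝ≥0} (hℓ : 0 < ℓ) {w w' : ℝ≥0∞}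
    (h1 : ℓ ≤ w) (h2 : w ≤ w') (h3 : w' ≠ ∞) (hL : -ρ * (u * ℓ ^ (ρ - 1)) ≤ L) :
    u * w ^ ρ + ENNReal.ofReal L * w ≤ u * w' ^ ρ + ENNReal.ofReal L * w' := by
  lift w' to ℝ≥0 using h3
  lift w to ℝ≥0 using ne_top_of_le_ne_top ENNReal.coe_ne_top h2
  have h1 : ℓ ≤ w := by exact_mod_cast h1
  have h2 : w ≤ w' := by exact_mod_cast h2
  have hw : 0 < w := hℓ.trans_le h1
  have hw' : 0 < w' := hw.trans_le h2
  have hL0 : 0 ≤ L := le_trans (mul_nonneg (by linarith) (by positivity)) hL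
  rw [← ENNReal.coe_rpow_of_ne_zero hw.ne', ← ENNReal.coe_rpow_of_ne_zero hw'.ne']
  lift L to ℝ≥0 using hL0
  rw [ENNReal.ofReal_coe_nnreal]
  norm_cast
  rw [← NNReal.coe_le_coe]
  push_cast
  have h4 := rpow_tangent_le hρ (NNReal.coe_pos.2 hw) (NNReal.coe_pos.2 hw')
  have h5 : (w : ℝ) ^ (ρ - 1) ≤ (ℓ : ℝ) ^ (ρ - 1) :=
    Real.rpow_le_rpow_of_nonpos (by exact_mod_cast hℓ) (by exact_mod_cast h1) (by linarith)
  have h6 : (0 : ℝ) ≤ w' - w := sub_nonneg.2 (by exact_mod_cast h2)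
  have h7 : -ρ * (u * (w : ℝ) ^ (ρ - 1)) ≤ L := le_trans
    (mul_le_mul_of_nonneg_left (mul_le_mul_of_nonneg_left h5 u.2) (by linarith)) hL
  nlinarith [mul_le_mul_of_nonneg_left h4 u.2, mul_le_mul_of_nonneg_right h7 h6]

lemma ennreal_rpow_anti {ρ : ℝ} (hρ : ρ ≤ 0) {x y : ℝ≥0∞} (h : x ≤ y) : y ^ ρ ≤ x ^ ρ := by
  rw [← neg_neg ρ, ENNReal.rpow_neg, ENNReal.rpow_neg x, ENNReal.inv_le_inv]
  exact ENNReal.rpow_le_rpow h (neg_nonneg.2 hρ)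

/-- Needed for two exponents when `ρ = (θ - 1) / θ`: with `p = ρ` the power of `l` is `θ`, which
gives the supersolution; with `p = ρ - 1` it is `0`, which gives a slope bound independent of time
and scenario. -/
lemma mul_rpow_le_of_order {θ : ℝ} {K K₂ c U l i : ℝ≥0} {p : ℝ}
    (hp : p ≤ 0) (hl : 0 < l) (hK₂ : 0 < K₂) (hc : 0 < c) (hU : U ≤ K * l)
    (hi : l ^ θ ≤ K₂ * i) :
    U * (c * i) ^ p ≤ K * (c / K₂) ^ p * l ^ (1 + θ * p) := by
  have h1 : (c * i) ^ p ≤ (c / K₂ * l ^ θ) ^ p := by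
    refine NNReal.rpow_le_rpow_of_nonpos (by positivity) ?_ hp
    rw [div_mul_eq_mul_div, div_le_iff₀ hK₂, mul_assoc, mul_comm i]
    gcongr
  calc U * (c * i) ^ p ≤ K * l * (c / K₂ * l ^ θ) ^ p := mul_le_mul' hU h1
    _ = K * (c / K₂) ^ p * l ^ (1 + θ * p) := by
      rw [NNReal.mul_rpow, NNReal.rpow_add hl.ne', NNReal.rpow_one, ← NNReal.rpow_mul]
      ring

section FixedPoint

variable {Ω : Type*} {m : MeasurableSpace Ω} {𝓕 : Filtration ℝ≥0 m} {P : Measure Ω}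

lemma _root_.MeasureTheory.IsProgressive.coe_nnreal {X : ℝ≥0 → Ω → ℝ≥0} (hX : IsProgressive 𝓕 X) :
    IsProgressive 𝓕 fun t ω => (X t ω : ℝ≥0∞) := fun i => (hX i).coe_nnreal_ennreal

lemma _root_.MeasureTheory.IsProgressive.mul_rpow {U : ℝ≥0 → Ω → ℝ≥0} (hU : IsProgressive 𝓕 U)
    {W : ℝ≥0 → Ω → ℝ≥0∞} (hW : IsProgressive 𝓕 W) (ρ : ℝ) :
    IsProgressive 𝓕 fun t ω => (U t ω : ℝ≥0∞) * W t ω ^ ρ := fun i =>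
  ((hU i).coe_nnreal_ennreal).mul ((hW i).pow_const ρ)

lemma isFixedPointFU_coe {ρ : ℝ} (hρ : ρ < 0) {U X : ℝ≥0 → Ω → ℝ≥0}
    (hX : IsCadlagTailExp 𝓕 P (fun s ω => U s ω * (X s ω : ℝ≥0∞) ^ ρ) X)
    (hint : ∫⁻ ω, ∫⁻ s, U s ω * (X s ω : ℝ≥0∞) ^ ρ ∂leb ∂P < ∞) :
    IsFixedPointFU 𝓕 P ρ (fun t ω => (U t ω : ℝ≥0∞)) fun t ω => X t ω :=
  ⟨⟨hX.isProgressive.coe_nnreal, by simpa only [hEZ_coe hρ] using hint⟩, X,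
    by simpa only [IsFU, hEZ_coe hρ] using hX, ae_of_all _ fun _ _ => rfl⟩

variable [IsProbabilityMeasure P]

/-- The fixed point equation for `F_U`, perturbed by `ε Λ^θ`, has a solution. -/
lemma exists_isCadlagTailExp_perturbed (h𝓕 : IsStochasticBasis 𝓕 P) {θ : ℝ}
    (hθ : θ ∈ Ioo (0 : ℝ) 1) {Λ U : ℝ≥0 → Ω → ℝ≥0} (hΛ : MemLHat 𝓕 P θ Λ)
    (hU : IsProgressive 𝓕 U) {K : ℝ≥0} (hUK : ∀ᵐ ω ∂P, ∀ t, U t ω ≤ K * Λ t ω) {ε : ℝ≥0}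
    (hε : 0 < ε) (hε1 : ε ≤ 1) :
    ∃ X : ℝ≥0 → Ω → ℝ≥0, IsCadlagTailExp 𝓕 P
        (fun s ω => U s ω * (X s ω : ℝ≥0∞) ^ ((θ - 1) / θ) + ε * (Λ s ω ^ θ : ℝ≥0)) X ∧
      ∫⁻ ω, ∫⁻ s, (U s ω * (X s ω : ℝ≥0∞) ^ ((θ - 1) / θ) + ε * (Λ s ω ^ θ : ℝ≥0)) ∂leb ∂P < ∞ := by
  obtain ⟨I, hI, k, K₂, hk, hK₂, hkK⟩ := hΛ.sameOrder
  have hθ0 : 0 < θ := hθ.1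
  have hρ : (θ - 1) / θ < 0 := div_neg_of_neg_of_pos (by linarith [hθ.2]) hθ0
  set ρ := (θ - 1) / θ with hρdef
  have e1 : 1 + θ * ρ = θ := by rw [hρdef]; field_simp; ring
  have e2 : 1 + θ * (ρ - 1) = 0 := by rw [hρdef]; field_simp; ring
  have hΛp : IsProgressive 𝓕 fun s ω => ((Λ s ω ^ θ : ℝ≥0) : ℝ≥0∞) := fun i =>
    ((hΛ.progressive i).pow_const θ).coe_nnreal_ennreal
  have hIp := hI.isProgressive.coe_nnreal
  have hcm : ∀ {Y : ℝ≥0 → Ω → ℝ≥0∞} (c : ℝ≥0), IsProgressive 𝓕 Y →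
      IsProgressive 𝓕 fun s ω => c * Y s ω := fun c hY i => (hY i).const_mul _
  -- The summand `1` covers the perturbation, since `ε ≤ 1`. The other bounds `U (C I)^ρ` by a
  -- multiple of `Λ^θ`, where `C ≥ 1` allows `(C / K₂)^ρ` to be replaced by `(1 / K₂)^ρ`.
  let C : ℝ≥0 := 1 + K * (1 / K₂) ^ ρ
  have hC1 : 1 ≤ C := le_self_add
  -- The uniform bound for `-ρ U w^{ρ-1}` on `w ≥ ε I`.
  let L : ℝ≥0 := (-ρ).toNNReal * (K * (ε / K₂) ^ (ρ - 1))
  have hIint : ∫⁻ ω, ∫⁻ s, (I s ω : ℝ≥0∞) ∂leb ∂P < ∞ := by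
    have h1 : ∫⁻ ω, ∫⁻ s, (I s ω : ℝ≥0∞) ∂leb ∂P ≤
        ∫⁻ ω, ∫⁻ s, (k⁻¹ : ℝ≥0) * ((Λ s ω ^ θ : ℝ≥0) : ℝ≥0∞) ∂leb ∂P := by
      refine lintegral_mono_ae ?_
      filter_upwards [hkK] with ω hω
      refine lintegral_mono fun s => ?_
      rw [← ENNReal.coe_mul, ENNReal.coe_le_coe, le_inv_mul_iff₀ hk]
      exact (hω s).1
    refine h1.trans_lt ?_
    simp only [lintegral_const_mul _ (hΛp.measurable_path _)]
    rw [lintegral_const_mul _ (Measurable.lintegral_prod_left'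
      (measurable_uncurry_of_isProgressive hΛp))]
    exact ENNReal.mul_lt_top ENNReal.coe_lt_top hΛ.integrable
  have hcint : ∀ {Y : ℝ≥0 → Ω → ℝ≥0∞} (c : ℝ≥0), IsProgressive 𝓕 Y →
      ∫⁻ ω, ∫⁻ s, Y s ω ∂leb ∂P < ∞ → ∫⁻ ω, ∫⁻ s, c * Y s ω ∂leb ∂P < ∞ := fun c hY h => by
    simp only [lintegral_const_mul _ (hY.measurable_path _)]
    rw [lintegral_const_mul _ (Measurable.lintegral_prod_left'
      (measurable_uncurry_of_isProgressive hY))]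
    exact ENNReal.mul_lt_top ENNReal.coe_lt_top h
  have hΦ : ∀ W, IsProgressive 𝓕 W → IsProgressive 𝓕 fun s ω =>
      (U s ω : ℝ≥0∞) * W s ω ^ ρ + ε * (Λ s ω ^ θ : ℝ≥0) := fun W hW =>
    (hU.mul_rpow hW ρ).add (hcm ε hΛp)
  obtain ⟨W, hW, hWt, hWint, hWb⟩ := exists_isTail_of_sub_super h𝓕 (L := L) L.2
    (Φ := fun s ω w => U s ω * w ^ ρ + ε * (Λ s ω ^ θ : ℝ≥0))
    (l := fun s ω => ε * I s ω) (u := fun s ω => C * I s ω)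
    (yl := fun s ω => ε * (Λ s ω ^ θ : ℝ≥0)) (yu := fun s ω => C * (Λ s ω ^ θ : ℝ≥0))
    hΦ
    (fun s ω => ((ENNReal.continuous_const_mul ENNReal.coe_ne_top).comp
      ENNReal.continuous_rpow_const).add continuous_const)
    (hcm ε hIp) (hcm C hIp) (hcm ε hΛp) (hcm C hΛp)
    (fun s ω => by gcongr; exact hε1.trans hC1)
    (hI.isTail.const_mul hIp.adapted hΛp ε) (hI.isTail.const_mul hIp.adapted hΛp C)
    (by
      filter_upwards [hkK, hUK, hΛ.pos] with ω h1 h2 h3 s w w' hlw hww' hw'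
      have hI0 : 0 < I s ω := by
        have : 0 < K₂ * I s ω := (NNReal.rpow_pos (h3 s)).trans_le (h1 s).2
        exact pos_of_mul_pos_right this hK₂.le
      have h5 := mul_rpow_le_of_order (p := ρ - 1) (by linarith) (h3 s) hK₂ hε (h2 s) (h1 s).2
      rw [e2, NNReal.rpow_zero, mul_one] at h5
      have h6 := mul_rpow_add_mul_le (L := L) hρ (ℓ := ε * I s ω) (u := U s ω)
        (mul_pos hε hI0) (by push_cast; exact hlw) hww'
        (ne_top_of_le_ne_top (ENNReal.mul_ne_top ENNReal.coe_ne_top ENNReal.coe_ne_top) hw') (by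
          have h7 : (-ρ).toNNReal * (U s ω * (ε * I s ω) ^ (ρ - 1)) ≤ L := by
            simp only [L]; gcongr
          have h8 := NNReal.coe_le_coe.2 h7
          push_cast at h8
          rw [Real.coe_toNNReal _ (by linarith)] at h8
          push_cast
          exact h8)
      rw [add_right_comm, add_right_comm (_ * _) (_ * _) (_ * w')]
      exact add_le_add_left h6 _)
    (ae_of_all _ fun ω s => le_add_self)
    (by
      filter_upwards [hkK, hUK, hΛ.pos] with ω h1 h2 h3 s
      have hI0 : 0 < I s ω := by
        have : 0 < K₂ * I s ω := (NNReal.rpow_pos (h3 s)).trans_le (h1 s).2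
        exact pos_of_mul_pos_right this hK₂.le
      have h5 := mul_rpow_le_of_order (p := ρ) hρ.le (h3 s) hK₂ (zero_lt_one.trans_le hC1)
        (h2 s) (h1 s).2
      rw [e1] at h5
      have h6 : (C / K₂) ^ ρ ≤ (1 / K₂) ^ ρ :=
        NNReal.rpow_le_rpow_of_nonpos (by positivity) (by gcongr) hρ.le
      have hCI : C * I s ω ≠ 0 := (mul_pos (zero_lt_one.trans_le hC1) hI0).ne'
      rw [← ENNReal.coe_mul, ← ENNReal.coe_rpow_of_ne_zero hCI]
      norm_cast
      calc U s ω * (C * I s ω) ^ ρ + ε * Λ s ω ^ θ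
          ≤ K * (1 / K₂) ^ ρ * Λ s ω ^ θ + 1 * Λ s ω ^ θ := by
            refine add_le_add (h5.trans ?_) (by gcongr)
            gcongr
        _ = C * Λ s ω ^ θ := by simp only [C]; ring)
    (hcint C hΛp hΛ.integrable) (hcint C hIp hIint)
  obtain ⟨X, hX, -, hXW⟩ := hWt.exists_cadlag h𝓕
    (Φ := fun s ω w => U s ω * w ^ ρ + ε * (Λ s ω ^ θ : ℝ≥0)) hW (hΦ W hW) hWint
  refine ⟨X, hX, lt_of_eq_of_lt (lintegral_congr_ae ?_) hWint⟩
  filter_upwards [hXW] with ω hω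
  refine lintegral_congr_ae ?_
  filter_upwards [hω] with s hs
  rw [hs]

/-- Existence of a càdlàg fixed point of `F_U`. -/
theorem exists_isCadlagTailExp_mul_rpow (h𝓕 : IsStochasticBasis 𝓕 P) {θ : ℝ}
    (hθ : θ ∈ Ioo (0 : ℝ) 1) {Λ U : ℝ≥0 → Ω → ℝ≥0} (hΛ : MemLHat 𝓕 P θ Λ)
    (hU : IsProgressive 𝓕 U) {K : ℝ≥0} (hUK : ∀ᵐ ω ∂P, ∀ t, U t ω ≤ K * Λ t ω) :
    ∃ X : ℝ≥0 → Ω → ℝ≥0,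
      IsCadlagTailExp 𝓕 P (fun s ω => U s ω * (X s ω : ℝ≥0∞) ^ ((θ - 1) / θ)) X ∧
      ∫⁻ ω, ∫⁻ s, U s ω * (X s ω : ℝ≥0∞) ^ ((θ - 1) / θ) ∂leb ∂P < ∞ := by
  have hρ : (θ - 1) / θ < 0 := div_neg_of_neg_of_pos (by linarith [hθ.2]) hθ.1
  set ρ := (θ - 1) / θ with hρdef
  let ε : ℕ → ℝ≥0 := fun n => 1 / ((n : ℝ≥0) + 1)
  have hε : ∀ n, 0 < ε n := fun n => by positivity
  have hεanti : Antitone ε := fun n n' h => by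
    simp only [ε]; gcongr
  have hε0 : Tendsto ε atTop (𝓝 0) := tendsto_one_div_add_atTop_nhds_zero_nat
  have hε1 : ∀ n, ε n ≤ 1 := fun n => by
    simp only [ε]; rw [div_le_one (by positivity)]; exact le_add_self
  choose X hX hXint using fun n =>
    exists_isCadlagTailExp_perturbed h𝓕 hθ hΛ hU hUK (hε n) (hε1 n)
  have hΛp : IsProgressive 𝓕 fun s ω => ((Λ s ω ^ θ : ℝ≥0) : ℝ≥0∞) := fun i =>
    ((hΛ.progressive i).pow_const θ).coe_nnreal_ennreal
  have hXp : ∀ n, IsProgressive 𝓕 fun t ω => (X n t ω : ℝ≥0∞) := fun n =>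
    (hX n).isProgressive.coe_nnreal
  have hYp : ∀ n, IsProgressive 𝓕 fun s ω =>
      (U s ω : ℝ≥0∞) * (X n s ω : ℝ≥0∞) ^ ρ + ε n * (Λ s ω ^ θ : ℝ≥0) := fun n =>
    (hU.mul_rpow (hXp n) ρ).add fun i => (hΛp i).const_mul _
  -- Comparison applies because a smaller `ε` and a larger `w` both make the perturbed driver
  -- smaller.
  have hanti : ∀ᵐ ω ∂P, ∀ t, Antitone fun n => (X n t ω : ℝ≥0∞) := by
    have h1 : ∀ n, ∀ᵐ ω ∂P, ∀ t, X (n + 1) t ω ≤ X n t ω := fun n =>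
      (hX (n + 1)).le_of_imp (hX n) (hYp _) (hYp _) (hXint _) (hXint _)
        (ae_of_all _ fun ω => ae_of_all _ fun s h => by
          refine add_le_add (mul_le_mul_right ?_ _) (mul_le_mul_left ?_ _)
          · exact ennreal_rpow_anti hρ.le (by exact_mod_cast h)
          · exact_mod_cast hεanti n.le_succ)
    filter_upwards [ae_all_iff.2 h1] with ω hω t
    exact antitone_nat_of_succ_le fun n => by exact_mod_cast hω n t
  let W : ℝ≥0 → Ω → ℝ≥0∞ := fun t ω => ⨅ n, (X n t ω : ℝ≥0∞)
  have hW : IsProgressive 𝓕 W := fun i => Measurable.iInf fun n => hXp n i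
  have hlim : ∀ᵐ ω ∂P, ∀ t, Tendsto (fun n => (X n t ω : ℝ≥0∞)) atTop (𝓝 (W t ω)) := by
    filter_upwards [hanti] with ω hω t using tendsto_atTop_iInf (hω t)
  have hX0 : ∀ t, ∫⁻ ω, (X 0 t ω : ℝ≥0∞) ∂P ≠ ∞ := fun t => by
    have := (hX 0).isTail t univ MeasurableSet.univ
    simp only [Measure.restrict_univ] at this
    rw [this]
    exact ((lintegral_mono fun ω => setLIntegral_le_lintegral _ _).trans_lt (hXint 0)).ne
  have htail : IsTail 𝓕 P (fun s ω => U s ω * W s ω ^ ρ) W := by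
    intro t A hA
    have h1 : Tendsto (fun n => ∫⁻ ω in A, (X n t ω : ℝ≥0∞) ∂P) atTop
        (𝓝 (∫⁻ ω in A, W t ω ∂P)) := by
      refine tendsto_lintegral_of_dominated_convergence (fun ω => (X 0 t ω : ℝ≥0∞))
        (fun n => (hXp n).adapted.measurable) (fun n => ?_)
        (ne_top_of_le_ne_top (hX0 t) (setLIntegral_le_lintegral _ _)) ?_
      · filter_upwards [ae_restrict_of_ae hanti] with ω hω using hω t (Nat.zero_le n)
      · filter_upwards [ae_restrict_of_ae hlim] with ω hω using hω t
    -- As `X n` decreases, `U (X n)^ρ` increases, so monotone convergence applies without a lower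
    -- bound on `W`, even where `W` vanishes. The solutions themselves are dominated by `X 0`.
    have h2 : Tendsto (fun n => ∫⁻ ω in A, ∫⁻ s in Ici t, U s ω * (X n s ω : ℝ≥0∞) ^ ρ ∂leb ∂P)
        atTop (𝓝 (∫⁻ ω in A, ∫⁻ s in Ici t, U s ω * W s ω ^ ρ ∂leb ∂P)) := by
      refine tendsto_setLIntegral_of_monotone (fun n => hU.mul_rpow (hXp n) ρ) ?_ ?_ A _
      · filter_upwards [hanti] with ω hω
        exact ae_of_all _ fun s n n' h =>
          mul_le_mul_right (ennreal_rpow_anti hρ.le (hω s h)) _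
      · filter_upwards [hlim] with ω hω
        exact ae_of_all _ fun s => ENNReal.Tendsto.const_mul
          ((ENNReal.continuous_rpow_const.tendsto _).comp (hω s)) (Or.inr ENNReal.coe_ne_top)
    have h3 : Tendsto (fun n => (ε n : ℝ≥0∞) *
        ∫⁻ ω in A, ∫⁻ s in Ici t, ((Λ s ω ^ θ : ℝ≥0) : ℝ≥0∞) ∂leb ∂P) atTop (𝓝 0) := by
      have hfin : ∫⁻ ω in A, ∫⁻ s in Ici t, ((Λ s ω ^ θ : ℝ≥0) : ℝ≥0∞) ∂leb ∂P ≠ ∞ :=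
        (((setLIntegral_le_lintegral _ _).trans
          (lintegral_mono fun ω => setLIntegral_le_lintegral _ _)).trans_lt hΛ.integrable).ne
      simpa using ENNReal.Tendsto.mul_const (ENNReal.tendsto_coe.2 hε0) (Or.inr hfin)
    have h4 : ∀ n, ∫⁻ ω in A, (X n t ω : ℝ≥0∞) ∂P =
        ∫⁻ ω in A, ∫⁻ s in Ici t, U s ω * (X n s ω : ℝ≥0∞) ^ ρ ∂leb ∂P + (ε n : ℝ≥0∞) *
          ∫⁻ ω in A, ∫⁻ s in Ici t, ((Λ s ω ^ θ : ℝ≥0) : ℝ≥0∞) ∂leb ∂P := fun n => by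
      rw [(hX n).isTail t A hA, ← lintegral_const_mul _
        (measurable_setLIntegral_of_isProgressive hΛp _), ← lintegral_add_left
        (measurable_setLIntegral_of_isProgressive (hU.mul_rpow (hXp n) ρ) _)]
      refine lintegral_congr fun ω => ?_
      rw [← lintegral_const_mul _ (hΛp.measurable_path ω),
        ← lintegral_add_left ((hU.mul_rpow (hXp n) ρ).measurable_path ω)]
    simp only [h4] at h1
    have h5 := h2.add h3
    rw [add_zero] at h5
    exact tendsto_nhds_unique h1 h5
  have hWint : ∫⁻ ω, ∫⁻ s, U s ω * W s ω ^ ρ ∂leb ∂P < ∞ := by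
    have h1 := htail 0 univ MeasurableSet.univ
    have e : Ici (0 : ℝ≥0) = univ := by ext; simp
    simp only [Measure.restrict_univ, e] at h1
    rw [← h1]
    exact (lintegral_mono fun ω => iInf_le (fun n => (X n 0 ω : ℝ≥0∞)) 0).trans_lt
      (hX0 0).lt_top
  obtain ⟨Z, hZ, -, hZW⟩ := htail.exists_cadlag h𝓕 (Φ := fun s ω w => U s ω * w ^ ρ) hW
    (hU.mul_rpow hW ρ) hWint
  refine ⟨Z, hZ, lt_of_eq_of_lt (lintegral_congr_ae ?_) hWint⟩
  filter_upwards [hZW] with ω hω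
  refine lintegral_congr_ae ?_
  filter_upwards [hω] with s hs
  rw [hs]

/-- Uniqueness of the càdlàg fixed point of `F_U`. -/
theorem IsCadlagTailExp.indistinguishable_of_mul_rpow {ρ : ℝ} (hρ : ρ ≤ 0)
    {U X X' : ℝ≥0 → Ω → ℝ≥0} (hU : IsProgressive 𝓕 U)
    (hX : IsCadlagTailExp 𝓕 P (fun s ω => U s ω * (X s ω : ℝ≥0∞) ^ ρ) X)
    (hX' : IsCadlagTailExp 𝓕 P (fun s ω => U s ω * (X' s ω : ℝ≥0∞) ^ ρ) X')
    (hint : ∫⁻ ω, ∫⁻ s, U s ω * (X s ω : ℝ≥0∞) ^ ρ ∂leb ∂P < ∞)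
    (hint' : ∫⁻ ω, ∫⁻ s, U s ω * (X' s ω : ℝ≥0∞) ^ ρ ∂leb ∂P < ∞) :
    Indistinguishable P X X' := by
  have key : ∀ {X X' : ℝ≥0 → Ω → ℝ≥0},
      IsCadlagTailExp 𝓕 P (fun s ω => U s ω * (X s ω : ℝ≥0∞) ^ ρ) X →
      IsCadlagTailExp 𝓕 P (fun s ω => U s ω * (X' s ω : ℝ≥0∞) ^ ρ) X' →
      (∫⁻ ω, ∫⁻ s, U s ω * (X s ω : ℝ≥0∞) ^ ρ ∂leb ∂P < ∞) →
      (∫⁻ ω, ∫⁻ s, U s ω * (X' s ω : ℝ≥0∞) ^ ρ ∂leb ∂P < ∞) →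
      ∀ᵐ ω ∂P, ∀ t, X t ω ≤ X' t ω := fun hX hX' h h' =>
    hX.le_of_imp hX' (hU.mul_rpow hX.isProgressive.coe_nnreal ρ)
      (hU.mul_rpow hX'.isProgressive.coe_nnreal ρ) h h'
      (ae_of_all _ fun ω => ae_of_all _ fun s hs =>
        mul_le_mul_right (ennreal_rpow_anti hρ (by exact_mod_cast hs)) _)
  filter_upwards [key hX hX' hint hint', key hX' hX hint' hint] with ω h1 h2 t
  exact le_antisymm (h1 t) (h2 t)

/-- Two fixed points of `F_U` are indistinguishable. -/
theorem IsFixedPointFU.indistinguishable {ρ : ℝ} (hρ : ρ < 0) {U : ℝ≥0 → Ω → ℝ≥0}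
    (hU : IsProgressive 𝓕 U) {W W' : ℝ≥0 → Ω → ℝ≥0∞}
    (h : IsFixedPointFU 𝓕 P ρ (fun t ω => (U t ω : ℝ≥0∞)) W)
    (h' : IsFixedPointFU 𝓕 P ρ (fun t ω => (U t ω : ℝ≥0∞)) W') : Indistinguishable P W W' := by
  -- `W` and its càdlàg version agree at all times almost surely, so the latter can be put inside
  -- the driver, and uniqueness reduces to finite càdlàg solutions.
  have key : ∀ {W : ℝ≥0 → Ω → ℝ≥0∞}, IsFixedPointFU 𝓕 P ρ (fun t ω => (U t ω : ℝ≥0∞)) W →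
      ∃ X : ℝ≥0 → Ω → ℝ≥0, IsCadlagTailExp 𝓕 P (fun s ω => U s ω * (X s ω : ℝ≥0∞) ^ ρ) X ∧
        (∫⁻ ω, ∫⁻ s, U s ω * (X s ω : ℝ≥0∞) ^ ρ ∂leb ∂P < ∞) ∧
        Indistinguishable P W fun t ω => (X t ω : ℝ≥0∞) := by
    rintro W ⟨⟨hW, hint⟩, X, hX, hWX⟩
    simp only [IsFU, hEZ_coe hρ] at hX hint
    refine ⟨X, (hX.isTail.congr ?_).isCadlagTailExp hX.adapted hX.cadlag,
      lt_of_eq_of_lt (lintegral_congr_ae ?_) hint, hWX⟩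
    · filter_upwards [hWX] with ω hω
      exact ae_of_all _ fun s => by rw [hω s]
    · filter_upwards [hWX] with ω hω
      exact lintegral_congr fun s => by rw [hω s]
  obtain ⟨X, hX, hi, hWX⟩ := key h
  obtain ⟨X', hX', hi', hWX'⟩ := key h'
  filter_upwards [hWX, hWX', hX.indistinguishable_of_mul_rpow hρ.le hU hX' hi hi']
    with ω h1 h2 h3 t
  rw [h1, h2, h3]

end FixedPoint

/-! ### Geometric Brownian motions in `L̂^θ_{++}` -/

lemma setLIntegral_Ici_exp_neg {κ : ℝ} (hκ : 0 < κ) (t : ℝ≥0) :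
    ∫⁻ s in Ici t, ENNReal.ofReal (Real.exp (-κ * (s - t))) ∂leb = ENNReal.ofReal (1 / κ) := by
  have h1 : Ici t = ((↑) : ℝ≥0 → ℝ) ⁻¹' Ici (t : ℝ) := by ext; simp
  have hexp : ∀ x : ℝ, Real.exp (-κ * (x - t)) = Real.exp (κ * t) * Real.exp (-κ * x) :=
    fun x => by rw [← Real.exp_add]; congr 1; ring
  have hint : IntegrableOn (fun x : ℝ => Real.exp (-κ * (x - t))) (Ioi (t : ℝ)) := by
    simp only [hexp]
    exact (integrableOn_exp_mul_Ioi (neg_lt_zero.2 hκ) _).const_mul _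
  rw [h1, setLIntegral_leb measurableSet_Ici fun x => ENNReal.ofReal (Real.exp (-κ * (x - t))),
    inter_eq_self_of_subset_right (Ici_subset_Ici.2 t.coe_nonneg),
    setLIntegral_congr Ioi_ae_eq_Ici.symm, ← ofReal_integral_eq_lintegral_ofReal hint
    (Eventually.of_forall fun x => (Real.exp_pos _).le)]
  congr 1
  simp only [hexp]
  rw [integral_const_mul, integral_exp_mul_Ioi (neg_lt_zero.2 hκ), neg_div_neg_eq, ← mul_div_assoc,
    ← Real.exp_add]
  simp

section Brownian

variable {Ω : Type*} {m : MeasurableSpace Ω} {𝓕 : Filtration ℝ≥0 m} {P : Measure Ω}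
  {B : ℝ≥0 → Ω → ℝ}

/-- The paths of `B`, replaced by `0` where they are not continuous. -/
def contVersion (B : ℝ≥0 → Ω → ℝ) (t : ℝ≥0) : Ω → ℝ :=
  {ω | Continuous fun s => B s ω}.indicator (B t)

lemma continuous_contVersion (B : ℝ≥0 → Ω → ℝ) (ω : Ω) :
    Continuous fun t => contVersion B t ω := by
  by_cases h : ω ∈ {ω | Continuous fun s => B s ω}
  · simp only [contVersion, indicator_of_mem h]
    exact h
  · simpa only [contVersion, indicator_of_notMem h] using continuous_const

lemma IsFBrownian.ae_contVersion_eq (hB : IsFBrownian 𝓕 P B) :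
    ∀ᵐ ω ∂P, ∀ t, contVersion B t ω = B t ω := by
  filter_upwards [hB.cont] with ω hω t
  exact indicator_of_mem (s := {ω | Continuous fun s => B s ω}) hω _

lemma IsFBrownian.adapted_contVersion (h𝓕 : IsStochasticBasis 𝓕 P) (hB : IsFBrownian 𝓕 P B) :
    Adapted 𝓕 (contVersion B) := fun t =>
  (hB.adapted t).indicator (h𝓕.measurableSet_of_ae hB.cont t)

lemma IsFBrownian.isProgressive_comp (h𝓕 : IsStochasticBasis 𝓕 P) (hB : IsFBrownian 𝓕 P B)
    {E : Type*} [MeasurableSpace E] {f : ℝ≥0 × ℝ → E} (hf : Measurable f) :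
    IsProgressive 𝓕 fun t ω => f (t, contVersion B t ω) :=
  (isProgressive_of_rightCont (hB.adapted_contVersion h𝓕) fun ω _ =>
    (continuous_contVersion B ω).continuousWithinAt).map hf

variable [IsProbabilityMeasure P]

/-- Factor out the increment from `t` to `s`: it is independent of `𝓕 t`, and the Gaussian moment
generating function supplies the deterministic factor. -/
lemma IsFBrownian.setLIntegral_exp (hB : IsFBrownian 𝓕 P B) (a c : ℝ) {t s : ℝ≥0} (hts : t ≤ s)
    {A : Set Ω} (hA : MeasurableSet[𝓕 t] A) :
    ∫⁻ ω in A, ENNReal.ofReal (Real.exp (a * B s ω + c * s)) ∂P =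
      ENNReal.ofReal (Real.exp ((c + a ^ 2 / 2) * (s - t))) *
        ∫⁻ ω in A, ENNReal.ofReal (Real.exp (a * B t ω + c * t)) ∂P := by
  have hA0 := 𝓕.le t _ hA
  let f : Ω → ℝ≥0∞ := A.indicator fun ω => ENNReal.ofReal (Real.exp (a * B t ω + c * t))
  let g : Ω → ℝ≥0∞ := fun ω => ENNReal.ofReal (Real.exp (c * (s - t) + a * (B s ω - B t ω)))
  have hf : Measurable[𝓕 t] f :=
    Measurable.indicator (((hB.adapted t).const_mul a).add_const _ |>.exp.ennreal_ofReal) hA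
  have hBm : ∀ t, Measurable (B t) := fun t => (hB.adapted t).mono (𝓕.le t) le_rfl
  have hg : Measurable[MeasurableSpace.comap (fun ω => B s ω - B t ω) inferInstance] g :=
    (((comap_measurable _).const_mul a).const_add _).exp.ennreal_ofReal
  have h1 : ∫⁻ ω in A, ENNReal.ofReal (Real.exp (a * B s ω + c * s)) ∂P =
      ∫⁻ ω, f ω * g ω ∂P := by
    rw [← lintegral_indicator hA0]
    refine lintegral_congr fun ω => ?_
    by_cases hω : ω ∈ A
    · simp only [f, g, indicator_of_mem hω]
      rw [← ENNReal.ofReal_mul (Real.exp_pos _).le, ← Real.exp_add]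
      congr 2
      ring
    · simp [f, indicator_of_notMem hω]
  have h2 : ∫⁻ ω, g ω ∂P = ENNReal.ofReal (Real.exp ((c + a ^ 2 / 2) * (s - t))) := by
    have hlaw := (hB.hasLaw_sub s t).map_eq
    have h3 := mgf_gaussianReal hlaw a
    -- The `mgf` of a non-integrable exponential is `0` by convention, so its positivity yields
    -- integrability.
    have hpos : 0 < mgf (B s - B t) P a := by rw [h3]; exact Real.exp_pos _
    have hi : Integrable (fun ω => Real.exp (a * (B s - B t) ω)) P := mgf_pos_iff.1 hpos
    have hd : ((nndist s.1 t.1 : ℝ≥0) : ℝ) = s - t := by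
      rw [coe_nndist, Real.dist_eq]
      exact abs_of_nonneg (sub_nonneg.2 hts)
    simp only [g, Real.exp_add]
    simp only [ENNReal.ofReal_mul (Real.exp_pos _).le]
    rw [lintegral_const_mul' _ _ ENNReal.ofReal_ne_top]
    have h4 : ∫⁻ ω, ENNReal.ofReal (Real.exp (a * (B s ω - B t ω))) ∂P =
        ENNReal.ofReal (mgf (B s - B t) P a) :=
      (ofReal_integral_eq_lintegral_ofReal hi
        (Eventually.of_forall fun x => (Real.exp_pos _).le)).symm
    rw [h4, h3, hd, ← ENNReal.ofReal_mul (Real.exp_pos _).le, ← Real.exp_add]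
    congr 2
    ring
  rw [h1, lintegral_mul_eq_lintegral_mul_lintegral_of_independent_measurableSpace (𝓕.le t)
    ((hBm s).sub (hBm t)).comap_le (hB.indep t s hts) hf hg, h2, mul_comm]
  simp only [f]
  rw [lintegral_indicator hA0]

/-- The tail expectation of a geometric Brownian motion. -/
lemma IsFBrownian.isTail_exp (h𝓕 : IsStochasticBasis 𝓕 P) (hB : IsFBrownian 𝓕 P B) {a c : ℝ}
    (hκ : c + a ^ 2 / 2 < 0) :
    IsTail 𝓕 P (fun s ω => ENNReal.ofReal (Real.exp (a * contVersion B s ω + c * s)))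
      fun t ω => ENNReal.ofReal (1 / -(c + a ^ 2 / 2)) *
        ENNReal.ofReal (Real.exp (a * contVersion B t ω + c * t)) := by
  intro t A hA
  have hp : IsProgressive 𝓕 fun s ω =>
      ENNReal.ofReal (Real.exp (a * contVersion B s ω + c * s)) :=
    hB.isProgressive_comp h𝓕 (f := fun p => ENNReal.ofReal (Real.exp (a * p.2 + c * p.1)))
      (by fun_prop)
  have hae : ∀ s, ∫⁻ ω in A, ENNReal.ofReal (Real.exp (a * contVersion B s ω + c * s)) ∂P =
      ∫⁻ ω in A, ENNReal.ofReal (Real.exp (a * B s ω + c * s)) ∂P := fun s => by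
    refine lintegral_congr_ae (ae_restrict_of_ae ?_)
    filter_upwards [hB.ae_contVersion_eq] with ω hω
    rw [hω s]
  rw [integral_comm_of_isProgressive hp, lintegral_const_mul' _ _ ENNReal.ofReal_ne_top,
    ← setLIntegral_Ici_exp_neg (neg_pos.2 hκ) t, ← lintegral_mul_const _ (by fun_prop)]
  refine setLIntegral_congr_fun measurableSet_Ici fun s hs => ?_
  simp only [hae, neg_neg]
  exact (hB.setLIntegral_exp a c hs hA).symm

lemma IsFBrownian.lintegral_exp_lt_top (h𝓕 : IsStochasticBasis 𝓕 P) (hB : IsFBrownian 𝓕 P B)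
    {a c : ℝ} (hκ : c + a ^ 2 / 2 < 0) :
    ∫⁻ ω, ∫⁻ s, ENNReal.ofReal (Real.exp (a * contVersion B s ω + c * s)) ∂leb ∂P < ∞ := by
  have h1 := hB.isTail_exp h𝓕 hκ 0 univ MeasurableSet.univ
  have e : Ici (0 : ℝ≥0) = univ := by ext; simp
  simp only [Measure.restrict_univ, e] at h1
  rw [← h1, lintegral_const_mul' _ _ ENNReal.ofReal_ne_top]
  refine ENNReal.mul_lt_top ENNReal.ofReal_lt_top (lt_of_eq_of_lt (lintegral_congr_ae ?_)
    (b := ∫⁻ ω, 1 ∂P) (by simp))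
  filter_upwards [hB.ae_contVersion_eq, hB.eval_zero_ae_eq_zero] with ω h2 h3
  simp [h2, h3]

/-- Geometric Brownian motions with `E ∫ Λ^θ < ∞` belong to `L̂^θ_{++}`. -/
theorem IsFBrownian.memLHat (h𝓕 : IsStochasticBasis 𝓕 P) (hB : IsFBrownian 𝓕 P B)
    {θ M α γ : ℝ} (hM : 0 < M) (hκ : θ * γ + (θ * α) ^ 2 / 2 < 0) :
    MemLHat 𝓕 P θ fun t ω => (M * Real.exp (α * contVersion B t ω + γ * t)).toNNReal := by
  set κ := -(θ * γ + (θ * α) ^ 2 / 2) with hκdef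
  have hκ0 : 0 < κ := neg_pos.2 hκ
  have hpow : ∀ (t : ℝ≥0) (ω : Ω),
      (M * Real.exp (α * contVersion B t ω + γ * t)).toNNReal ^ θ =
        (M ^ θ).toNNReal *
          (Real.exp (θ * α * contVersion B t ω + θ * γ * t)).toNNReal := by
    intro t ω
    rw [← Real.toNNReal_mul (by positivity), ← Real.toNNReal_rpow_of_nonneg (by positivity),
      Real.mul_rpow hM.le (Real.exp_pos _).le, ← Real.exp_mul]
    congr 3
    ring
  have hpow' : (fun (t : ℝ≥0) (ω : Ω) =>
      (((M * Real.exp (α * contVersion B t ω + γ * t)).toNNReal ^ θ : ℝ≥0) : ℝ≥0∞)) =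
      fun t ω => ENNReal.ofReal (M ^ θ) *
        ENNReal.ofReal (Real.exp (θ * α * contVersion B t ω + θ * γ * t)) := by
    ext t ω
    rw [hpow, ENNReal.coe_mul]
    rfl
  have hp : IsProgressive 𝓕 fun s ω =>
      ENNReal.ofReal (Real.exp (θ * α * contVersion B s ω + θ * γ * s)) :=
    hB.isProgressive_comp h𝓕
      (f := fun p => ENNReal.ofReal (Real.exp (θ * α * p.2 + θ * γ * p.1))) (by fun_prop)
  have hc : ∀ ω, Continuous fun t : ℝ≥0 => (1 / κ).toNNReal *
      ((M ^ θ).toNNReal * (Real.exp (θ * α * contVersion B t ω + θ * γ * t)).toNNReal) :=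
      fun ω => by
    have := continuous_contVersion B ω
    fun_prop
  -- The tail expectation of `Λ^θ` is `Λ^θ / κ`, because its conditional mean decays at the rate
  -- `κ`. Hence `κ` serves as both order constants.
  refine ⟨⟨?_, ae_of_all _ fun ω t => by positivity, ?_⟩, fun t ω => (1 / κ).toNNReal *
    ((M ^ θ).toNNReal * (Real.exp (θ * α * contVersion B t ω + θ * γ * t)).toNNReal), ?_, ?_⟩
  · exact hB.isProgressive_comp h𝓕 (f := fun p => (M * Real.exp (α * p.2 + γ * p.1)).toNNReal)
      (by fun_prop)
  · have h1 := congrFun₂ hpow'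
    simp only [h1]
    have h2 := hB.lintegral_exp_lt_top h𝓕 hκ
    simp only [lintegral_const_mul' _ _ ENNReal.ofReal_ne_top]
    exact ENNReal.mul_lt_top ENNReal.ofReal_lt_top h2
  · rw [hpow']
    refine IsTail.isCadlagTailExp ?_ ?_ fun ω t => ⟨(hc ω).continuousWithinAt, _,
      (hc ω).tendsto t |>.mono_left inf_le_left⟩
    · have h1 := hB.isTail_exp h𝓕 hκ
      have h2 := h1.const_mul (fun t => ((hp.adapted t).const_mul _)) hp
        (ENNReal.ofReal (M ^ θ))
      convert h2 using 3 with t ω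
      rw [ENNReal.coe_mul, ENNReal.coe_mul, mul_left_comm]
      rfl
    · exact (hB.isProgressive_comp h𝓕 (f := fun p => (1 / κ).toNNReal *
        ((M ^ θ).toNNReal * (Real.exp (θ * α * p.2 + θ * γ * p.1)).toNNReal))
        (by fun_prop)).adapted
  · have hκ' : (0 : ℝ≥0) < κ.toNNReal := Real.toNNReal_pos.2 hκ0
    have e : ∀ x : ℝ≥0, κ.toNNReal * ((1 / κ).toNNReal * x) = x := fun x => by
      rw [← mul_assoc, ← Real.toNNReal_mul hκ0.le, mul_one_div_cancel hκ0.ne', Real.toNNReal_one,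
        one_mul]
    exact ⟨κ.toNNReal, κ.toNNReal, hκ', hκ', ae_of_all _ fun ω t => by simp only [e, hpow, le_refl,
      and_self]⟩

end Brownian

/-! ### Epstein--Zin utility processes as fixed points -/

lemma abs_coe_ennreal (x : ℝ≥0∞) : (x : EReal).abs = x := by
  induction x with
  | top => rfl
  | coe r =>
    change ENNReal.ofReal |(r : ℝ)| = r
    rw [abs_of_nonneg r.coe_nonneg]
    exact ENNReal.ofReal_coe_nnreal

section Utility

/-- The coefficient process `U = θ b e^{-δ t} C^{1-S}`. -/
def coeffEZ {Ω : Type*} (θ b δ S : ℝ) (C : ℝ≥0 → Ω → ℝ≥0) (t : ℝ≥0) (ω : Ω) : ℝ≥0 :=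
  (θ * b * Real.exp (-δ * t)).toNNReal * ((C t ω : ℝ≥0∞) ^ (1 - S)).toNNReal

variable {Ω : Type*} {m : MeasurableSpace Ω} {𝓕 : Filtration ℝ≥0 m} {P : Measure Ω}
  {θ b δ R S : ℝ} {C : ℝ≥0 → Ω → ℝ≥0}

lemma isProgressive_coeffEZ (hC : IsProgressive 𝓕 C) : IsProgressive 𝓕 (coeffEZ θ b δ S C) :=
  hC.map (f := fun p : ℝ≥0 × ℝ≥0 => (θ * b * Real.exp (-δ * p.1)).toNNReal *
    ((p.2 : ℝ≥0∞) ^ (1 - S)).toNNReal) (by fun_prop)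

/-- Since `θ = (1-R)/(1-S)`, the prefactor `b / (1-S)` equals `θ b / (1-R)`. Finiteness of `C^{1-S}`
matters because `coeffEZ` passes through `toNNReal`, which would send `∞` to `0`. -/
lemma gEZ_eq (hR : R ≠ 1) (hb : 0 < b) (hθ : 0 < θ) (hRS : (1 - R) / (1 - S) = θ) {t : ℝ≥0} {ω : Ω}
    (hCt : (C t ω : ℝ≥0∞) ^ (1 - S) ≠ ∞) (v : ℝ) :
    gEZ b δ R S t (C t ω) v = ((1 - R)⁻¹ : ℝ) *
      ((coeffEZ θ b δ S C t ω * ENNReal.ofReal ((1 - R) * v) ^ ((S - R) / (1 - R)) : ℝ≥0∞) :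
        EReal) := by
  have hR' : 1 - R ≠ 0 := sub_ne_zero.2 hR.symm
  have h0 : 0 ≤ θ * b * Real.exp (-δ * t) := by positivity
  have h1 : b * Real.exp (-δ * t) / (1 - S) = (1 - R)⁻¹ * (θ * b * Real.exp (-δ * t)) := by
    rw [← hRS]; field_simp
  have h2 : (coeffEZ θ b δ S C t ω : ℝ≥0∞) =
      ENNReal.ofReal (θ * b * Real.exp (-δ * t)) * (C t ω : ℝ≥0∞) ^ (1 - S) := by
    rw [coeffEZ, ENNReal.coe_mul, ENNReal.coe_toNNReal hCt]
    rfl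
  rw [gEZ, h1, h2, mul_assoc (ENNReal.ofReal _), EReal.coe_ennreal_mul (ENNReal.ofReal _),
    EReal.coe_ennreal_ofReal, max_eq_left h0, EReal.coe_mul, mul_assoc]

lemma abs_gEZ (hR : R ≠ 1) (hb : 0 < b) (hθ : 0 < θ) (hRS : (1 - R) / (1 - S) = θ) {t : ℝ≥0} {ω : Ω}
    (hCt : (C t ω : ℝ≥0∞) ^ (1 - S) ≠ ∞) (v : ℝ) :
    (gEZ b δ R S t (C t ω) v).abs = ENNReal.ofReal |(1 - R)⁻¹| *
      (coeffEZ θ b δ S C t ω * ENNReal.ofReal ((1 - R) * v) ^ ((S - R) / (1 - R))) := by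
  rw [gEZ_eq hR hb hθ hRS hCt, EReal.abs_mul, EReal.abs_def, abs_coe_ennreal]

lemma toReal_gEZ (hR : R ≠ 1) (hb : 0 < b) (hθ : 0 < θ) (hRS : (1 - R) / (1 - S) = θ) {t : ℝ≥0}
    {ω : Ω} (hCt : (C t ω : ℝ≥0∞) ^ (1 - S) ≠ ∞) (v : ℝ) :
    (gEZ b δ R S t (C t ω) v).toReal = (1 - R)⁻¹ *
      (coeffEZ θ b δ S C t ω * ENNReal.ofReal ((1 - R) * v) ^ ((S - R) / (1 - R))).toReal := by
  rw [gEZ_eq hR hb hθ hRS hCt, EReal.toReal_mul, EReal.toReal_coe, EReal.toReal_coe_ennreal]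

lemma lintegral_abs_gEZ (hR : R ≠ 1) (hb : 0 < b) (hθ : 0 < θ) (hRS : (1 - R) / (1 - S) = θ)
    (hC : ∀ᵐ ω ∂P, ∀ t, (C t ω : ℝ≥0∞) ^ (1 - S) ≠ ∞) (V : ℝ≥0 → Ω → ℝ) :
    ∫⁻ ω, ∫⁻ s, (gEZ b δ R S s (C s ω) (V s ω)).abs ∂leb ∂P = ENNReal.ofReal |(1 - R)⁻¹| *
      ∫⁻ ω, ∫⁻ s, coeffEZ θ b δ S C s ω *
        ENNReal.ofReal ((1 - R) * V s ω) ^ ((S - R) / (1 - R)) ∂leb ∂P := by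
  rw [← lintegral_const_mul' _ _ ENNReal.ofReal_ne_top]
  refine lintegral_congr_ae ?_
  filter_upwards [hC] with ω hω
  rw [← lintegral_const_mul' _ _ ENNReal.ofReal_ne_top]
  exact lintegral_congr fun s => abs_gEZ hR hb hθ hRS (hω s) _

lemma _root_.MeasureTheory.IsProgressive.coeffEZ_mul_rpow (hC : IsProgressive 𝓕 C)
    {V : ℝ≥0 → Ω → ℝ} (hV : IsProgressive 𝓕 V) (ρ : ℝ) :
    IsProgressive 𝓕 fun s ω =>
      (coeffEZ θ b δ S C s ω : ℝ≥0∞) * ENNReal.ofReal ((1 - R) * V s ω) ^ ρ :=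
  (isProgressive_coeffEZ hC).mul_rpow (W := fun s ω => ENNReal.ofReal ((1 - R) * V s ω))
    (fun i => ((hV i).const_mul _).ennreal_ofReal) _

/-- The Bochner conditional tail expectation of `g_EZ` in terms of the transformed aggregator. -/
lemma condExp_integral_gEZ (hR : R ≠ 1) (hb : 0 < b) (hθ : 0 < θ) (hRS : (1 - R) / (1 - S) = θ)
    (hC : IsProgressive 𝓕 C) (hCt : ∀ᵐ ω ∂P, ∀ t, (C t ω : ℝ≥0∞) ^ (1 - S) ≠ ∞)
    {V : ℝ≥0 → Ω → ℝ} (hV : IsProgressive 𝓕 V)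
    (hint : ∫⁻ ω, ∫⁻ s, coeffEZ θ b δ S C s ω *
        ENNReal.ofReal ((1 - R) * V s ω) ^ ((S - R) / (1 - R)) ∂leb ∂P < ∞) (t : ℝ≥0) :
    P[fun ω => ∫ s in Ici t, (gEZ b δ R S s (C s ω) (V s ω)).toReal ∂leb | 𝓕 t] =ᵐ[P] fun ω =>
      (1 - R)⁻¹ * (condLExp (𝓕 t) P (fun ω => ∫⁻ s in Ici t, coeffEZ θ b δ S C s ω *
        ENNReal.ofReal ((1 - R) * V s ω) ^ ((S - R) / (1 - R)) ∂leb) ω).toReal := by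
  have hp := hC.coeffEZ_mul_rpow (θ := θ) (b := b) (δ := δ) (R := R) (S := S) hV ((S - R) / (1 - R))
  have hI : Measurable fun ω => ∫⁻ s, coeffEZ θ b δ S C s ω *
      ENNReal.ofReal ((1 - R) * V s ω) ^ ((S - R) / (1 - R)) ∂leb :=
    Measurable.lintegral_prod_left' (measurable_uncurry_of_isProgressive hp)
  have hfin : ∫⁻ ω, ∫⁻ s in Ici t, coeffEZ θ b δ S C s ω *
        ENNReal.ofReal ((1 - R) * V s ω) ^ ((S - R) / (1 - R)) ∂leb ∂P ≠ ∞ :=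
    ((lintegral_mono fun ω => setLIntegral_le_lintegral _ _).trans_lt hint).ne
  have h1 : (fun ω => ∫ s in Ici t, (gEZ b δ R S s (C s ω) (V s ω)).toReal ∂leb) =ᵐ[P]
      (1 - R)⁻¹ • fun ω => (∫⁻ s in Ici t, coeffEZ θ b δ S C s ω *
        ENNReal.ofReal ((1 - R) * V s ω) ^ ((S - R) / (1 - R)) ∂leb).toReal := by
    filter_upwards [hCt, ae_lt_top hI hint.ne] with ω h2 h3
    simp only [toReal_gEZ hR hb hθ hRS (h2 _), Pi.smul_apply, smul_eq_mul]
    rw [integral_const_mul, integral_toReal (hp.measurable_path ω).aemeasurable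
      (ae_restrict_of_ae (ae_lt_top (hp.measurable_path ω) h3.ne))]
  refine (condExp_congr_ae h1).trans ((condExp_smul _ _ _).trans ?_)
  filter_upwards [toReal_condLExp (𝓕 t)
    (measurable_setLIntegral_of_isProgressive hp (Ici t)).aemeasurable hfin] with ω h2
  rw [Pi.smul_apply, smul_eq_mul, h2]

/-- A solution of the fixed point equation yields an Epstein--Zin utility process. -/
lemma IsCadlagTailExp.isUtilityProcess (hR : R ≠ 1)
    (hb : 0 < b) (hθ : 0 < θ) (hRS : (1 - R) / (1 - S) = θ) (hC : IsProgressive 𝓕 C)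
    (hCt : ∀ᵐ ω ∂P, ∀ t, (C t ω : ℝ≥0∞) ^ (1 - S) ≠ ∞) {X : ℝ≥0 → Ω → ℝ≥0}
    (hX : IsCadlagTailExp 𝓕 P (fun s ω => coeffEZ θ b δ S C s ω *
        (X s ω : ℝ≥0∞) ^ ((S - R) / (1 - R))) X)
    (hint : ∫⁻ ω, ∫⁻ s, coeffEZ θ b δ S C s ω *
      (X s ω : ℝ≥0∞) ^ ((S - R) / (1 - R)) ∂leb ∂P < ∞) :
    IsUtilityProcess 𝓕 P (domEZ R) (gEZ b δ R S) C fun t ω => (1 - R)⁻¹ * X t ω := by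
  have hR' : 1 - R ≠ 0 := sub_ne_zero.2 hR.symm
  have hVp : IsProgressive 𝓕 fun t ω => (1 - R)⁻¹ * (X t ω : ℝ) := fun i =>
    (hX.isProgressive i).coe_nnreal_real.const_mul _
  have e : ∀ s ω, ENNReal.ofReal ((1 - R) * ((1 - R)⁻¹ * (X s ω : ℝ))) = X s ω := fun s ω => by
    rw [mul_inv_cancel_left₀ hR', ENNReal.ofReal_coe_nnreal]
  have hc : Continuous fun x : ℝ≥0 => (1 - R)⁻¹ * (x : ℝ) := by fun_prop
  refine ⟨hVp, ae_of_all _ fun ω t => ?_, ?_, ae_of_all _ fun ω t => ?_, fun t => ?_⟩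
  · change 0 ≤ (1 - R) * ((1 - R)⁻¹ * (X t ω : ℝ))
    rw [mul_inv_cancel_left₀ hR']
    exact (X t ω).2
  · rw [lintegral_abs_gEZ hR hb hθ hRS hCt]
    simp only [e]
    exact ENNReal.mul_lt_top ENNReal.ofReal_lt_top hint
  · obtain ⟨h1, l, h2⟩ := hX.cadlag ω t
    exact ⟨hc.continuousAt.comp_continuousWithinAt h1, _, (hc.tendsto _).comp h2⟩
  · have h1 := condExp_integral_gEZ hR hb hθ hRS hC hCt (δ := δ) hVp
      (by simpa only [e] using hint) t
    simp only [e] at h1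
    filter_upwards [h1, hX.version t] with ω h1 h2
    rw [h1, ← h2]
    rfl

variable [IsProbabilityMeasure P]

/-- If `V` is an Epstein--Zin utility process, then `(1 - R) V` solves the fixed point equation. -/
lemma IsUtilityProcess.exists_isCadlagTailExp (h𝓕 : IsStochasticBasis 𝓕 P) (hR : R ≠ 1)
    (hb : 0 < b) (hθ : 0 < θ) (hRS : (1 - R) / (1 - S) = θ) (hC : IsProgressive 𝓕 C)
    (hCt : ∀ᵐ ω ∂P, ∀ t, (C t ω : ℝ≥0∞) ^ (1 - S) ≠ ∞) {V : ℝ≥0 → Ω → ℝ}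
    (h : IsUtilityProcess 𝓕 P (domEZ R) (gEZ b δ R S) C V) :
    ∃ X : ℝ≥0 → Ω → ℝ≥0, IsCadlagTailExp 𝓕 P (fun s ω => coeffEZ θ b δ S C s ω *
        (X s ω : ℝ≥0∞) ^ ((S - R) / (1 - R))) X ∧
      (∫⁻ ω, ∫⁻ s, coeffEZ θ b δ S C s ω * (X s ω : ℝ≥0∞) ^ ((S - R) / (1 - R)) ∂leb ∂P < ∞) ∧
      ∀ᵐ ω ∂P, ∀ t, (1 - R) * V t ω = X t ω := by
  have hR' : 1 - R ≠ 0 := sub_ne_zero.2 hR.symm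
  have hint := h.integrable
  rw [lintegral_abs_gEZ hR hb hθ hRS hCt] at hint
  have hint := ENNReal.lt_top_of_mul_ne_top_right hint.ne (by simpa using hR')
  let G : Set Ω := {ω | IsCadlag fun t => V t ω}
  have hG : ∀ᵐ ω ∂P, ω ∈ G := h.cadlag
  -- Utility processes have càdlàg paths only almost surely; the exceptional paths are set to `0`,
  -- which preserves adaptedness because the filtration is complete.
  let X : ℝ≥0 → Ω → ℝ≥0 := fun t => G.indicator fun ω => ((1 - R) * V t ω).toNNReal
  have hXV : ∀ᵐ ω ∂P, ∀ t, X t ω = ((1 - R) * V t ω).toNNReal := by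
    filter_upwards [hG] with ω hω t using indicator_of_mem hω _
  have hXa : Adapted 𝓕 X := fun t =>
    ((h.progressive.adapted t).const_mul _).real_toNNReal.indicator (h𝓕.measurableSet_of_ae hG t)
  have hXc : ∀ ω, IsCadlag fun t => X t ω := fun ω => by
    by_cases hω : ω ∈ G
    · simp only [X, indicator_of_mem hω]
      have hc : Continuous fun v : ℝ => ((1 - R) * v).toNNReal := by fun_prop
      intro t
      obtain ⟨h1, l, h2⟩ := (show IsCadlag fun t => V t ω from hω) t
      exact ⟨hc.continuousAt.comp_continuousWithinAt h1, _, (hc.tendsto _).comp h2⟩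
    · simp only [X, indicator_of_notMem hω]
      exact isCadlag_const _
  have hYY : ∀ᵐ ω ∂P, ∀ s, (coeffEZ θ b δ S C s ω : ℝ≥0∞) *
      ENNReal.ofReal ((1 - R) * V s ω) ^ ((S - R) / (1 - R)) =
      coeffEZ θ b δ S C s ω * (X s ω : ℝ≥0∞) ^ ((S - R) / (1 - R)) := by
    filter_upwards [hXV] with ω hω s
    rw [hω s]
    rfl
  have hX : IsCadlagTailExp 𝓕 P (fun s ω => (coeffEZ θ b δ S C s ω : ℝ≥0∞) *
      ENNReal.ofReal ((1 - R) * V s ω) ^ ((S - R) / (1 - R))) X := by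
    refine ⟨hXa, hXc, fun t => ?_⟩
    have hfin : ∫⁻ ω, ∫⁻ s in Ici t, coeffEZ θ b δ S C s ω *
        ENNReal.ofReal ((1 - R) * V s ω) ^ ((S - R) / (1 - R)) ∂leb ∂P ≠ ∞ :=
      ((lintegral_mono fun ω => setLIntegral_le_lintegral _ _).trans_lt hint).ne
    filter_upwards [hXV, h.eq t, condExp_integral_gEZ hR hb hθ hRS hC hCt h.progressive hint t,
      condLExp_ne_top (mΩ := 𝓕 t) hfin] with ω h1 h2 h3 h4
    rw [h1, h2, h3, mul_inv_cancel_left₀ hR']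
    exact ENNReal.ofReal_toReal h4
  refine ⟨X, (hX.isTail.congr (hYY.mono fun ω hω => ae_of_all _ hω)).isCadlagTailExp hXa hXc,
    lt_of_eq_of_lt (lintegral_congr_ae ?_) hint, ?_⟩
  · filter_upwards [hYY] with ω hω using lintegral_congr fun s => (hω s).symm
  · filter_upwards [hXV, h.mem] with ω h1 h2 t
    rw [h1, Real.coe_toNNReal _ (h2 t)]

end Utility

section Main

variable {Ω : Type*} {m : MeasurableSpace Ω} {𝓕 : Filtration ℝ≥0 m} {P : Measure Ω}
  [IsProbabilityMeasure P]

/-- `F_U` has a unique fixed point when `U` is dominated by some `Λ ∈ L̂^θ_{++}`. -/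
theorem exists_unique_isFixedPointFU (h𝓕 : IsStochasticBasis 𝓕 P) {θ : ℝ}
    (hθ : θ ∈ Ioo (0 : ℝ) 1) {Λ U : ℝ≥0 → Ω → ℝ≥0} (hΛ : MemLHat 𝓕 P θ Λ)
    (hU : IsProgressive 𝓕 U) {K : ℝ≥0} (hUK : ∀ᵐ ω ∂P, ∀ t, U t ω ≤ K * Λ t ω) :
    ∃ W : ℝ≥0 → Ω → ℝ≥0∞,
      IsFixedPointFU 𝓕 P ((θ - 1) / θ) (fun t ω => (U t ω : ℝ≥0∞)) W ∧
      ∀ W' : ℝ≥0 → Ω → ℝ≥0∞,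
        IsFixedPointFU 𝓕 P ((θ - 1) / θ) (fun t ω => (U t ω : ℝ≥0∞)) W' →
        Indistinguishable P W' W := by
  have hρ : (θ - 1) / θ < 0 := div_neg_of_neg_of_pos (by linarith [hθ.2]) hθ.1
  obtain ⟨X, hX, hint⟩ := exists_isCadlagTailExp_mul_rpow h𝓕 hθ hΛ hU hUK
  have h := isFixedPointFU_coe hρ hX hint
  exact ⟨_, h, fun W' hW' => hW'.indistinguishable hρ hU h⟩

/-- The geometric Brownian motion `θ b e^{-δ t} Ĉ^{1-S}` belongs to `L̂^θ_{++}`. -/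
lemma exists_memLHat_candidateC (h𝓕 : IsStochasticBasis 𝓕 P) {θ b δ R S r μ σ x : ℝ}
    (hθ : 0 < θ) (hb : 0 < b) (hR : 0 < R) (hS : 0 < S) (hS1 : S ≠ 1)
    (hRS : (1 - R) / (1 - S) = θ) (hσ : 0 < σ) (hx : 0 < x) (hη : 0 < etaEZ δ R S r μ σ)
    {B : ℝ≥0 → Ω → ℝ} (hB : IsFBrownian 𝓕 P B) :
    ∃ Λ : ℝ≥0 → Ω → ℝ≥0, MemLHat 𝓕 P θ Λ ∧ ∀ᵐ ω ∂P, ∀ t, (Λ t ω : ℝ) =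
      θ * b * Real.exp (-δ * t) * candidateC δ R S r μ σ x B t ω ^ (1 - S) := by
  set η := etaEZ δ R S r μ σ with hηdef
  set q := (μ - r) / σ with hq
  have hS1' : 1 - S ≠ 0 := sub_ne_zero.2 hS1.symm
  have hR1 : 1 - R = θ * (1 - S) := by rw [← hRS]; field_simp
  -- The exponential growth rate of `E[Λ^θ]` is `-θη`: with `θ(1-S) = 1-R` the Itô correction
  -- combines with the drift to the term `q² / (2R)` in `η`. This is where `η > 0` gives
  -- integrability.
  have hκ : θ * (-δ + (1 - S) * (r + q ^ 2 / R - η - q ^ 2 / (2 * R ^ 2))) +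
      (θ * ((1 - S) * (q / R))) ^ 2 / 2 = -(θ * η) := by
    have h1 : S * η = δ + (S - 1) * r + (S - 1) * q ^ 2 / (2 * R) := by
      rw [hηdef, etaEZ, ← hq]; field_simp
    have h2 : θ * (1 - S) = 1 - R := hR1.symm
    have h3 : (θ * ((1 - S) * (q / R))) ^ 2 / 2 =
        θ * (1 - S) * (1 - R) * (q ^ 2 / (2 * R ^ 2)) := by
      rw [← mul_assoc, h2]; field_simp
    have h4 : q ^ 2 / R - q ^ 2 / (2 * R ^ 2) + (1 - R) * (q ^ 2 / (2 * R ^ 2)) =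
        q ^ 2 / (2 * R) := by
      field_simp; ring
    rw [h3]
    have h5 : (S - 1) * q ^ 2 / (2 * R) = (S - 1) * (q ^ 2 / (2 * R)) := by ring
    rw [h5] at h1
    linear_combination θ * (1 - S) * h4 + θ * h1
  refine ⟨_, hB.memLHat h𝓕 (M := θ * b * (η * x) ^ (1 - S)) (α := (1 - S) * (q / R))
    (γ := -δ + (1 - S) * (r + q ^ 2 / R - η - q ^ 2 / (2 * R ^ 2))) (by positivity)
    (by rw [hκ]; exact neg_lt_zero.2 (mul_pos hθ hη)), ?_⟩
  filter_upwards [hB.ae_contVersion_eq] with ω hω t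
  rw [Real.coe_toNNReal _ (by positivity), hω t, candidateC, wealthConst, ← hηdef, ← hq,
    ← mul_assoc, Real.mul_rpow (by positivity) (Real.exp_pos _).le, ← Real.exp_mul]
  have h1 : q / (σ * R) * σ = q / R := by field_simp
  have h2 : q / (σ * R) * (μ - r) = q ^ 2 / R := by
    have : μ - r = q * σ := by rw [hq]; field_simp
    rw [this]; field_simp
  have h3 : (q / (σ * R)) ^ 2 * σ ^ 2 / 2 = q ^ 2 / (2 * R ^ 2) := by field_simp
  rw [h1, h2, h3]
  have h4 : Real.exp ((1 - S) * (q / R) * B t ω +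
      (-δ + (1 - S) * (r + q ^ 2 / R - η - q ^ 2 / (2 * R ^ 2))) * t) = Real.exp (-δ * t) *
      Real.exp ((q / R * B t ω + (r + q ^ 2 / R - η - q ^ 2 / (2 * R ^ 2)) * t) * (1 - S)) := by
    rw [← Real.exp_add]; congr 1; ring
  rw [h4]
  ring

/-- Consumption streams `C` with `C^{1-S} ≤ K Ĉ^{1-S}` are uniquely evaluable. -/
theorem uniquelyEvaluable_of_le_candidateC (h𝓕 : IsStochasticBasis 𝓕 P) {θ b δ R S r μ σ x : ℝ}
    (hθ : θ ∈ Ioo (0 : ℝ) 1) (hb : 0 < b) (hR : 0 < R) (hR1 : R ≠ 1) (hS : 0 < S) (hS1 : S ≠ 1)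
    (hRS : (1 - R) / (1 - S) = θ) (hσ : 0 < σ) (hx : 0 < x) (hη : 0 < etaEZ δ R S r μ σ)
    {B : ℝ≥0 → Ω → ℝ} (hB : IsFBrownian 𝓕 P B) {C : ℝ≥0 → Ω → ℝ≥0} (hC : IsProgressive 𝓕 C)
    {K : ℝ≥0} (hCK : ∀ᵐ ω ∂P, ∀ t, (C t ω : ℝ≥0∞) ^ (1 - S) ≤
      K * ENNReal.ofReal (candidateC δ R S r μ σ x B t ω) ^ (1 - S)) :
    UniquelyEvaluable 𝓕 P (domEZ R) (gEZ b δ R S) C := by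
  have hρ : (θ - 1) / θ < 0 := div_neg_of_neg_of_pos (by linarith [hθ.2]) hθ.1
  have hρeq : (S - R) / (1 - R) = (θ - 1) / θ := by
    have h1 : 1 - S ≠ 0 := sub_ne_zero.2 hS1.symm
    have h2 : 1 - R ≠ 0 := sub_ne_zero.2 hR1.symm
    rw [← hRS]; field_simp; ring
  have hcand : ∀ t ω, 0 < candidateC δ R S r μ σ x B t ω := fun t ω =>
    mul_pos hη (mul_pos hx (Real.exp_pos _))
  have hCK' : ∀ᵐ ω ∂P, ∀ t, (C t ω : ℝ≥0∞) ^ (1 - S) ≤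
      (K * (candidateC δ R S r μ σ x B t ω ^ (1 - S)).toNNReal : ℝ≥0) := by
    filter_upwards [hCK] with ω hω t
    refine (hω t).trans (le_of_eq ?_)
    rw [ENNReal.ofReal_rpow_of_pos (hcand t ω), ENNReal.coe_mul]
    rfl
  -- For `S > 1` this says that `C` stays positive; it follows from the domination, since `Ĉ > 0`.
  have hCt : ∀ᵐ ω ∂P, ∀ t, (C t ω : ℝ≥0∞) ^ (1 - S) ≠ ∞ := by
    filter_upwards [hCK'] with ω hω t using ne_top_of_le_ne_top ENNReal.coe_ne_top (hω t)
  obtain ⟨Λ, hΛ, hΛeq⟩ := exists_memLHat_candidateC h𝓕 hθ.1 hb hR hS hS1 hRS hσ hx hη hB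
  have hU := isProgressive_coeffEZ (θ := θ) (b := b) (δ := δ) (S := S) hC
  have hUK : ∀ᵐ ω ∂P, ∀ t, coeffEZ θ b δ S C t ω ≤ K * Λ t ω := by
    filter_upwards [hCK', hΛeq] with ω h1 h2 t
    have h3 : ((C t ω : ℝ≥0∞) ^ (1 - S)).toNNReal ≤
        K * (candidateC δ R S r μ σ x B t ω ^ (1 - S)).toNNReal :=
      ENNReal.toNNReal_mono ENNReal.coe_ne_top (h1 t)
    have hθ0 := hθ.1
    have h4 : Λ t ω = (θ * b * Real.exp (-δ * t)).toNNReal *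
        (candidateC δ R S r μ σ x B t ω ^ (1 - S)).toNNReal := by
      rw [← Real.toNNReal_mul (by positivity), ← h2 t, Real.toNNReal_coe]
    rw [h4, mul_left_comm]
    exact mul_le_mul_right h3 _
  constructor
  · obtain ⟨X, hX, hint⟩ := exists_isCadlagTailExp_mul_rpow h𝓕 hθ hΛ hU hUK
    rw [← hρeq] at hX hint
    exact ⟨_, hX.isUtilityProcess hR1 hb hθ.1 hRS hC hCt hint⟩
  · intro V V' hV hV'
    obtain ⟨X, hX, hint, hXV⟩ := hV.exists_isCadlagTailExp h𝓕 hR1 hb hθ.1 hRS hC hCt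
    obtain ⟨X', hX', hint', hXV'⟩ := hV'.exists_isCadlagTailExp h𝓕 hR1 hb hθ.1 hRS hC hCt
    filter_upwards [hXV, hXV', hX.indistinguishable_of_mul_rpow (hρeq ▸ hρ.le) hU hX' hint hint']
      with ω h1 h2 h3 t
    refine mul_left_cancel₀ (sub_ne_zero.2 hR1.symm) ?_
    rw [h1 t, h2 t, h3 t]

end Main

end

end EpsteinZin

theorem mainTheorem7 {Ω : Type*} {m : MeasurableSpace Ω} (P : Measure Ω) [IsProbabilityMeasure P]
    (𝓕 : Filtration ℝ≥0 m) (h𝓕 : IsStochasticBasis 𝓕 P)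
    (θ : ℝ) (hθ : θ ∈ Ioo (0 : ℝ) 1) :
    (∀ Λ : ℝ≥0 → Ω → ℝ≥0, MemLHat 𝓕 P θ Λ →
      ∀ U : ℝ≥0 → Ω → ℝ≥0, IsProgressive 𝓕 U →
      ∀ K : ℝ≥0, (∀ᵐ ω ∂P, ∀ t, U t ω ≤ K * Λ t ω) →
        ∃ W : ℝ≥0 → Ω → ℝ≥0∞,
          IsFixedPointFU 𝓕 P ((θ - 1) / θ) (fun t ω => (U t ω : ℝ≥0∞)) W ∧
          ∀ W' : ℝ≥0 → Ω → ℝ≥0∞,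
            IsFixedPointFU 𝓕 P ((θ - 1) / θ) (fun t ω => (U t ω : ℝ≥0∞)) W' →
            Indistinguishable P W' W) ∧
    (∀ b δ R S r μ σ x : ℝ, 0 < b → 0 < R → R ≠ 1 → 0 < S → S ≠ 1 → (1 - R) / (1 - S) = θ →
      0 < σ → 0 < x → 0 < etaEZ δ R S r μ σ →
      ∀ B : ℝ≥0 → Ω → ℝ, IsFBrownian 𝓕 P B →
      ∀ C : ℝ≥0 → Ω → ℝ≥0, IsProgressive 𝓕 C →
      ∀ K : ℝ≥0, (∀ᵐ ω ∂P, ∀ t, (C t ω : ℝ≥0∞) ^ (1 - S) ≤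
          K * ENNReal.ofReal (candidateC δ R S r μ σ x B t ω) ^ (1 - S)) →
        UniquelyEvaluable 𝓕 P (domEZ R) (gEZ b δ R S) C) := by
  refine ⟨fun Λ hΛ U hU K hUK => exists_unique_isFixedPointFU h𝓕 hθ hΛ hU hUK, ?_⟩
  intro b δ R S r μ σ x hb hR hR1 hS hS1 hRS hσ hx hη B hB C hC K hCK
  exact uniquelyEvaluable_of_le_candidateC h𝓕 hθ hb hR hR1 hS hS1 hRS hσ hx hη hB hC hCK
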